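/- Let $\Sigma$ be a compact $C^\infty$ Riemannian manifold without boundary, with Riemannian volume measure $d\mathrm{vol}$, and let $\pi:V\to\Sigma$ be a $C^\infty$ real vector bundle of finite rank with a $C^\infty$ fiber metric. Fix $C^\infty$ connections on $T\Sigma$ and on $V$ (for example the Levi-Civita connection and a metric connection), let $\nabla^i\xi$ be the resulting $i$-th covariant derivative of a smooth section $\xi$ of $V$, and let $|\nabla^i\xi|$ be its pointwise Hilbert–Schmidt norm. For integers $k\ge 0$ and $p\ge 1$ let $L_k^p(\Sigma,V)$ be the completion of the space of $C^\infty$ sections of $V$ in the norm $$\|\xi\|_{k,p}=\Big(\sum_{i\le k}\int_\Sigma|\nabla^i\xi|^p\,d\mathrm{vol}\Big)^{1/p}.$$ Let $G$ be a (finite-dimensional) Lie group acting smoothly on $\Sigma$ by diffeomorphisms, and suppose that the action is lifted to a smooth action on $V$ by linear isomorphisms between the fibers (for the trivial bundle one can take the trivial lift). For $g\in G$ and a section $\xi$ of $V$ put $(g\cdot\xi)(x)=g^{-1}\big(\xi(gx)\big)$, that is, $\xi(gx)$ with the fiber $V_{gx}$ identified with $V_x$ through the lift. Let $p$ be a positive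 even integer and $k\ge 0$. Then, for every $g\in G$, the map $\xi\mapsto g\cdot\xi$ on smooth sections extends to a continuous map $\Psi(g,\cdot)$ of $L_k^p(\Sigma,V)$ to itself, and the function $$F:G\times L_k^p(\Sigma,V)\to\mathbb R,\qquad F(g,\xi)=\|\Psi(g,\xi)\|_{k,p}^p,$$ is $C^\infty$ on the product of the Lie group $G$ with the Banach space $L_k^p(\Sigma,V)$. (In particular this holds when $\Sigma$ is oriented and $G$ preserves the orientation; neither is needed, since the integrals are taken against the Riemannian volume measure.) -/

import Mathlib

open Bundle MeasureTheory
open scoped Manifold ContDiff Topology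

set_option linter.unusedSectionVars false

noncomputable section

namespace SobolevAction

section Tensor

variable
  {E : Type*} [NormedAddCommGroup E] [NormedSpace ℝ E] [FiniteDimensional ℝ E]
  {H : Type*} [TopologicalSpace H] {I : ModelWithCorners ℝ E H}
  {M : Type*} [TopologicalSpace M] [ChartedSpace H M] [IsManifold I ∞ M]
  {F : Type*} [NormedAddCommGroup F] [NormedSpace ℝ F]
  {V : M → Type*} [TopologicalSpace (TotalSpace F V)]
  [∀ x, NormedAddCommGroup (V x)] [∀ x, InnerProductSpace ℝ (V x)]
  [FiberBundle F V] [VectorBundle ℝ F V]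

/-- The covariant derivative of a field `T` of `i`-linear maps `TM × ⋯ × TM → V`:
`(∇T)(v₀, v₁, …, vᵢ) = ∇_{v₀} (T(X₁, …, Xᵢ)) - ∑ⱼ T(v₁, …, ∇_{v₀} Xⱼ, …, vᵢ)`,
where `Xⱼ` is a local smooth vector field with value `vⱼ` at the given point. -/
def covDerivTensor (covT : CovariantDerivative I E (fun x : M => TangentSpace I x))
    (covV : CovariantDerivative I F V) {i : ℕ}
    (T : ∀ x : M, (Fin i → TangentSpace I x) → V x) :
    ∀ x : M, (Fin (i + 1) → TangentSpace I x) → V x :=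
  fun x v =>
    covV (fun y => T y fun j => FiberBundle.extend E (v j.succ) y) x (v 0)
      - ∑ j, T x (Function.update (fun l => v l.succ) j
          (covT (FiberBundle.extend E (v j.succ)) x (v 0)))

/-- The iterated covariant derivative `∇ⁱ ξ`, a field of `i`-linear maps `TM × ⋯ × TM → V`. -/
def iterCovDeriv (covT : CovariantDerivative I E (fun x : M => TangentSpace I x))
    (covV : CovariantDerivative I F V) (ξ : ∀ x : M, V x) :
    ∀ (i : ℕ) (x : M), (Fin i → TangentSpace I x) → V x
  | 0 => fun x _ => ξ x
  | i + 1 => covDerivTensor covT covV (iterCovDeriv covT covV ξ i)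

variable (I) in
/-- The local frame of `TM` around `x₀`. -/
def tframe (x₀ : M) (a : Fin (Module.finrank ℝ E)) (x : M) :
    TangentSpace I x :=
  (trivializationAt E (TangentSpace I : M → Type _) x₀).localFrame (Module.finBasis ℝ E) a x

variable (I) in
def tbase (x₀ : M) : Set M :=
  (trivializationAt E (TangentSpace I : M → Type _) x₀).baseSet

lemma isOpen_tbase (x₀ : M) : IsOpen (tbase I x₀) :=
  (trivializationAt E (TangentSpace I : M → Type _) x₀).open_baseSet

lemma mem_tbase (x₀ : M) : x₀ ∈ tbase I x₀ :=
  FiberBundle.mem_baseSet_trivializationAt' x₀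

lemma contMDiffOn_tframe (x₀ : M) (a) : CMDiff[tbase I x₀] ∞ (T% (tframe I x₀ a)) :=
  (trivializationAt E (TangentSpace I : M → Type _) x₀).contMDiffOn_localFrame_baseSet
    ∞ (Module.finBasis ℝ E) a

/-- A field of multilinear maps whose components in local frames of `TM` are smooth. -/
structure IsSmoothTensor {i : ℕ} (T : ∀ x : M, (Fin i → TangentSpace I x) → V x) : Prop where
  add : ∀ x v j (a b : TangentSpace I x), T x (Function.update v j (a + b)) =
    T x (Function.update v j a) + T x (Function.update v j b)
  smul : ∀ x v j (c : ℝ) (a : TangentSpace I x), T x (Function.update v j (c • a)) =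
    c • T x (Function.update v j a)
  smooth : ∀ x₀ (a : Fin i → Fin (Module.finrank ℝ E)),
    CMDiff[tbase I x₀] ∞ (T% fun y => T y (fun j => tframe I x₀ (a j) y))

/-- The tensor at a point as a multilinear map. -/
def IsSmoothTensor.toMulti {i : ℕ} {T : ∀ x : M, (Fin i → TangentSpace I x) → V x}
    (hT : IsSmoothTensor (F := F) T) (x : M) :
    MultilinearMap ℝ (fun _ : Fin i => TangentSpace I x) (V x) where
  toFun := T x
  map_update_add' v j a b := by
    rename_i inst
    have : inst = instDecidableEqFin i := Subsingleton.elim _ _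
    subst this
    exact hT.add x v j a b
  map_update_smul' v j c a := by
    rename_i inst
    have : inst = instDecidableEqFin i := Subsingleton.elim _ _
    subst this
    exact hT.smul x v j c a

lemma IsSmoothTensor.expand {i : ℕ} {T : ∀ x : M, (Fin i → TangentSpace I x) → V x}
    (hT : IsSmoothTensor (F := F) T) (x : M) {ι : Type*} [Fintype ι] [DecidableEq ι]
    (c : Fin i → ι → ℝ) (e : ι → TangentSpace I x) :
    T x (fun j => ∑ a, c j a • e a) = ∑ b : Fin i → ι, (∏ j, c j (b j)) • T x (fun j => e (b j)) := by
  have h := (hT.toMulti x).map_sum (fun j a => c j a • e a)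
  have h2 : ∀ b : Fin i → ι, (hT.toMulti x) (fun j => c j (b j) • e (b j))
      = (∏ j, c j (b j)) • (hT.toMulti x) (fun j => e (b j)) := fun b =>
    (hT.toMulti x).map_smul_univ _ _
  rw [Finset.sum_congr rfl fun b _ => h2 b] at h
  exact h

variable (I) in
/-- Coefficients in the local frame. -/
def tcoeff (x₀ : M) (X : ∀ x : M, TangentSpace I x)
    (a : Fin (Module.finrank ℝ E)) (x : M) : ℝ :=
  (trivializationAt E (TangentSpace I : M → Type _) x₀).localFrameCoeff I
    (Module.finBasis ℝ E) a x (X x)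

lemma eq_sum_tcoeff (x₀ : M) (X : ∀ x : M, TangentSpace I x) {x : M} (hx : x ∈ tbase I x₀) :
    X x = ∑ a, tcoeff I x₀ X a x • tframe I x₀ a x :=
  Bundle.Trivialization.eq_sum_localFrameCoeff_smul (I := I)
    (e := trivializationAt E (TangentSpace I : M → Type _) x₀) (s := X)
    (b := Module.finBasis ℝ E) hx

lemma IsSmoothTensor.eventually_expand {i : ℕ} {T : ∀ x : M, (Fin i → TangentSpace I x) → V x}
    (hT : IsSmoothTensor (F := F) T) (x₀ : M) (X : Fin i → ∀ x : M, TangentSpace I x) {x : M}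
    (hx : x ∈ tbase I x₀) : T x (fun j => X j x) =
      ∑ b : Fin i → Fin (Module.finrank ℝ E), (∏ j, tcoeff I x₀ (X j) (b j) x) •
        T x (fun j => tframe I x₀ (b j) x) := by
  rw [← hT.expand x (fun j a => tcoeff I x₀ (X j) a x) (fun a => tframe I x₀ a x)]
  congr 1
  funext j
  exact eq_sum_tcoeff x₀ (X j) hx

lemma mdifferentiableAt_prod_real {ι : Type*} {s : Finset ι} {f : ι → M → ℝ} {x : M}
    (h : ∀ j, MDiffAt (f j) x) : MDiffAt (fun y => ∏ j ∈ s, f j y) x := by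
  classical
  induction s using Finset.induction_on with
  | empty => simpa using mdifferentiableAt_const
  | insert a s ha ih =>
    simp only [Finset.prod_insert ha]
    exact (h a).mul ih

lemma IsSmoothTensor.mdiff {i : ℕ} {T : ∀ x : M, (Fin i → TangentSpace I x) → V x}
    (hT : IsSmoothTensor (F := F) T) {x₀ : M} {X : Fin i → ∀ x : M, TangentSpace I x}
    (hX : ∀ j, MDiffAt (T% (X j)) x₀) : MDiffAt (T% fun y => T y (fun j => X j y)) x₀ := by
  have key : MDiffAt (T% fun y => ∑ b : Fin i → Fin (Module.finrank ℝ E),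
      (∏ j, tcoeff I x₀ (X j) (b j) y) • T y (fun j => tframe I x₀ (b j) y)) x₀ := by
    refine MDifferentiableAt.sum_section fun b _ => ?_
    refine MDifferentiableAt.smul_section (s := fun y => T y (fun j => tframe I x₀ (b j) y)) ?_ ?_
    · have : ∀ j, MDiffAt (tcoeff I x₀ (X j) (b j)) x₀ := fun j =>
        mdifferentiableAt_localFrameCoeff (I := I) (Module.finBasis ℝ E)
          (mem_tbase (I := I) x₀) (hX j) (b j)
      exact mdifferentiableAt_prod_real fun j => this j
    · exact ((hT.smooth x₀ b).contMDiffAt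
        ((isOpen_tbase (I := I) x₀).mem_nhds (mem_tbase x₀))).mdifferentiableAt (by simp)
  refine key.congr_of_eventuallyEq ?_
  filter_upwards [(isOpen_tbase (I := I) x₀).mem_nhds (mem_tbase x₀)] with y hy
  rw [hT.eventually_expand x₀ X hy]

lemma IsSmoothTensor.contMDiffOn {i : ℕ} {T : ∀ x : M, (Fin i → TangentSpace I x) → V x}
    (hT : IsSmoothTensor (F := F) T) {x₀ : M} {X : Fin i → ∀ x : M, TangentSpace I x}
    (hX : ∀ j, CMDiff[tbase I x₀] ∞ (T% (X j))) :
    CMDiff[tbase I x₀] ∞ (T% fun y => T y (fun j => X j y)) := by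
  have key : CMDiff[tbase I x₀] ∞ (T% fun y => ∑ b : Fin i → Fin (Module.finrank ℝ E),
      (∏ j, tcoeff I x₀ (X j) (b j) y) • T y (fun j => tframe I x₀ (b j) y)) := by
    refine ContMDiffOn.sum_section fun b _ => ?_
    refine ContMDiffOn.smul_section (s := fun y => T y (fun j => tframe I x₀ (b j) y)) ?_
      (hT.smooth x₀ b)
    have : ∀ j, CMDiff[tbase I x₀] ∞ (tcoeff I x₀ (X j) (b j)) := fun j =>
      contMDiffOn_baseSet_localFrameCoeff (I := I) (Module.finBasis ℝ E) (hX j) (b j)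
    exact contMDiffOn_finsetProd fun j _ => this j
  refine key.congr fun y hy => ?_
  rw [hT.eventually_expand x₀ X hy]

lemma contMDiffOn_cov {V : M → Type*} [TopologicalSpace (TotalSpace F V)]
    [∀ x, AddCommGroup (V x)] [∀ x, Module ℝ (V x)] [∀ x, TopologicalSpace (V x)]
    [∀ x, IsTopologicalAddGroup (V x)] [∀ x, ContinuousSMul ℝ (V x)]
    [FiberBundle F V] [VectorBundle ℝ F V] [T2Space M] [ContMDiffVectorBundle ∞ F V I]
    (covV : CovariantDerivative I F V)
    [hc : CovariantDerivative.ContMDiffCovariantDerivative covV ∞]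
    {U : Set M} (hU : IsOpen U) {σ : ∀ x : M, V x} (hσ : CMDiff[U] ∞ (T% σ))
    {X : ∀ x : M, TangentSpace I x} (hX : CMDiff[U] ∞ (T% X)) :
    CMDiff[U] ∞ (T% fun y => covV σ y (X y)) := by
  intro x hx
  obtain ⟨χ, -, hχ⟩ := (SmoothBumpFunction.nhds_basis_tsupport (I := I) x).mem_iff.1 (hU.mem_nhds hx)
  have h1 : CMDiff ∞ (T% ((χ : M → ℝ) • σ)) :=
    ContMDiffOn.smul_section_of_tsupport (I := I) (χ.contMDiff.contMDiffOn) hU hχ hσ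
  have h2 := hc.contMDiff.contMDiff (σ := (χ : M → ℝ) • σ) h1.contMDiffOn
  have h3 : CMDiffAt[U] ∞ (T% fun y => covV ((χ : M → ℝ) • σ) y (X y)) x :=
    ContMDiffWithinAt.clm_bundle_apply ((h2 x trivial).mono (Set.subset_univ U)) (hX x hx)
  have h4 : ∀ᶠ y in 𝓝 x, covV σ y = covV ((χ : M → ℝ) • σ) y := by
    filter_upwards [χ.eventuallyEq_one.eventually_nhds, hU.mem_nhds hx] with y hy hyU
    refine covV.isCovariantDerivativeOnUniv.congr_of_eventuallyEq
      ((hσ.contMDiffAt (hU.mem_nhds hyU)).mdifferentiableAt (by simp))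
      (h1.mdifferentiable (by simp) y) Filter.univ_mem ?_
    filter_upwards [hy] with z hz
    simp [hz]
  refine h3.congr_of_eventuallyEq ?_ ?_
  · filter_upwards [nhdsWithin_le_nhds h4] with y hy
    rw [hy]
  · rw [h4.self_of_nhds]

/-- `∇_w (T(X)) - ∑ⱼ T(…, ∇_w Xⱼ, …)` for vector fields `X`. -/
def covField (covT : CovariantDerivative I E (fun x : M => TangentSpace I x))
    (covV : CovariantDerivative I F V) {i : ℕ}
    (T : ∀ x : M, (Fin i → TangentSpace I x) → V x)
    (X : Fin i → ∀ x : M, TangentSpace I x) (x : M) (w : TangentSpace I x) : V x :=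
  covV (fun y => T y fun j => X j y) x w
    - ∑ j, T x (Function.update (fun l => X l x) j (covT (X j) x w))

lemma update_field {i : ℕ} (X : Fin i → ∀ x : M, TangentSpace I x) (m : Fin i)
    (Z : ∀ x : M, TangentSpace I x) (y : M) :
    (fun j => Function.update X m Z j y) = Function.update (fun j => X j y) m (Z y) := by
  funext j
  by_cases h : j = m
  · subst h; simp
  · simp [h]

section

variable (covT : CovariantDerivative I E (fun x : M => TangentSpace I x))
    (covV : CovariantDerivative I F V) {i : ℕ}
    {T : ∀ x : M, (Fin i → TangentSpace I x) → V x}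

lemma IsSmoothTensor.tensorialAt (hT : IsSmoothTensor (F := F) T)
    {x : M} {X : Fin i → ∀ x : M, TangentSpace I x}
    (hX : ∀ j, MDiffAt (T% (X j)) x) (w : TangentSpace I x) (m : Fin i) :
    TensorialAt I E (fun Y : ∀ x : M, TangentSpace I x =>
      covField covT covV T (Function.update X m Y) x w) x := by
  have hup : ∀ {σ : ∀ x : M, TangentSpace I x}, MDiffAt (T% σ) x →
      MDiffAt (T% fun y => T y (fun j => Function.update X m σ j y)) x := by
    intro σ hσ
    refine hT.mdiff fun j => ?_
    by_cases h : j = m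
    · subst h; simpa using hσ
    · simpa [h] using hX j
  constructor
  · intro f σ hf hσ
    have e1 : (fun y => T y fun j => Function.update X m (f • σ) j y) =
        f • (fun y => T y fun j => Function.update X m σ j y) := by
      funext y
      rw [update_field]
      simp only [Pi.smul_apply']
      rw [hT.smul, update_field]
    have e2 : ∀ j, T x (Function.update (fun l => Function.update X m (f • σ) l x) j
          (covT (Function.update X m (f • σ) j) x w)) =
        f x • T x (Function.update (fun l => Function.update X m σ l x) j
          (covT (Function.update X m σ j) x w)) +
        if j = m then (d% f x w) • T x (fun l => Function.update X m σ l x) else 0 := by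
      intro j
      simp only [update_field]
      by_cases h : j = m
      · subst h
        simp only [Function.update_self, Function.update_idem, if_true]
        rw [covT.isCovariantDerivativeOnUniv.leibniz hσ hf]
        simp only [add_apply, smul_apply,
          ContinuousLinearMap.smulRight_apply]
        rw [hT.add, hT.smul, hT.smul]
      · simp only [Function.update_of_ne h, if_neg h, add_zero, Pi.smul_apply']
        rw [Function.update_comm (Ne.symm h), hT.smul, Function.update_comm (Ne.symm h)]
    simp only [covField]
    rw [e1, covV.isCovariantDerivativeOnUniv.leibniz (hup hσ) hf, Finset.sum_congr rfl fun j _ => e2 j,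
      Finset.sum_add_distrib, ← Finset.smul_sum]
    simp only [Finset.sum_ite_eq', Finset.mem_univ, if_true, add_apply,
      smul_apply, ContinuousLinearMap.smulRight_apply, smul_sub]
    abel
  · intro σ σ' hσ hσ'
    have e1 : (fun y => T y fun j => Function.update X m (σ + σ') j y) =
        (fun y => T y fun j => Function.update X m σ j y) +
        (fun y => T y fun j => Function.update X m σ' j y) := by
      funext y
      simp only [Pi.add_apply, update_field]
      rw [hT.add]
    have e2 : ∀ j, T x (Function.update (fun l => Function.update X m (σ + σ') l x) j
          (covT (Function.update X m (σ + σ') j) x w)) =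
        T x (Function.update (fun l => Function.update X m σ l x) j
          (covT (Function.update X m σ j) x w)) +
        T x (Function.update (fun l => Function.update X m σ' l x) j
          (covT (Function.update X m σ' j) x w)) := by
      intro j
      simp only [update_field]
      by_cases h : j = m
      · subst h
        simp only [Function.update_self, Function.update_idem]
        rw [covT.isCovariantDerivativeOnUniv.add hσ hσ']
        simp only [add_apply]
        rw [hT.add]
      · simp only [Function.update_of_ne h, Pi.add_apply]
        rw [Function.update_comm (Ne.symm h), hT.add, Function.update_comm h, Function.update_comm h]
    simp only [covField]
    rw [e1, covV.isCovariantDerivativeOnUniv.add (hup hσ) (hup hσ'),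
      Finset.sum_congr rfl fun j _ => e2 j, Finset.sum_add_distrib]
    simp only [add_apply]
    abel

lemma IsSmoothTensor.covField_congr (hT : IsSmoothTensor (F := F) T)
    {x : M} {X X' : Fin i → ∀ x : M, TangentSpace I x}
    (hX : ∀ j, MDiffAt (T% (X j)) x) (hX' : ∀ j, MDiffAt (T% (X' j)) x)
    (h : ∀ j, X j x = X' j x) (w : TangentSpace I x) :
    covField covT covV T X x w = covField covT covV T X' x w := by
  classical
  have key : ∀ s : Finset (Fin i), covField covT covV T (fun l => if l ∈ s then X' l else X l) x w =
      covField covT covV T X x w := by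
    intro s
    induction s using Finset.induction_on with
    | empty => simp
    | insert m s hm ih =>
      rw [← ih]
      set Y : Fin i → ∀ x : M, TangentSpace I x := fun l => if l ∈ s then X' l else X l with hY
      have hYd : ∀ j, MDiffAt (T% (Y j)) x := by
        intro j
        by_cases hj : j ∈ s
        · simpa [hY, hj] using hX' j
        · simpa [hY, hj] using hX j
      have e1 : (fun l => if l ∈ insert m s then X' l else X l) = Function.update Y m (X' m) := by
        funext l
        by_cases hl : l = m
        · subst hl; simp
        · simp [hY, hl]
      have e2 : Y = Function.update Y m (X m) := by
        funext l
        by_cases hl : l = m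
        · subst hl; simp [hY, hm]
        · simp [hl]
      rw [e1]
      conv_rhs => rw [e2]
      exact (hT.tensorialAt covT covV hYd w m).pointwise (hX' m) (hX m) (h m).symm
  rw [← key Finset.univ]
  simp

lemma IsSmoothTensor.covDerivTensor_eq (hT : IsSmoothTensor (F := F) T)
    {x : M} {X : Fin i → ∀ x : M, TangentSpace I x}
    (hX : ∀ j, MDiffAt (T% (X j)) x) (v : Fin (i + 1) → TangentSpace I x)
    (h : ∀ j, X j x = v j.succ) :
    covDerivTensor covT covV T x v = covField covT covV T X x (v 0) := by
  rw [← hT.covField_congr covT covV (X := fun j => FiberBundle.extend E (v j.succ))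
    (fun j => FiberBundle.mdifferentiableAt_extend I E _) hX (by simp [h])]
  simp [covDerivTensor, covField]

lemma IsSmoothTensor.covDeriv [T2Space M] [ContMDiffVectorBundle ∞ F V I]
    [hcT : CovariantDerivative.ContMDiffCovariantDerivative covT ∞]
    [hcV : CovariantDerivative.ContMDiffCovariantDerivative covV ∞]
    (hT : IsSmoothTensor (F := F) T) :
    IsSmoothTensor (F := F) (covDerivTensor covT covV T) := by
  have hext : ∀ {x : M} (v : Fin (i + 1) → TangentSpace I x) (j : Fin i),
      MDiffAt (T% (FiberBundle.extend E (v j.succ))) x := fun v j =>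
    FiberBundle.mdifferentiableAt_extend I E _
  constructor
  · intro x v j a b
    refine Fin.cases ?_ (fun m => ?_) j
    · simp only [covDerivTensor, Function.update_self, ne_eq, Fin.succ_ne_zero, not_false_eq_true,
        Function.update_of_ne, map_add, hT.add, Finset.sum_add_distrib]
      abel
    · set X : Fin i → ∀ x : M, TangentSpace I x := fun j => FiberBundle.extend E (v j.succ)
      have hX : ∀ j, MDiffAt (T% (X j)) x := fun j => hext v j
      have ha : MDiffAt (T% (FiberBundle.extend E a : ∀ x : M, TangentSpace I x)) x :=
        FiberBundle.mdifferentiableAt_extend I E _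
      have hb : MDiffAt (T% (FiberBundle.extend E b : ∀ x : M, TangentSpace I x)) x :=
        FiberBundle.mdifferentiableAt_extend I E _
      have hgen : ∀ (Z : ∀ x : M, TangentSpace I x), MDiffAt (T% Z) x →
          covDerivTensor covT covV T x (Function.update v m.succ (Z x)) =
          covField covT covV T (Function.update X m Z) x (v 0) := by
        intro Z hZ
        rw [hT.covDerivTensor_eq covT covV (X := Function.update X m Z)]
        · simp [(Fin.succ_ne_zero m).symm]
        · intro l
          by_cases hl : l = m
          · subst hl; simpa using hZ
          · simpa [hl] using hX l
        · intro l
          by_cases hl : l = m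
          · subst hl; simp
          · simp [hl, X]
      have := (hT.tensorialAt covT covV hX (v 0) m).add ha hb
      rw [← hgen _ ha, ← hgen _ hb, ← hgen _ (mdifferentiableAt_add_section ha hb)] at this
      simpa using this
  · intro x v j c a
    refine Fin.cases ?_ (fun m => ?_) j
    · simp only [covDerivTensor, Function.update_self, ne_eq, Fin.succ_ne_zero, not_false_eq_true,
        Function.update_of_ne, map_smul, hT.smul, smul_sub, Finset.smul_sum]
    · set X : Fin i → ∀ x : M, TangentSpace I x := fun j => FiberBundle.extend E (v j.succ)
      have hX : ∀ j, MDiffAt (T% (X j)) x := fun j => hext v j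
      have ha : MDiffAt (T% (FiberBundle.extend E a : ∀ x : M, TangentSpace I x)) x :=
        FiberBundle.mdifferentiableAt_extend I E _
      have hgen : ∀ (Z : ∀ x : M, TangentSpace I x), MDiffAt (T% Z) x →
          covDerivTensor covT covV T x (Function.update v m.succ (Z x)) =
          covField covT covV T (Function.update X m Z) x (v 0) := by
        intro Z hZ
        rw [hT.covDerivTensor_eq covT covV (X := Function.update X m Z)]
        · simp [(Fin.succ_ne_zero m).symm]
        · intro l
          by_cases hl : l = m
          · subst hl; simpa using hZ
          · simpa [hl] using hX l
        · intro l
          by_cases hl : l = m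
          · subst hl; simp
          · simp [hl, X]
      have := (hT.tensorialAt covT covV hX (v 0) m).smul (f := fun _ => c) mdifferentiableAt_const ha
      rw [← hgen _ ha, ← hgen _ (mdifferentiableAt_const.smul_section ha)] at this
      simpa using this
  · intro x₀ a
    have hfr : ∀ b, CMDiff[tbase I x₀] ∞ (T% (tframe I x₀ b)) := contMDiffOn_tframe x₀
    have hfd : ∀ b, ∀ y ∈ tbase I x₀, MDiffAt (T% (tframe I x₀ b)) y := fun b y hy =>
      ((hfr b).contMDiffAt ((isOpen_tbase x₀).mem_nhds hy)).mdifferentiableAt (by simp)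
    have key : CMDiff[tbase I x₀] ∞ (T% fun y => covField covT covV T
        (fun j => tframe I x₀ (a j.succ)) y (tframe I x₀ (a 0) y)) := by
      refine ContMDiffOn.sub_section ?_ (ContMDiffOn.sum_section fun j _ => ?_)
      · exact contMDiffOn_cov covV (isOpen_tbase x₀) (hT.smooth x₀ fun j => a j.succ) (hfr _)
      · have := hT.contMDiffOn (x₀ := x₀) (X := Function.update (fun j => tframe I x₀ (a j.succ)) j
          (fun y => covT (tframe I x₀ (a j.succ)) y (tframe I x₀ (a 0) y))) ?_
        · simpa only [update_field] using this
        · intro l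
          by_cases hl : l = j
          · subst hl
            simpa using contMDiffOn_cov covT (isOpen_tbase x₀) (hfr _) (hfr _)
          · simpa [hl] using hfr _
    refine key.congr fun y hy => ?_
    rw [hT.covDerivTensor_eq covT covV (X := fun j => tframe I x₀ (a j.succ))
      (fun j => hfd _ y hy) _ (fun j => rfl)]

end


section

variable (covT : CovariantDerivative I E (fun x : M => TangentSpace I x))
    (covV : CovariantDerivative I F V) [T2Space M] [ContMDiffVectorBundle ∞ F V I]
    [CovariantDerivative.ContMDiffCovariantDerivative covT ∞]
    [CovariantDerivative.ContMDiffCovariantDerivative covV ∞]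

lemma isSmoothTensor_iterCovDeriv {ξ : ∀ x : M, V x} (hξ : CMDiff ∞ (T% ξ)) (i : ℕ) :
    IsSmoothTensor (F := F) (iterCovDeriv covT covV ξ i) := by
  induction i with
  | zero => exact ⟨fun _ _ j => j.elim0, fun _ _ j => j.elim0, fun _ _ => hξ.contMDiffOn⟩
  | succ i ih => exact ih.covDeriv covT covV

lemma iterCovDeriv_add {ξ η : ∀ x : M, V x} (hξ : CMDiff ∞ (T% ξ)) (hη : CMDiff ∞ (T% η)) (i : ℕ) :
    iterCovDeriv covT covV (ξ + η) i = iterCovDeriv covT covV ξ i + iterCovDeriv covT covV η i := by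
  induction i with
  | zero => rfl
  | succ i ih =>
    funext x v
    have h1 := (isSmoothTensor_iterCovDeriv covT covV hξ i).mdiff
      (X := fun j => FiberBundle.extend E (v j.succ))
      (fun j => FiberBundle.mdifferentiableAt_extend I E _)
    have h2 := (isSmoothTensor_iterCovDeriv covT covV hη i).mdiff
      (X := fun j => FiberBundle.extend E (v j.succ))
      (fun j => FiberBundle.mdifferentiableAt_extend I E _)
    have h3 := covV.isCovariantDerivativeOnUniv.add h1 h2
    simp only [iterCovDeriv, covDerivTensor, ih, Pi.add_apply, Finset.sum_add_distrib]
    have h4 : covV (fun y => (iterCovDeriv covT covV ξ i y fun j => FiberBundle.extend E (v j.succ) y) +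
      (iterCovDeriv covT covV η i y fun j => FiberBundle.extend E (v j.succ) y)) x = _ := h3
    rw [h4, add_apply]
    abel

lemma iterCovDeriv_smul {ξ : ∀ x : M, V x} (hξ : CMDiff ∞ (T% ξ)) (c : ℝ) (i : ℕ) :
    iterCovDeriv covT covV (c • ξ) i = c • iterCovDeriv covT covV ξ i := by
  induction i with
  | zero => rfl
  | succ i ih =>
    funext x v
    have h1 := (isSmoothTensor_iterCovDeriv covT covV hξ i).mdiff
      (X := fun j => FiberBundle.extend E (v j.succ))
      (fun j => FiberBundle.mdifferentiableAt_extend I E _)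
    have h3 := covV.isCovariantDerivativeOnUniv.smul_const c h1
    simp only [iterCovDeriv, covDerivTensor, ih, Pi.smul_apply, smul_sub, Finset.smul_sum]
    have h4 : covV (fun y => c • (iterCovDeriv covT covV ξ i y
      fun j => FiberBundle.extend E (v j.succ) y)) x = _ := h3
    rw [h4, smul_apply]

end

section Norm

variable [RiemannianBundle (fun x : M => TangentSpace I x)]

instance (x : M) : FiniteDimensional ℝ (TangentSpace I x) :=
  inferInstanceAs (FiniteDimensional ℝ E)

/-- The pointwise (Hilbert–Schmidt) norm at `x` of a field `T` of `i`-linear maps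
`TM × ⋯ × TM → V`: the square root of `∑ |T(e_{a₁}, …, e_{aᵢ})|²` over all choices of `i` elements
of an orthonormal basis of the tangent space at `x`. -/
def tensorNorm {i : ℕ} (T : ∀ x : M, (Fin i → TangentSpace I x) → V x) (x : M) : ℝ :=
  √(∑ a : Fin i → Fin (Module.finrank ℝ (TangentSpace I x)),
    ‖T x fun j => stdOrthonormalBasis ℝ (TangentSpace I x) (a j)‖ ^ 2)

lemma tensorNorm_nonneg {i : ℕ} (T : ∀ x : M, (Fin i → TangentSpace I x) → V x) (x : M) :
    0 ≤ tensorNorm T x := Real.sqrt_nonneg _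

lemma tensorNorm_eq_toLp {i : ℕ} (T : ∀ x : M, (Fin i → TangentSpace I x) → V x) (x : M) :
    tensorNorm T x = ‖WithLp.toLp 2
      (fun a : Fin i → Fin (Module.finrank ℝ (TangentSpace I x)) =>
        T x fun j => stdOrthonormalBasis ℝ (TangentSpace I x) (a j))‖ := by
  rw [PiLp.norm_eq_of_L2]
  rfl

lemma tensorNorm_add_le {i : ℕ} (T S : ∀ x : M, (Fin i → TangentSpace I x) → V x) (x : M) :
    tensorNorm (T + S) x ≤ tensorNorm T x + tensorNorm S x := by
  simp only [tensorNorm_eq_toLp]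
  exact norm_add_le (WithLp.toLp 2 (fun a : Fin i → Fin (Module.finrank ℝ (TangentSpace I x)) =>
        T x fun j => stdOrthonormalBasis ℝ (TangentSpace I x) (a j))) (WithLp.toLp 2 (fun a => S x
        fun j => stdOrthonormalBasis ℝ (TangentSpace I x) (a j)))

lemma tensorNorm_smul {i : ℕ} (c : ℝ) (T : ∀ x : M, (Fin i → TangentSpace I x) → V x) (x : M) :
    tensorNorm (c • T) x = |c| * tensorNorm T x := by
  simp only [tensorNorm_eq_toLp]
  exact norm_smul c (WithLp.toLp 2 (fun a : Fin i → Fin (Module.finrank ℝ (TangentSpace I x)) =>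
        T x fun j => stdOrthonormalBasis ℝ (TangentSpace I x) (a j)))

lemma localFrameCoeff_tframe (x₀ : M) {x : M} (hx : x ∈ tbase I x₀) (a b) :
    (trivializationAt E (TangentSpace I : M → Type _) x₀).localFrameCoeff I
      (Module.finBasis ℝ E) a x (tframe I x₀ b x) = if b = a then 1 else 0 := by
  rw [Bundle.Trivialization.localFrameCoeff_apply_of_mem_baseSet _ _ hx]
  rw [tframe, Bundle.Trivialization.localFrame_apply_of_mem_baseSet _ _ hx, Module.Basis.repr_self,
    Finsupp.single_apply]

/-- Gram matrix of the local frame. -/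
def gram (x₀ x : M) : Matrix (Fin (Module.finrank ℝ E)) (Fin (Module.finrank ℝ E)) ℝ :=
  fun a b => inner ℝ (tframe I x₀ a x) (tframe I x₀ b x)

lemma tensorNorm_eq_frame {i : ℕ} {T : ∀ x : M, (Fin i → TangentSpace I x) → V x}
    (hT : IsSmoothTensor (F := F) T) (x₀ : M) {x : M} (hx : x ∈ tbase I x₀) :
    IsUnit (gram (I := I) x₀ x).det ∧ tensorNorm T x = √(∑ b : Fin i → Fin (Module.finrank ℝ E),
      ∑ b' : Fin i → Fin (Module.finrank ℝ E), (∏ j, (gram (I := I) x₀ x)⁻¹ (b j) (b' j)) *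
        inner ℝ (T x fun j => tframe I x₀ (b j) x) (T x fun j => tframe I x₀ (b' j) x)) := by
  set e := stdOrthonormalBasis ℝ (TangentSpace I x) with he
  set c : Fin (Module.finrank ℝ E) → (TangentSpace I x →ₗ[ℝ] ℝ) := fun a =>
    (trivializationAt E (TangentSpace I : M → Type _) x₀).localFrameCoeff I
      (Module.finBasis ℝ E) a x with hc
  set s : Fin (Module.finrank ℝ E) → TangentSpace I x := fun a => tframe I x₀ a x with hs
  have hcs : ∀ a b, c a (s b) = if b = a then 1 else 0 := localFrameCoeff_tframe x₀ hx
  have hexp : ∀ v : TangentSpace I x, v = ∑ a, c a v • s a := by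
    intro v
    have := eq_sum_tcoeff (I := I) x₀ (FiberBundle.extend E v) hx
    simpa only [tcoeff, FiberBundle.extend_apply_self] using this
  set P : Matrix (Fin (Module.finrank ℝ E)) (Fin (Module.finrank ℝ E)) ℝ :=
    fun b b' => ∑ k, c b (e k) * c b' (e k) with hP
  have hGP : gram (I := I) x₀ x * P = 1 := by
    ext a b'
    rw [Matrix.mul_apply]
    have h1 : s a = ∑ k, inner ℝ (e k) (s a) • e k := (e.sum_repr' (s a)).symm
    have h2 : c b' (s a) = ∑ k, inner ℝ (e k) (s a) * c b' (e k) := by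
      conv_lhs => rw [h1]
      simp
    have h3 : ∀ k, inner ℝ (e k) (s a) = ∑ b, c b (e k) * inner ℝ (s a) (s b) := by
      intro k
      rw [real_inner_comm]
      conv_lhs => rw [hexp (e k)]
      rw [inner_sum]
      simp [inner_smul_right]
    rw [hcs] at h2
    rw [Matrix.one_apply, h2]
    simp only [h3, hP, Finset.mul_sum, Finset.sum_mul]
    rw [Finset.sum_comm]
    refine Finset.sum_congr rfl fun k _ => Finset.sum_congr rfl fun b _ => ?_
    simp only [gram, hs]
    ring
  refine ⟨(Matrix.isUnit_iff_isUnit_det _).1 (IsUnit.of_mul_eq_one _ hGP), ?_⟩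
  rw [Matrix.inv_eq_right_inv hGP, tensorNorm]
  congr 1
  have h4 : ∀ a : Fin i → Fin (Module.finrank ℝ (TangentSpace I x)),
      T x (fun j => e (a j)) = ∑ b : Fin i → Fin (Module.finrank ℝ E),
        (∏ j, c (b j) (e (a j))) • T x (fun j => s (b j)) := by
    intro a
    rw [← hT.expand x (fun j b => c b (e (a j))) s]
    congr 1
    funext j
    exact hexp _
  have h5 : ∀ a : Fin i → Fin (Module.finrank ℝ (TangentSpace I x)),
      ‖T x (fun j => e (a j))‖ ^ 2 = ∑ b : Fin i → Fin (Module.finrank ℝ E),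
        ∑ b' : Fin i → Fin (Module.finrank ℝ E), (∏ j, c (b j) (e (a j)) * c (b' j) (e (a j))) *
          inner ℝ (T x fun j => s (b j)) (T x fun j => s (b' j)) := by
    intro a
    rw [← real_inner_self_eq_norm_sq, h4, sum_inner]
    refine Finset.sum_congr rfl fun b _ => ?_
    rw [inner_sum]
    refine Finset.sum_congr rfl fun b' _ => ?_
    rw [real_inner_smul_left, real_inner_smul_right, Finset.prod_mul_distrib]
    ring
  rw [Finset.sum_congr rfl fun a _ => h5 a, Finset.sum_comm]
  refine Finset.sum_congr rfl fun b _ => ?_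
  rw [Finset.sum_comm]
  refine Finset.sum_congr rfl fun b' _ => ?_
  rw [← Finset.sum_mul]
  congr 1
  simp only [hP]
  rw [Finset.prod_univ_sum]
  simp

lemma continuous_tensorNorm [ContMDiffVectorBundle ∞ F V I] [IsContMDiffRiemannianBundle I ∞ F V]
    [IsContMDiffRiemannianBundle I ∞ E (fun x : M => TangentSpace I x)]
    {i : ℕ} {T : ∀ x : M, (Fin i → TangentSpace I x) → V x}
    (hT : IsSmoothTensor (F := F) T) : Continuous (tensorNorm T) := by
  rw [continuous_iff_continuousAt]
  intro x₀
  have hU := (isOpen_tbase (I := I) x₀).mem_nhds (mem_tbase x₀)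
  have hG : ContinuousOn (gram (I := I) x₀) (tbase I x₀) := by
    refine continuousOn_pi.2 fun a => continuousOn_pi.2 fun b => ?_
    obtain ⟨g, hg, hgi⟩ := IsContMDiffRiemannianBundle.exists_contMDiff (IB := I) (n := ∞) (F := E)
      (E := fun x : M => TangentSpace I x)
    have h1 : ContMDiffOn I (I.prod 𝓘(ℝ)) ∞ (fun m => TotalSpace.mk' ℝ (E := Bundle.Trivial M ℝ) m
        (g m (tframe I x₀ a m) (tframe I x₀ b m))) (tbase I x₀) :=
      ContMDiffOn.clm_bundle_apply₂ (F₁ := E) (F₂ := E) hg.contMDiffOn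
        (contMDiffOn_tframe x₀ a) (contMDiffOn_tframe x₀ b)
    have h2 : ContMDiffOn I 𝓘(ℝ) ∞ (fun m =>
        (g m (tframe I x₀ a m) (tframe I x₀ b m))) (tbase I x₀) := by
      intro x hx
      have := h1 x hx
      simp only [contMDiffWithinAt_totalSpace] at this
      exact this.2
    refine h2.continuousOn.congr fun x hx => ?_
    exact hgi x _ _
  have hGi : ContinuousOn (fun x => (gram (I := I) x₀ x)⁻¹) (tbase I x₀) := by
    simp only [Matrix.inv_def]
    refine ContinuousOn.fun_smul ?_ ?_
    · simp only [Ring.inverse_eq_inv']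
      exact ContinuousOn.inv₀ ((continuous_id.matrix_det).comp_continuousOn hG)
        fun x hx => (tensorNorm_eq_frame hT x₀ hx).1.ne_zero
    · exact (continuous_id.matrix_adjugate).comp_continuousOn hG
  have key : ContinuousOn (tensorNorm T) (tbase I x₀) := by
    refine ContinuousOn.congr ?_ fun x hx => (tensorNorm_eq_frame hT x₀ hx).2
    refine Real.continuous_sqrt.comp_continuousOn ?_
    refine continuousOn_finsetSum _ fun b _ => continuousOn_finsetSum _ fun b' _ => ?_
    refine ContinuousOn.mul ?_ ?_
    · refine continuousOn_finsetProd _ fun j _ => ?_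
      exact continuousOn_pi.1 (continuousOn_pi.1 hGi (b j)) (b' j)
    · exact (ContMDiffOn.inner_bundle (IB := I) (n := ∞) (hT.smooth x₀ b)
        (hT.smooth x₀ b')).continuousOn
  exact key.continuousAt hU

end Norm

end Tensor
section Measure

variable {n : ℕ} {M : Type*} [TopologicalSpace M] [ChartedSpace (EuclideanSpace ℝ (Fin n)) M]
  [RiemannianBundle (fun x : M => TangentSpace (𝓡 n) x)]

/-- The `i`-th coordinate vector field of the chart at `c`, at the point with coordinates `y`. -/
def coordVec (c : M) (y : EuclideanSpace ℝ (Fin n)) (i : Fin n) :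
    TangentSpace (𝓡 n) ((extChartAt (𝓡 n) c).symm y) :=
  mfderiv (𝓡 n) (𝓡 n) (extChartAt (𝓡 n) c).symm y (EuclideanSpace.single i (1 : ℝ))

/-- The matrix `(gᵢⱼ)` of the Riemannian metric in the chart at `c`, as a function of the
coordinates. -/
def metricMatrix (c : M) (y : EuclideanSpace ℝ (Fin n)) : Matrix (Fin n) (Fin n) ℝ :=
  fun i j => inner ℝ (coordVec c y i) (coordVec c y j)

variable [MeasurableSpace M]

variable (n) in
/-- The Riemannian volume `√(det gᵢⱼ) dy` of the domain of the chart at `c`. -/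
def chartVolume (c : M) : Measure M :=
  ((volume.restrict (extChartAt (𝓡 n) c).target).withDensity
    fun y => ENNReal.ofReal (√(metricMatrix c y).det)).map (extChartAt (𝓡 n) c).symm

variable [IsManifold (𝓡 n) ∞ M] [T2Space M] [CompactSpace M]

variable (n M) in
/-- A smooth partition of unity subordinate to the chart domains. -/
def chartPartition : SmoothPartitionOfUnity M (𝓡 n) M Set.univ :=
  (SmoothPartitionOfUnity.exists_isSubordinate_chartAt_source (𝓡 n) M).choose

lemma chartPartition_isSubordinate : (chartPartition n M).IsSubordinate
    fun x => (chartAt (EuclideanSpace ℝ (Fin n)) x).source :=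
  (SmoothPartitionOfUnity.exists_isSubordinate_chartAt_source (𝓡 n) M).choose_spec

variable (n M) in
/-- The Riemannian volume measure of the compact manifold `M`, glued from the chart volumes by a
partition of unity (the result does not depend on the partition of unity). -/
def riemannianVolume : Measure M :=
  Measure.sum fun c : M =>
    (chartVolume n c).withDensity fun x => ENNReal.ofReal (chartPartition n M c x)

variable [IsContMDiffRiemannianBundle (𝓡 n) ∞ (EuclideanSpace ℝ (Fin n))
    (fun x : M => TangentSpace (𝓡 n) x)]

lemma continuousOn_metricMatrix (c : M) :
    ContinuousOn (metricMatrix c) (extChartAt (𝓡 n) c).target := by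
  obtain ⟨g, hg, hgi⟩ := IsContMDiffRiemannianBundle.exists_contMDiff (IB := 𝓡 n) (n := ∞)
    (F := EuclideanSpace ℝ (Fin n)) (E := fun x : M => TangentSpace (𝓡 n) x)
  set t := trivializationAt (EuclideanSpace ℝ (Fin n)) (TangentSpace (𝓡 n) : M → Type _) c with ht
  have htb : t.baseSet = (chartAt (EuclideanSpace ℝ (Fin n)) c).source :=
    TangentBundle.trivializationAt_baseSet c
  let s : Fin n → ∀ x : M, TangentSpace (𝓡 n) x :=
    fun i x => t.symmL ℝ x (EuclideanSpace.single i (1 : ℝ))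
  have hs : ∀ i, ContMDiffOn (𝓡 n) ((𝓡 n).prod 𝓘(ℝ, EuclideanSpace ℝ (Fin n))) ∞
      (fun x => TotalSpace.mk' (EuclideanSpace ℝ (Fin n)) (E := (TangentSpace (𝓡 n) : M → Type _))
        x (s i x)) t.baseSet := by
    intro i
    rw [t.contMDiffOn_section_baseSet_iff]
    refine (contMDiffOn_const (c := EuclideanSpace.single i (1 : ℝ))).congr fun x hx => ?_
    simp [s, hx]
  have h2 : ∀ i j, ContinuousOn (fun x => g x (s i x) (s j x)) t.baseSet := by
    intro i j
    have h1 : ContMDiffOn (𝓡 n) ((𝓡 n).prod 𝓘(ℝ)) ∞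
        (fun m => TotalSpace.mk' ℝ (E := Bundle.Trivial M ℝ) m (g m (s i m) (s j m))) t.baseSet :=
      ContMDiffOn.clm_bundle_apply₂ (F₁ := EuclideanSpace ℝ (Fin n))
        (F₂ := EuclideanSpace ℝ (Fin n)) hg.contMDiffOn (hs i) (hs j)
    have h2 : ContMDiffOn (𝓡 n) 𝓘(ℝ) ∞ (fun m => g m (s i m) (s j m)) t.baseSet := by
      intro x hx
      have := h1 x hx
      simp only [contMDiffWithinAt_totalSpace] at this
      exact this.2
    exact h2.continuousOn
  refine continuousOn_pi.2 fun i => continuousOn_pi.2 fun j => ?_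
  have h3 : ContinuousOn (fun y => g ((extChartAt (𝓡 n) c).symm y)
      (s i ((extChartAt (𝓡 n) c).symm y)) (s j ((extChartAt (𝓡 n) c).symm y)))
      (extChartAt (𝓡 n) c).target := by
    refine (h2 i j).comp (continuousOn_extChartAt_symm c) fun y hy => ?_
    rw [htb, ← extChartAt_source (𝓡 n)]
    exact (extChartAt (𝓡 n) c).map_target hy
  refine h3.congr fun y hy => ?_
  have hy' : (extChartAt (𝓡 n) c).symm y ∈ (chartAt (EuclideanSpace ℝ (Fin n)) c).source := by
    rw [← extChartAt_source (𝓡 n)]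
    exact (extChartAt (𝓡 n) c).map_target hy
  have h4 : ∀ i, coordVec c y i = s i ((extChartAt (𝓡 n) c).symm y) := by
    intro i
    simp only [s, ht]
    rw [TangentBundle.symmL_trivializationAt hy', (extChartAt (𝓡 n) c).right_inv hy]
    simp only [coordVec, modelWithCornersSelf_coe, Set.range_id, mfderivWithin_univ]
    rfl
  change inner ℝ (coordVec c y i) (coordVec c y j) = g _ _ _
  rw [← h4, ← h4, hgi]

variable [BorelSpace M]

lemma chartVolume_lt_top (c : M) {K : Set M} (hK : IsCompact K) (hK' : IsClosed K)
    (hKc : K ⊆ (chartAt (EuclideanSpace ℝ (Fin n)) c).source) : chartVolume n c K < ⊤ := by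
  by_cases hf : AEMeasurable (extChartAt (𝓡 n) c).symm
      ((volume.restrict (extChartAt (𝓡 n) c).target).withDensity
        fun y => ENNReal.ofReal (√(metricMatrix c y).det))
  swap
  · rw [chartVolume, Measure.map_of_not_aemeasurable hf]
    simp
  rw [chartVolume, Measure.map_apply_of_aemeasurable hf hK'.measurableSet]
  rw [← extChartAt_source (𝓡 n)] at hKc
  set L := extChartAt (𝓡 n) c '' K with hL
  have hLc : IsCompact L := hK.image_of_continuousOn ((continuousOn_extChartAt c).mono hKc)
  have hLt : L ⊆ (extChartAt (𝓡 n) c).target := by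
    rintro _ ⟨x, hx, rfl⟩
    exact (extChartAt (𝓡 n) c).map_source (hKc hx)
  have hto : IsOpen (extChartAt (𝓡 n) c).target := isOpen_extChartAt_target c
  have hsub : (extChartAt (𝓡 n) c).symm ⁻¹' K ⊆ L ∪ (extChartAt (𝓡 n) c).targetᶜ := by
    intro y hy
    by_cases hyt : y ∈ (extChartAt (𝓡 n) c).target
    · exact Or.inl ⟨_, hy, (extChartAt (𝓡 n) c).right_inv hyt⟩
    · exact Or.inr hyt
  refine (measure_mono hsub).trans_lt ((measure_union_le _ _).trans_lt ?_)
  refine ENNReal.add_lt_top.2 ⟨?_, ?_⟩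
  · rw [withDensity_apply _ hLc.measurableSet]
    have hcont : ContinuousOn (fun y => √(metricMatrix c y).det) L :=
      Real.continuous_sqrt.comp_continuousOn
        ((continuous_id.matrix_det).comp_continuousOn ((continuousOn_metricMatrix c).mono hLt))
    obtain ⟨C, hC⟩ := (hLc.image_of_continuousOn hcont).bddAbove
    calc ∫⁻ y in L, ENNReal.ofReal (√(metricMatrix c y).det)
          ∂(volume.restrict (extChartAt (𝓡 n) c).target)
        ≤ ∫⁻ y in L, ENNReal.ofReal C ∂(volume.restrict (extChartAt (𝓡 n) c).target) :=
          setLIntegral_mono' hLc.measurableSet fun y hy =>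
            ENNReal.ofReal_le_ofReal (hC ⟨y, hy, rfl⟩)
      _ = ENNReal.ofReal C * (volume.restrict (extChartAt (𝓡 n) c).target) L := by
          simp
      _ < ⊤ := ENNReal.mul_lt_top ENNReal.ofReal_lt_top
          ((Measure.restrict_apply_le _ _).trans_lt hLc.measure_lt_top)
  · have : ((volume.restrict (extChartAt (𝓡 n) c).target).withDensity
        fun y => ENNReal.ofReal (√(metricMatrix c y).det)) (extChartAt (𝓡 n) c).targetᶜ = 0 := by
      refine withDensity_absolutelyContinuous _ _ ?_
      rw [Measure.restrict_apply hto.measurableSet.compl]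
      simp
    rw [this]
    simp

instance : IsFiniteMeasure (riemannianVolume n M) := by
  constructor
  have hfin : {c : M | (Function.support (chartPartition n M c)).Nonempty}.Finite :=
    (chartPartition n M).locallyFinite.finite_nonempty_of_compact
  have hle : ∀ c : M, ((chartVolume n c).withDensity
      fun x => ENNReal.ofReal (chartPartition n M c x)) Set.univ < ⊤ := by
    intro c
    rw [withDensity_apply _ MeasurableSet.univ, Measure.restrict_univ]
    set K := tsupport (chartPartition n M c) with hKdef
    have hKcl : IsClosed K := isClosed_tsupport _
    calc ∫⁻ x, ENNReal.ofReal (chartPartition n M c x) ∂(chartVolume n c)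
        ≤ ∫⁻ x, K.indicator 1 x ∂(chartVolume n c) := by
          refine lintegral_mono fun x => ?_
          by_cases hx : x ∈ K
          · simpa [hx] using (chartPartition n M).le_one c x
          · simp [image_eq_zero_of_notMem_tsupport hx]
      _ = chartVolume n c K := by rw [lintegral_indicator_one hKcl.measurableSet]
      _ < ⊤ := chartVolume_lt_top c hKcl.isCompact hKcl (chartPartition_isSubordinate c)
  rw [riemannianVolume, Measure.sum_apply _ MeasurableSet.univ,
    tsum_eq_sum (s := hfin.toFinset)]
  · exact ENNReal.sum_lt_top.2 fun c _ => hle c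
  · intro c hc
    have h0 : ∀ x, chartPartition n M c x = 0 := by
      intro x
      by_contra hx
      exact hc (hfin.mem_toFinset.2 ⟨x, hx⟩)
    simp [h0]

end Measure

section Sobolev

variable {n : ℕ} {M : Type*} [TopologicalSpace M] [ChartedSpace (EuclideanSpace ℝ (Fin n)) M]
  [IsManifold (𝓡 n) ∞ M] [T2Space M] [CompactSpace M] [MeasurableSpace M] [BorelSpace M]
  [RiemannianBundle (fun x : M => TangentSpace (𝓡 n) x)]
  [IsContMDiffRiemannianBundle (𝓡 n) ∞ (EuclideanSpace ℝ (Fin n))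
    (fun x : M => TangentSpace (𝓡 n) x)]
  {F : Type*} [NormedAddCommGroup F] [NormedSpace ℝ F]
  {V : M → Type*} [TopologicalSpace (TotalSpace F V)]
  [∀ x, NormedAddCommGroup (V x)] [∀ x, InnerProductSpace ℝ (V x)]
  [FiberBundle F V] [VectorBundle ℝ F V] [ContMDiffVectorBundle ∞ F V (𝓡 n)]
  [IsContMDiffRiemannianBundle (𝓡 n) ∞ F V]
  (covT : CovariantDerivative (𝓡 n) (EuclideanSpace ℝ (Fin n))
    (fun x : M => TangentSpace (𝓡 n) x))
  (covV : CovariantDerivative (𝓡 n) F V)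

/-- The `L_k^p`-norm `(∑_{i ≤ k} ∫ |∇ⁱ ξ|^p)^{1/p}` of a section `ξ` of `V`. -/
def sobolevNorm (k p : ℕ) (ξ : ∀ x : M, V x) : ℝ :=
  (∑ i ∈ Finset.range (k + 1),
    ∫ x, tensorNorm (iterCovDeriv covT covV ξ i) x ^ p ∂(riemannianVolume n M)) ^ (1 / (p : ℝ))

variable [CovariantDerivative.ContMDiffCovariantDerivative covT ∞]
    [CovariantDerivative.ContMDiffCovariantDerivative covV ∞]

lemma continuous_tensorNorm_iterCovDeriv {ξ : ∀ x : M, V x} (hξ : ContMDiff (𝓡 n) ((𝓡 n).prod 𝓘(ℝ, F)) ∞ (fun x => TotalSpace.mk' F x (ξ x))) (i : ℕ) :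
    Continuous (tensorNorm (iterCovDeriv covT covV ξ i)) :=
  continuous_tensorNorm (isSmoothTensor_iterCovDeriv covT covV hξ i)

lemma memLp_tensorNorm {ξ : ∀ x : M, V x} (hξ : ContMDiff (𝓡 n) ((𝓡 n).prod 𝓘(ℝ, F)) ∞ (fun x => TotalSpace.mk' F x (ξ x))) (i : ℕ) (q : ENNReal) :
    MemLp (tensorNorm (iterCovDeriv covT covV ξ i)) q (riemannianVolume n M) :=
  (continuous_tensorNorm_iterCovDeriv covT covV hξ i).memLp_of_hasCompactSupport
    (HasCompactSupport.of_compactSpace _)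

lemma sobolevNorm_eq {k p : ℕ} (hp : 1 ≤ p) {ξ : ∀ x : M, V x} (hξ : ContMDiff (𝓡 n) ((𝓡 n).prod 𝓘(ℝ, F)) ∞ (fun x => TotalSpace.mk' F x (ξ x))) :
    sobolevNorm covT covV k p ξ = (∑ i ∈ Finset.range (k + 1),
      lpNorm (tensorNorm (iterCovDeriv covT covV ξ i)) p (riemannianVolume n M) ^ (p : ℝ))
        ^ (1 / (p : ℝ)) := by
  have hp0 : (p : ℝ) ≠ 0 := by positivity
  rw [sobolevNorm]
  congr 1
  refine Finset.sum_congr rfl fun i _ => ?_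
  rw [lpNorm_eq_integral_norm_rpow_toReal (by exact_mod_cast (by omega : p ≠ 0)) (by simp)
    (memLp_tensorNorm covT covV hξ i p).1]
  simp only [ENNReal.toReal_natCast]
  rw [← Real.rpow_mul (by positivity), inv_mul_cancel₀ hp0, Real.rpow_one]
  refine integral_congr_ae (Filter.Eventually.of_forall fun x => ?_)
  simp only [Real.norm_of_nonneg (tensorNorm_nonneg _ _), Real.rpow_natCast]

lemma sobolevNorm_add_le {k p : ℕ} (hp : 1 ≤ p) {ξ η : ∀ x : M, V x} (hξ : ContMDiff (𝓡 n) ((𝓡 n).prod 𝓘(ℝ, F)) ∞ (fun x => TotalSpace.mk' F x (ξ x)))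
    (hη : ContMDiff (𝓡 n) ((𝓡 n).prod 𝓘(ℝ, F)) ∞ (fun x => TotalSpace.mk' F x (η x))) : sobolevNorm covT covV k p (ξ + η) ≤
      sobolevNorm covT covV k p ξ + sobolevNorm covT covV k p η := by
  have hp' : (1 : ℝ) ≤ p := by exact_mod_cast hp
  rw [sobolevNorm_eq covT covV hp hξ, sobolevNorm_eq covT covV hp hη,
    sobolevNorm_eq covT covV hp (hξ.add_section hη)]
  refine le_trans ?_ (Real.Lp_add_le_of_nonneg _ hp' (fun i _ => lpNorm_nonneg)
    (fun i _ => lpNorm_nonneg))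
  refine Real.rpow_le_rpow (Finset.sum_nonneg fun i _ => Real.rpow_nonneg lpNorm_nonneg _) ?_ (by positivity)
  refine Finset.sum_le_sum fun i _ => Real.rpow_le_rpow lpNorm_nonneg ?_ (by positivity)
  refine le_trans ?_ (lpNorm_add_le (memLp_tensorNorm covT covV hξ i p) (by exact_mod_cast hp))
  refine lpNorm_mono_real ((memLp_tensorNorm covT covV hξ i p).add
    (memLp_tensorNorm covT covV hη i p)) fun x => ?_
  rw [Real.norm_of_nonneg (tensorNorm_nonneg _ _), iterCovDeriv_add covT covV hξ hη]
  exact tensorNorm_add_le _ _ _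

lemma sobolevNorm_smul {k p : ℕ} (hp : 1 ≤ p) (c : ℝ) {ξ : ∀ x : M, V x} (hξ : ContMDiff (𝓡 n) ((𝓡 n).prod 𝓘(ℝ, F)) ∞ (fun x => TotalSpace.mk' F x (ξ x))) :
    sobolevNorm covT covV k p (c • ξ) = |c| * sobolevNorm covT covV k p ξ := by
  have hp0 : (p : ℝ) ≠ 0 := by positivity
  simp only [sobolevNorm, iterCovDeriv_smul covT covV hξ, tensorNorm_smul, mul_pow]
  simp only [integral_const_mul, ← Finset.mul_sum]
  rw [Real.mul_rpow (by positivity) (Finset.sum_nonneg fun i _ => integral_nonneg fun x =>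
    pow_nonneg (tensorNorm_nonneg _ _) _)]
  rw [← Real.rpow_natCast |c|, ← Real.rpow_mul (abs_nonneg c), mul_one_div_cancel hp0, Real.rpow_one]

/-- The space of smooth sections of `V`, to be equipped with the `L_k^p`-norm. -/
@[nolint unusedArguments]
def SmoothSections (_covT : CovariantDerivative (𝓡 n) (EuclideanSpace ℝ (Fin n))
    (fun x : M => TangentSpace (𝓡 n) x)) (_covV : CovariantDerivative (𝓡 n) F V)
    (_k _p : ℕ) : Type _ :=
  Cₛ^∞⟮𝓡 n; F, V⟯

/-- The `L_k^p`-norm on smooth sections. -/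
def sobolevSeminorm (k p : ℕ) [hp : Fact (1 ≤ p)] : Seminorm ℝ Cₛ^∞⟮𝓡 n; F, V⟯ :=
  Seminorm.of (fun ξ => sobolevNorm covT covV k p ξ)
    (fun ξ η => sobolevNorm_add_le covT covV hp.out ξ.contMDiff η.contMDiff)
    (fun c ξ => sobolevNorm_smul covT covV hp.out c ξ.contMDiff)

instance (k p : ℕ) [Fact (1 ≤ p)] : SeminormedAddCommGroup (SmoothSections covT covV k p) :=
  (sobolevSeminorm covT covV k p).toAddGroupSeminorm.toSeminormedAddCommGroup

instance (k p : ℕ) [Fact (1 ≤ p)] : NormedSpace ℝ (SmoothSections covT covV k p) where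
  toModule := inferInstanceAs (Module ℝ Cₛ^∞⟮𝓡 n; F, V⟯)
  norm_smul_le c ξ := (map_smul_eq_mul (sobolevSeminorm covT covV k p) c ξ).le

lemma norm_smoothSections (k p : ℕ) [Fact (1 ≤ p)] (ξ : SmoothSections covT covV k p) :
    ‖ξ‖ = sobolevNorm covT covV k p (show Cₛ^∞⟮𝓡 n; F, V⟯ from ξ) := rfl

/-- The Banach space `L_k^p(M, V)`: the completion of the smooth sections in the `L_k^p`-norm. -/
abbrev SobolevSpace (k p : ℕ) [Fact (1 ≤ p)] : Type _ :=
  UniformSpace.Completion (SmoothSections covT covV k p)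

end Sobolev

section Action

/-- A lift of a smooth action of `G` on `M` to a smooth action by linear isomorphisms between the
fibers of the vector bundle `V`. -/
structure BundleAction (n : ℕ) (EG : Type*) [NormedAddCommGroup EG] [NormedSpace ℝ EG]
    (G : Type*) [Group G] [TopologicalSpace G] [ChartedSpace EG G]
    {M : Type*} [TopologicalSpace M] [ChartedSpace (EuclideanSpace ℝ (Fin n)) M] [MulAction G M]
    (F : Type*) [NormedAddCommGroup F] [NormedSpace ℝ F]
    (V : M → Type*) [TopologicalSpace (TotalSpace F V)]
    [∀ x, NormedAddCommGroup (V x)] [∀ x, InnerProductSpace ℝ (V x)]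
    [FiberBundle F V] where
  /-- The isomorphism from the fiber at `x` to the fiber at `g • x`. -/
  act : ∀ (g : G) (x : M), V x ≃L[ℝ] V (g • x)
  act_one : ∀ (x : M) (v : V x), (⟨(1 : G) • x, act 1 x v⟩ : TotalSpace F V) = ⟨x, v⟩
  act_mul : ∀ (g h : G) (x : M) (v : V x),
    (⟨(g * h) • x, act (g * h) x v⟩ : TotalSpace F V) = ⟨g • h • x, act g (h • x) (act h x v)⟩
  contMDiff_act : ContMDiff (𝓘(ℝ, EG).prod ((𝓡 n).prod 𝓘(ℝ, F))) ((𝓡 n).prod 𝓘(ℝ, F)) ∞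
    fun q : G × TotalSpace F V => (⟨q.1 • q.2.proj, act q.1 q.2.proj q.2.2⟩ : TotalSpace F V)

variable {n : ℕ} {EG : Type*} [NormedAddCommGroup EG] [NormedSpace ℝ EG]
  {G : Type*} [Group G] [TopologicalSpace G] [ChartedSpace EG G]
  {M : Type*} [TopologicalSpace M] [ChartedSpace (EuclideanSpace ℝ (Fin n)) M]
  [MulAction G M] [ContMDiffSMul 𝓘(ℝ, EG) (𝓡 n) ∞ G M]
  {F : Type*} [NormedAddCommGroup F] [NormedSpace ℝ F]
  {V : M → Type*} [TopologicalSpace (TotalSpace F V)]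
  [∀ x, NormedAddCommGroup (V x)] [∀ x, InnerProductSpace ℝ (V x)]
  [FiberBundle F V] [VectorBundle ℝ F V]

/-- The pulled back section `x ↦ ξ(g x)`, where the fiber of `V` at `g x` is identified with the
fiber at `x` through the action of `g` on `V`. -/
def BundleAction.pullback (A : BundleAction n EG G F V) (g : G) (ξ : Cₛ^∞⟮𝓡 n; F, V⟯) :
    Cₛ^∞⟮𝓡 n; F, V⟯ where
  toFun x := (A.act g x).symm (ξ (g • x))
  contMDiff_toFun := by
    have h1 : ∀ (h : G), h = 1 → ∀ (x : M) (v : V x),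
        (⟨h • x, A.act h x v⟩ : TotalSpace F V) = ⟨x, v⟩ := by
      rintro _ rfl x v
      exact A.act_one x v
    have h2 : ∀ x : M, (⟨x, (A.act g x).symm (ξ (g • x))⟩ : TotalSpace F V) =
        ⟨g⁻¹ • g • x, A.act g⁻¹ (g • x) (ξ (g • x))⟩ := by
      intro x
      have := A.act_mul g⁻¹ g x ((A.act g x).symm (ξ (g • x)))
      rw [h1 _ (inv_mul_cancel g)] at this
      simpa using this
    have h3 : ContMDiff (𝓡 n) (𝓡 n) ∞ (fun x : M => g • x) :=
      (ContMDiffSMul.contMDiff_smul (I := 𝓘(ℝ, EG)) (G := G) (M := M)).comp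
        (contMDiff_const.prodMk contMDiff_id)
    have h4 := A.contMDiff_act.comp (contMDiff_const (c := g⁻¹) |>.prodMk (ξ.contMDiff.comp h3))
    refine h4.congr fun x => ?_
    exact h2 x

end Action

section InducedAction

variable {n : ℕ} {EG : Type*} [NormedAddCommGroup EG] [NormedSpace ℝ EG]
  {G : Type*} [Group G] [TopologicalSpace G] [ChartedSpace EG G]
  {M : Type*} [TopologicalSpace M] [ChartedSpace (EuclideanSpace ℝ (Fin n)) M]
  [IsManifold (𝓡 n) ∞ M] [T2Space M] [CompactSpace M] [MeasurableSpace M] [BorelSpace M]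
  [RiemannianBundle (fun x : M => TangentSpace (𝓡 n) x)]
  [IsContMDiffRiemannianBundle (𝓡 n) ∞ (EuclideanSpace ℝ (Fin n))
    (fun x : M => TangentSpace (𝓡 n) x)]
  [MulAction G M] [ContMDiffSMul 𝓘(ℝ, EG) (𝓡 n) ∞ G M]
  {F : Type*} [NormedAddCommGroup F] [NormedSpace ℝ F]
  {V : M → Type*} [TopologicalSpace (TotalSpace F V)]
  [∀ x, NormedAddCommGroup (V x)] [∀ x, InnerProductSpace ℝ (V x)]
  [FiberBundle F V] [VectorBundle ℝ F V] [ContMDiffVectorBundle ∞ F V (𝓡 n)]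
  [IsContMDiffRiemannianBundle (𝓡 n) ∞ F V]

variable (covT : CovariantDerivative (𝓡 n) (EuclideanSpace ℝ (Fin n))
    (fun x : M => TangentSpace (𝓡 n) x))
  [CovariantDerivative.ContMDiffCovariantDerivative covT ∞]
  (covV : CovariantDerivative (𝓡 n) F V)
  [CovariantDerivative.ContMDiffCovariantDerivative covV ∞]

/-- The pullback by `g` on smooth sections, as a map of the space with the `L_k^p`-norm. -/
def smoothAction (k p : ℕ) (A : BundleAction n EG G F V) (g : G) :
    SmoothSections covT covV k p → SmoothSections covT covV k p :=
  fun ξ => A.pullback g ξ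

/-- The action of `g` on `L_k^p(M, V)`: the extension of the pullback of smooth sections to the
completion. -/
def inducedAction (k p : ℕ) [Fact (1 ≤ p)] (A : BundleAction n EG G F V) (g : G) :
    SobolevSpace covT covV k p → SobolevSpace covT covV k p :=
  UniformSpace.Completion.map (smoothAction covT covV k p A g)

end InducedAction

end SobolevAction

end

/-! Differentiating `g · ξ` in `g` costs a derivative of `ξ`, so smoothness of `F` cannot be read
off from the action map on `L_k^p`. It comes from a change of variables under the integral. For
smooth `ξ`, substitute `x = g⁻¹ y` in `∫ |∇ⁱ(g · ξ)|^p dvol`. By the chain rule, the components of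
`∇ⁱ(g · ξ)` at `g⁻¹ y` are linear combinations of components of `∇ʲ ξ` at `y`, `j ≤ i`, with
coefficients smooth in `(g, y)` (`polyOp_movedJet`). As `p` is even, `|∇ⁱ(g · ξ)|^p` is a power of a
quadratic form, hence a homogeneous polynomial of degree `p` in these components
(`polyOp_tensorNorm_pow`). Jacobian, volume density and cut-offs are further smooth coefficients.
After the substitution `g` occurs in the coefficients only, and `ξ` is no longer moved.

What remains is a finite sum of integrals `∫_K c(g, y) v₁(y) ⋯ v_p(y) dy` over compact sets `K` in
charts. Each `vᵢ` is a component of some `∇ʲ ξ` with `j ≤ k`, hence a bounded linear function of `ξ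
∈ L_k^p` with values in `L^p(K)` (`IsControlled.exists_clm_jetCoord`). By Hölder the integral is a
continuous multilinear form in the `vᵢ` that depends continuously and linearly on the weight `c(g,
·) ∈ C(K)` (`hoelderFormL`), and `g ↦ c(g, ·)` is a smooth map into `C(K)` (`contDiffOn_paramMap`).
These facts meet in `PolyOp.exists_integral_eq`.

A partition of unity puts the pieces together: near each group element, `‖g · ξ‖^p = Λ(g)(ξ, …, ξ)`
for smooth sections, where `Λ` is a smooth map into the Banach space of continuous `p`-linear forms
on `L_k^p` (`exists_norm_smoothAction_pow_eq`). For fixed `g` this identity bounds `‖g · ξ‖` by a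
multiple of `‖ξ‖`, so the action extends to the completion. By density the identity extends too, and
`(g, ξ) ↦ Λ(g)(ξ, …, ξ)` is smooth. -/

noncomputable section

namespace SobolevAction

/-! ### Smooth functions of `(γ, z)` as smooth maps of `γ` into `C(K, H)` -/

section ParamMap

variable {P E H : Type*} [NormedAddCommGroup P] [NormedSpace ℝ P]
  [NormedAddCommGroup E] [NormedSpace ℝ E] [NormedAddCommGroup H] [NormedSpace ℝ H]

open Classical in
/-- The partial function `c (γ, ·)` on `K`, as a continuous map; zero if it is not continuous. -/
def paramMap (K : Set E) (c : P × E → H) (γ : P) : C(K, H) :=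
  if h : Continuous fun z : K => c (γ, z) then ⟨fun z => c (γ, z), h⟩ else 0

variable {N : Set P} {U K : Set E} {c : P × E → H}

lemma paramMap_apply (hc : ContinuousOn c (N ×ˢ U)) (hKU : K ⊆ U) {γ : P} (hγ : γ ∈ N) (z : K) :
    paramMap K c γ z = c (γ, z) := by
  have h : Continuous fun z : K => c (γ, z) :=
    hc.comp_continuous (by fun_prop) fun z => ⟨hγ, hKU z.2⟩
  simp [paramMap, h]

/-- Currying: `C(K, H)` carries the compact-open topology, so joint continuity on `N × K` is enough,
and compactness of `K` plays no role yet. -/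
lemma continuousOn_paramMap (hc : ContinuousOn c (N ×ˢ U)) (hKU : K ⊆ U) :
    ContinuousOn (paramMap K c) N := by
  rw [continuousOn_iff_continuous_domRestrict]
  have h : Continuous fun q : N × K => c (q.1, q.2) :=
    hc.comp_continuous (by fun_prop) fun q => ⟨q.1.2, hKU q.2.2⟩
  have h2 := (ContinuousMap.curry ⟨_, h⟩).continuous
  refine h2.congr fun γ => ?_
  ext z
  exact (paramMap_apply hc hKU γ.2 z).symm

variable [CompactSpace K]

variable (P H K) in
set_option synthInstance.maxHeartbeats 200000 in
/-- Interchange of the arguments of a continuous family of linear maps. -/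
def flipContinuousMap : C(K, P →L[ℝ] H) →L[ℝ] P →L[ℝ] C(K, H) :=
  LinearMap.mkContinuous₂
    (LinearMap.mk₂ ℝ (fun (f : C(K, P →L[ℝ] H)) (h : P) =>
      (⟨fun z => f z h, by fun_prop⟩ : C(K, H)))
      (fun f g h => by ext; simp) (fun a f h => by ext; simp)
      (fun f g h => by ext; simp) (fun a f h => by ext; simp)) 1 fun f h => by
    rw [one_mul, ContinuousMap.norm_le _ (by positivity)]
    intro z
    exact (ContinuousLinearMap.le_opNorm _ _).trans (by gcongr; exact f.norm_coe_le_norm z)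

lemma flipContinuousMap_apply (f : C(K, P →L[ℝ] H)) (h : P) (z : K) :
    flipContinuousMap P H K f h z = f z h := rfl

/-- The derivative in `γ` is itself a continuous map into `C(K, P →L[ℝ] H)`. Hence on a small ball
it stays within `ε` of its value at the centre for all `z ∈ K` at once, and the mean value
inequality gives a remainder that is uniform in `z`, which is what the sup norm asks for. -/
lemma hasFDerivAt_paramMap (hN : IsOpen N) (hKU : K ⊆ U)
    {c' : P × E → P →L[ℝ] H} (hc : ContinuousOn c (N ×ˢ U)) (hc' : ContinuousOn c' (N ×ˢ U))
    (hd : ∀ γ ∈ N, ∀ z ∈ U, HasFDerivAt (fun γ => c (γ, z)) (c' (γ, z)) γ) {γ : P} (hγ : γ ∈ N) :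
    HasFDerivAt (paramMap K c) (flipContinuousMap P H K (paramMap K c' γ)) γ := by
  have hcont := (continuousOn_paramMap hc' hKU).continuousAt (hN.mem_nhds hγ)
  rw [hasFDerivAt_iff_isLittleO, Asymptotics.isLittleO_iff]
  intro ε hε
  obtain ⟨δ, hδ, hball⟩ := Metric.mem_nhds_iff.1 (Filter.inter_mem (hN.mem_nhds hγ)
    (hcont (Metric.closedBall_mem_nhds _ hε)))
  filter_upwards [Metric.ball_mem_nhds γ hδ] with γ' hγ'
  rw [ContinuousMap.norm_le _ (by positivity)]
  intro z
  have hz := hKU z.2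
  have h1 := (convex_ball γ δ).norm_image_sub_le_of_norm_hasFDerivWithin_le' (𝕜 := ℝ)
    (f := fun γ => c (γ, z)) (f' := fun γ => c' (γ, z)) (φ := c' (γ, z)) (C := ε)
    (fun x hx => (hd x (hball hx).1 z hz).hasFDerivWithinAt) (fun x hx => ?_)
    (Metric.mem_ball_self hδ) hγ'
  · simpa [paramMap_apply hc hKU (hball hγ').1, paramMap_apply hc hKU hγ,
      flipContinuousMap_apply, paramMap_apply hc' hKU hγ] using h1
  · have h2 := (hball hx).2
    simp only [Set.mem_preimage, mem_closedBall_iff_norm] at h2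
    have h3 := (ContinuousMap.norm_coe_le_norm _ z).trans h2
    simpa [paramMap_apply hc' hKU (hball hx).1, paramMap_apply hc' hKU hγ] using h3

/-- Induction on `m` for all `c` simultaneously: the derivative in a direction `h` is again a
`paramMap`, namely of the smooth function `q ↦ fderiv ℝ c q (h, 0)`. Testing on single directions
suffices because `P` is finite-dimensional. -/
lemma contDiffOn_paramMap_nat [FiniteDimensional ℝ P] (hN : IsOpen N) (hU : IsOpen U) (hKU : K ⊆ U)
    (m : ℕ) : ∀ {c : P × E → H}, ContDiffOn ℝ ∞ c (N ×ˢ U) → ContDiffOn ℝ m (paramMap K c) N := by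
  have hNU := hN.prod hU
  have hder : ∀ {c : P × E → H}, ContDiffOn ℝ ∞ c (N ×ˢ U) → ∀ γ ∈ N,
      HasFDerivAt (paramMap K c) (flipContinuousMap P H K (paramMap K
        (fun q => (fderiv ℝ c q).comp (ContinuousLinearMap.inl ℝ P E)) γ)) γ := by
    intro c hc γ hγ
    refine hasFDerivAt_paramMap hN hKU hc.continuousOn ?_ ?_ hγ
    · exact ((hc.fderiv_of_isOpen hNU (m := ∞) (by simp)).clm_comp contDiffOn_const).continuousOn
    · intro γ hγ z hz
      have h1 : DifferentiableAt ℝ c (γ, z) :=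
        (hc.contDiffAt (hNU.mem_nhds ⟨hγ, hz⟩)).differentiableAt (by simp)
      exact h1.hasFDerivAt.comp γ (hasFDerivAt_prodMk_left γ z)
  induction m with
  | zero => exact fun hc => contDiffOn_zero.2 (continuousOn_paramMap hc.continuousOn hKU)
  | succ m ih =>
    intro c hc
    have : ((m + 1 : ℕ) : ℕ∞ω) = (m : ℕ∞ω) + 1 := by norm_cast
    rw [this, contDiffOn_succ_iff_fderiv_apply hN.uniqueDiffOn]
    refine ⟨fun γ hγ => (hder hc γ hγ).differentiableAt.differentiableWithinAt, by simp, fun h => ?_⟩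
    refine (ih (c := fun q => fderiv ℝ c q (h, 0)) ?_).congr fun γ hγ => ?_
    · exact (hc.fderiv_of_isOpen hNU (m := ∞) (by simp)).clm_apply contDiffOn_const
    · rw [fderivWithin_of_isOpen hN hγ, (hder hc γ hγ).fderiv]
      have hf := hc.fderiv_of_isOpen hNU (m := ∞) (by simp)
      ext z
      rw [flipContinuousMap_apply, paramMap_apply
        (hf.clm_comp contDiffOn_const).continuousOn hKU hγ,
        paramMap_apply (hf.clm_apply contDiffOn_const).continuousOn hKU hγ]
      simp

lemma contDiffOn_paramMap [FiniteDimensional ℝ P] (hN : IsOpen N) (hU : IsOpen U) (hKU : K ⊆ U)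
    (hc : ContDiffOn ℝ ∞ c (N ×ˢ U)) : ContDiffOn ℝ ∞ (paramMap K c) N :=
  contDiffOn_infty.2 fun m => contDiffOn_paramMap_nat hN hU hKU m hc

end ParamMap

/-! ### Hölder's inequality and weighted multilinear forms on `L^p` -/

section Hoelder

variable {X : Type*} [TopologicalSpace X] [CompactSpace X] [MeasurableSpace X] [BorelSpace X]
  {μ : Measure X} [IsFiniteMeasure μ] {p : ℕ} [Fact (1 ≤ p)]
  {B : Type*} [SeminormedAddCommGroup B] [NormedSpace ℝ B]

instance fact_one_le_natCast : Fact ((1 : ENNReal) ≤ (p : ENNReal)) :=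
  ⟨by exact_mod_cast (Fact.out : 1 ≤ p)⟩

/-- Hölder's inequality for `p` factors that all lie in `L^p`. It is applied to the functions `|f
m|^p` with weights `1/p`, and there are exactly `p` weights, so they sum to one. -/
lemma memLp_prod_of_memLp {f : Fin p → X → ℝ} (hf : ∀ m, MemLp (f m) p μ) :
    Integrable (fun x => ∏ m, f m x) μ ∧
      ∫ x, ‖∏ m, f m x‖ ∂μ ≤ ∏ m, (eLpNorm (f m) p μ).toReal := by
  have hp : 1 ≤ p := Fact.out
  have hp0 : (p : ℝ) ≠ 0 := by positivity
  have hmeas : AEStronglyMeasurable (fun x => ∏ m, f m x) μ :=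
    Finset.aestronglyMeasurable_fun_prod _ fun m _ => (hf m).1
  have hle : ∫⁻ x, ‖∏ m, f m x‖ₑ ∂μ ≤ ∏ m, eLpNorm (f m) p μ := by
    have h := ENNReal.lintegral_prod_norm_pow_le (μ := μ) Finset.univ
      (f := fun m x => ‖f m x‖ₑ ^ (p : ℝ)) (fun m _ => ((hf m).1.enorm).pow_const _)
      (p := fun _ => (p : ℝ)⁻¹) (by simp [hp0]) (fun _ _ => by positivity)
    refine le_trans (le_of_eq ?_) (h.trans (le_of_eq ?_))
    · refine lintegral_congr fun x => ?_
      rw [show ‖∏ m, f m x‖ₑ = ∏ m, ‖f m x‖ₑ by simp [enorm_eq_nnnorm, nnnorm_prod]]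
      refine Finset.prod_congr rfl fun m _ => ?_
      rw [← ENNReal.rpow_mul, mul_inv_cancel₀ hp0, ENNReal.rpow_one]
    · refine Finset.prod_congr rfl fun m _ => ?_
      rw [eLpNorm_eq_lintegral_rpow_enorm_toReal (by simpa using (by omega : p ≠ 0)) (by simp)]
      simp
  have hfin : ∏ m, eLpNorm (f m) p μ < ⊤ := ENNReal.prod_lt_top fun m _ => (hf m).2
  refine ⟨⟨hmeas, hle.trans_lt hfin⟩, ?_⟩
  rw [integral_norm_eq_lintegral_enorm hmeas, ← ENNReal.toReal_prod]
  exact ENNReal.toReal_mono hfin.ne hle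

lemma integrable_mul_prod (c : C(X, ℝ)) (f : Fin p → Lp ℝ p μ) :
    Integrable (fun x => c x * ∏ m, f m x) μ :=
  (memLp_prod_of_memLp fun m => Lp.memLp (f m)).1.bdd_mul
    (c := ‖c‖) c.continuous.aestronglyMeasurable
    (Filter.Eventually.of_forall fun x => c.norm_coe_le_norm x)

lemma norm_integral_mul_prod_le (c : C(X, ℝ)) (f : Fin p → Lp ℝ p μ) :
    ‖∫ x, c x * ∏ m, f m x ∂μ‖ ≤ ‖c‖ * ∏ m, ‖f m‖ := by
  have h := memLp_prod_of_memLp fun m => Lp.memLp (f m)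
  calc ‖∫ x, c x * ∏ m, f m x ∂μ‖ ≤ ∫ x, ‖c‖ * ‖∏ m, f m x‖ ∂μ := by
        refine norm_integral_le_of_norm_le (h.1.norm.const_mul _)
          (Filter.Eventually.of_forall fun x => ?_)
        rw [norm_mul]
        gcongr
        exact c.norm_coe_le_norm x
    _ ≤ ‖c‖ * ∏ m, ‖f m‖ := by
        rw [integral_const_mul]
        gcongr
        exact h.2

variable (μ) in
/-- The multilinear form `(f₁, …, f_p) ↦ ∫ c f₁ ⋯ f_p` on `L^p`. -/
def hoelderForm (c : C(X, ℝ)) :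
    ContinuousMultilinearMap ℝ (fun _ : Fin p => Lp ℝ p μ) ℝ :=
  MultilinearMap.mkContinuous
    { toFun := fun f => ∫ x, c x * ∏ m, f m x ∂μ
      map_update_add' := by
        intro _ f m a b
        rw [← integral_add (integrable_mul_prod c _) (integrable_mul_prod c _)]
        refine integral_congr_ae ?_
        filter_upwards [Lp.coeFn_add a b] with x hx
        have key : ∀ g : Lp ℝ p μ, ∏ l, (Function.update f m g l : X → ℝ) x =
            (g : X → ℝ) x * ∏ l ∈ Finset.univ.erase m, (f l : X → ℝ) x := by
          intro g
          rw [← Finset.mul_prod_erase _ _ (Finset.mem_univ m), Function.update_self]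
          congr 1
          refine Finset.prod_congr rfl fun l hl => ?_
          rw [Function.update_of_ne (Finset.ne_of_mem_erase hl)]
        rw [key, key, key, hx, Pi.add_apply]
        ring
      map_update_smul' := by
        intro _ f m a b
        rw [smul_eq_mul, ← integral_const_mul]
        refine integral_congr_ae ?_
        filter_upwards [Lp.coeFn_smul a b] with x hx
        have key : ∀ g : Lp ℝ p μ, ∏ l, (Function.update f m g l : X → ℝ) x =
            (g : X → ℝ) x * ∏ l ∈ Finset.univ.erase m, (f l : X → ℝ) x := by
          intro g
          rw [← Finset.mul_prod_erase _ _ (Finset.mem_univ m), Function.update_self]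
          congr 1
          refine Finset.prod_congr rfl fun l hl => ?_
          rw [Function.update_of_ne (Finset.ne_of_mem_erase hl)]
        rw [key, key, hx, Pi.smul_apply, smul_eq_mul]
        ring }
    ‖c‖ (norm_integral_mul_prod_le c)

lemma hoelderForm_apply (c : C(X, ℝ)) (f : Fin p → Lp ℝ p μ) :
    hoelderForm μ c f = ∫ x, c x * ∏ m, f m x ∂μ := rfl

variable (μ p) in
/-- `hoelderForm` as a continuous linear map of the weight. -/
def hoelderFormL : C(X, ℝ) →L[ℝ] ContinuousMultilinearMap ℝ (fun _ : Fin p => Lp ℝ p μ) ℝ :=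
  LinearMap.mkContinuous
    { toFun := fun c => hoelderForm μ c
      map_add' := by
        intro c d
        ext f
        simp only [add_apply, hoelderForm_apply, ContinuousMap.add_apply, add_mul]
        exact integral_add (integrable_mul_prod c f) (integrable_mul_prod d f)
      map_smul' := by
        intro a c
        ext f
        simp only [smul_apply, hoelderForm_apply,
          ContinuousMap.smul_apply, smul_eq_mul, mul_assoc, integral_const_mul, RingHom.id_apply] }
    1 fun c => by
      rw [one_mul]
      exact MultilinearMap.mkContinuous_norm_le _ (norm_nonneg c)
        (norm_integral_mul_prod_le c)

lemma hoelderFormL_apply (c : C(X, ℝ)) (f : Fin p → Lp ℝ p μ) :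
    hoelderFormL μ p c f = ∫ x, c x * ∏ m, f m x ∂μ := rfl

end Hoelder

/-! ### Homogeneous polynomial expressions with smooth coefficients -/

section PolyOp

variable {P E : Type*} [NormedAddCommGroup P] [NormedSpace ℝ P]
  [NormedAddCommGroup E] [NormedSpace ℝ E] {Ξ J : Type*}

/-- `PolyOp D lev v d m Φ`: on `D`, the expression `Φ ξ (γ, z)` is a homogeneous polynomial of
degree `d` in those `v a ξ z` with `lev a ≤ m`, with coefficients smooth in `(γ, z)`. -/
inductive PolyOp (D : Set (P × E)) (lev : J → ℕ) (v : J → Ξ → E → ℝ) :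
    ℕ → ℕ → (Ξ → P × E → ℝ) → Prop
  | zero (d m : ℕ) : PolyOp D lev v d m (fun _ _ => 0)
  | coef (m : ℕ) {c : P × E → ℝ} (hc : ContDiffOn ℝ ∞ c D) : PolyOp D lev v 0 m (fun _ q => c q)
  | base {m : ℕ} {a : J} (ha : lev a ≤ m) : PolyOp D lev v 1 m (fun ξ q => v a ξ q.2)
  | add {d m : ℕ} {Φ Ψ : Ξ → P × E → ℝ} (hΦ : PolyOp D lev v d m Φ) (hΨ : PolyOp D lev v d m Ψ) :
      PolyOp D lev v d m (fun ξ q => Φ ξ q + Ψ ξ q)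
  | mul {d e m : ℕ} {Φ Ψ : Ξ → P × E → ℝ} (hΦ : PolyOp D lev v d m Φ)
      (hΨ : PolyOp D lev v e m Ψ) : PolyOp D lev v (d + e) m (fun ξ q => Φ ξ q * Ψ ξ q)
  | congr {d m : ℕ} {Φ Ψ : Ξ → P × E → ℝ} (hΦ : PolyOp D lev v d m Φ)
      (h : ∀ ξ, ∀ q ∈ D, Ψ ξ q = Φ ξ q) : PolyOp D lev v d m Ψ

namespace PolyOp

variable {D : Set (P × E)} {lev : J → ℕ} {v : J → Ξ → E → ℝ} {d m : ℕ} {Φ Ψ : Ξ → P × E → ℝ}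

lemma mono {m' : ℕ} (h : PolyOp D lev v d m Φ) (hm : m ≤ m') : PolyOp D lev v d m' Φ := by
  induction h with
  | zero d m => exact zero d m'
  | coef m hc => exact coef m' hc
  | base ha => exact base (ha.trans hm)
  | add _ _ ih1 ih2 => exact (ih1 hm).add (ih2 hm)
  | mul _ _ ih1 ih2 => exact (ih1 hm).mul (ih2 hm)
  | congr _ h ih => exact (ih hm).congr h

lemma smul {c : P × E → ℝ} (hc : ContDiffOn ℝ ∞ c D) (h : PolyOp D lev v d m Φ) :
    PolyOp D lev v d m (fun ξ q => c q * Φ ξ q) := by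
  have := (coef (lev := lev) (v := v) m hc).mul h
  rwa [zero_add] at this

lemma sum {ι : Type*} {s : Finset ι} {Φ : ι → Ξ → P × E → ℝ}
    (h : ∀ i ∈ s, PolyOp D lev v d m (Φ i)) :
    PolyOp D lev v d m (fun ξ q => ∑ i ∈ s, Φ i ξ q) := by
  classical
  induction s using Finset.induction_on with
  | empty => simpa using zero d m
  | insert a s ha ih =>
    simp only [Finset.sum_insert ha]
    exact (h a (Finset.mem_insert_self a s)).add
      (ih fun i hi => h i (Finset.mem_insert_of_mem hi))

lemma sub (hΦ : PolyOp D lev v d m Φ) (hΨ : PolyOp D lev v d m Ψ) :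
    PolyOp D lev v d m (fun ξ q => Φ ξ q - Ψ ξ q) :=
  (hΦ.add (hΨ.smul (c := fun _ => -1) contDiffOn_const)).congr fun _ _ _ => by ring

lemma pow (h : PolyOp D lev v d m Φ) (r : ℕ) :
    PolyOp D lev v (d * r) m (fun ξ q => Φ ξ q ^ r) := by
  induction r with
  | zero => simpa using coef (lev := lev) (v := v) (D := D) m (contDiffOn_const (c := (1 : ℝ)))
  | succ r ih =>
    simp only [pow_succ, Nat.mul_succ]
    exact ih.mul h

lemma differentiableAt (hD : IsOpen D) (hv : ∀ a ξ, ∀ q ∈ D, DifferentiableAt ℝ (v a ξ) q.2)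
    (h : PolyOp D lev v d m Φ) (ξ : Ξ) : ∀ q ∈ D, DifferentiableAt ℝ (Φ ξ) q := by
  induction h with
  | zero d m => exact fun q _ => differentiableAt_const _
  | coef m hc => exact fun q hq => (hc.contDiffAt (hD.mem_nhds hq)).differentiableAt (by simp)
  | base ha => exact fun q hq => (hv _ ξ q hq).comp q differentiableAt_snd
  | add _ _ ih1 ih2 => exact fun q hq => (ih1 q hq).add (ih2 q hq)
  | mul _ _ ih1 ih2 => exact fun q hq => (ih1 q hq).mul (ih2 q hq)
  | congr _ h ih =>
    intro q hq
    exact (ih q hq).congr_of_eventuallyEq (Filter.eventually_of_mem (hD.mem_nhds hq) (h ξ))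

/-- By the Leibniz rule the degree is preserved. The level rises by one, because only the generators
contribute derivatives of `ξ`, and `hder` says that these are linear in generators one level up. The
direction `(0, e)` leaves the parameter `γ` fixed. -/
lemma fderiv_apply (hD : IsOpen D) (hv : ∀ a ξ, ∀ q ∈ D, DifferentiableAt ℝ (v a ξ) q.2) {e : E}
    (hder : ∀ a, PolyOp D lev v 1 (lev a + 1) (fun ξ q => fderiv ℝ (v a ξ) q.2 e))
    (h : PolyOp D lev v d m Φ) :
    PolyOp D lev v d (m + 1) (fun ξ q => fderiv ℝ (Φ ξ) q (0, e)) := by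
  induction h with
  | zero d m => simpa using zero d (m + 1)
  | coef m hc =>
    exact coef _ ((hc.fderiv_of_isOpen hD (m := ∞) (by simp)).clm_apply contDiffOn_const)
  | @base m a ha =>
    refine ((hder _).mono (Nat.succ_le_succ ha)).congr fun ξ q hq => ?_
    have := (hv a ξ q hq).hasFDerivAt.comp q hasFDerivAt_snd
    exact congrArg (fun L : P × E →L[ℝ] ℝ => L (0, e)) this.fderiv |>.trans (by simp)
  | @add d m Φ Ψ h1 h2 ih1 ih2 =>
    refine (ih1.add ih2).congr fun ξ q hq => ?_
    rw [fderiv_fun_add (h1.differentiableAt hD hv ξ q hq) (h2.differentiableAt hD hv ξ q hq)]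
    simp
  | @mul d e m Φ Ψ h1 h2 ih1 ih2 =>
    refine ((ih1.mul (h2.mono m.le_succ)).add ((h1.mono m.le_succ).mul ih2)).congr
      fun ξ q hq => ?_
    rw [fderiv_fun_mul (h1.differentiableAt hD hv ξ q hq) (h2.differentiableAt hD hv ξ q hq)]
    simp
    ring
  | congr _ h ih =>
    refine ih.congr fun ξ q hq => ?_
    rw [Filter.EventuallyEq.fderiv_eq (Filter.eventually_of_mem (hD.mem_nhds hq) (h ξ))]

/-- A direction that varies smoothly with `q` is expanded in a fixed basis, and its coordinates
become coefficients. The chain rule for a moving point needs such directions. -/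
lemma fderiv_apply_field [FiniteDimensional ℝ E] (hD : IsOpen D)
    (hv : ∀ a ξ, ∀ q ∈ D, DifferentiableAt ℝ (v a ξ) q.2)
    (hder : ∀ e a, PolyOp D lev v 1 (lev a + 1) (fun ξ q => fderiv ℝ (v a ξ) q.2 e))
    (h : PolyOp D lev v d m Φ) {Y : P × E → E} (hY : ContDiffOn ℝ ∞ Y D) :
    PolyOp D lev v d (m + 1) (fun ξ q => fderiv ℝ (Φ ξ) q (0, Y q)) := by
  set b := Module.finBasis ℝ E
  have hc : ∀ l, ContDiffOn ℝ ∞ (fun q => b.repr (Y q) l) D := fun l =>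
    (LinearMap.toContinuousLinearMap (b.coord l)).contDiff.comp_contDiffOn hY
  refine (sum (s := Finset.univ) fun l _ => (h.fderiv_apply hD hv (hder (b l))).smul (hc l)).congr
    fun ξ q hq => ?_
  have : ((0 : P), Y q) = ∑ l, b.repr (Y q) l • ((0 : P), b l) := by
    conv_lhs => rw [← b.sum_repr (Y q)]
    ext <;> simp [Prod.fst_sum, Prod.snd_sum]
  rw [this, map_sum]
  simp only [map_smul, smul_eq_mul]

/-- Expanding all products leaves a finite sum of monomials with exactly `d` factors each, the form
to which the multilinear Hölder form applies. -/
lemma exists_normalForm (h : PolyOp D lev v d m Φ) :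
    ∃ (T : Type) (_ : Fintype T) (c : T → P × E → ℝ) (a : T → Fin d → J),
      (∀ t, ContDiffOn ℝ ∞ (c t) D) ∧ (∀ t i, lev (a t i) ≤ m) ∧
      ∀ ξ, ∀ q ∈ D, Φ ξ q = ∑ t, c t q * ∏ i, v (a t i) ξ q.2 := by
  induction h with
  | zero d m =>
    exact ⟨Empty, inferInstance, fun t => t.elim, fun t => t.elim, fun t => t.elim,
      fun t => t.elim, by simp⟩
  | @coef m c hc =>
    exact ⟨Unit, inferInstance, fun _ => c, fun _ i => i.elim0, fun _ => hc,
      fun _ i => i.elim0, by simp⟩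
  | @base m a ha =>
    exact ⟨Unit, inferInstance, fun _ _ => 1, fun _ _ => a, fun _ => contDiffOn_const,
      fun _ _ => ha, by simp⟩
  | add _ _ ih1 ih2 =>
    obtain ⟨T, _, c, a, hc, ha, h⟩ := ih1
    obtain ⟨T', _, c', a', hc', ha', h'⟩ := ih2
    refine ⟨T ⊕ T', inferInstance, Sum.elim c c', Sum.elim a a', ?_, ?_, fun ξ q hq => ?_⟩
    · rintro (t | t)
      exacts [hc t, hc' t]
    · rintro (t | t)
      exacts [ha t, ha' t]
    · simp only [h ξ q hq, h' ξ q hq]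
      rw [Fintype.sum_sum_type]
      rfl
  | mul _ _ ih1 ih2 =>
    obtain ⟨T, _, c, a, hc, ha, h⟩ := ih1
    obtain ⟨T', _, c', a', hc', ha', h'⟩ := ih2
    refine ⟨T × T', inferInstance, fun t q => c t.1 q * c' t.2 q,
      fun t => Fin.append (a t.1) (a' t.2), fun t => (hc t.1).mul (hc' t.2), fun t i => ?_,
      fun ξ q hq => ?_⟩
    · refine Fin.addCases (fun i => ?_) (fun i => ?_) i
      · simpa using ha t.1 i
      · simpa using ha' t.2 i
    · simp only [h ξ q hq, h' ξ q hq]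
      rw [Finset.sum_mul_sum, Fintype.sum_prod_type]
      refine Finset.sum_congr rfl fun t _ => Finset.sum_congr rfl fun t' _ => ?_
      rw [Fin.prod_univ_add]
      simp only [Fin.append_left, Fin.append_right]
      ring
  | congr _ h ih =>
    obtain ⟨T, hT, c, a, hc, ha, h'⟩ := ih
    exact ⟨T, hT, c, a, hc, ha, fun ξ q hq => (h ξ q hq).trans (h' ξ q hq)⟩

/-- The degree of `Φ` equals the Lebesgue exponent, so each monomial of the normal form is a Hölder
form in `p` functions of `L^p`. The operators `u a` make these functions continuous linear images of
`j ξ`; only those with `lev a ≤ k` occur. The parameter `γ` enters through the weight alone. -/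
lemma exists_integral_eq [FiniteDimensional ℝ P] [MeasurableSpace E] [BorelSpace E]
    {N : Set P} {U K : Set E} (hN : IsOpen N)
    (hU : IsOpen U) (hK : IsCompact K) (hKU : K ⊆ U) {ν : Measure E} [IsFiniteMeasureOnCompacts ν]
    {p k : ℕ} [Fact (1 ≤ p)] {B : Type*} [SeminormedAddCommGroup B] [NormedSpace ℝ B]
    (j : Ξ → B) (u : J → B →L[ℝ] Lp ℝ p (ν.comap ((↑) : K → E)))
    (hu : ∀ a ξ, lev a ≤ k → u a (j ξ) =ᵐ[ν.comap ((↑) : K → E)] fun z => v a ξ z)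
    (h : PolyOp (N ×ˢ U) lev v p k Φ) :
    ∃ Λ : P → ContinuousMultilinearMap ℝ (fun _ : Fin p => B) ℝ, ContDiffOn ℝ ∞ Λ N ∧
      ∀ γ ∈ N, ∀ ξ, ∫ z in K, Φ ξ (γ, z) ∂ν = Λ γ fun _ => j ξ := by
  obtain ⟨T, _, c, a, hc, ha, hΦ⟩ := h.exists_normalForm
  have : CompactSpace K := isCompact_iff_compactSpace.1 hK
  have : IsFiniteMeasure (ν.comap ((↑) : K → E)) := by
    constructor
    rw [comap_subtype_coe_apply hK.measurableSet]
    simpa using hK.measure_lt_top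
  -- Two continuous linear maps (weight to Hölder form, then precomposition with the `u (a t i)`)
  -- applied to `paramMap K (c t)`, so smoothness in `γ` is that of `paramMap`.
  refine ⟨fun γ => ∑ t, ContinuousMultilinearMap.compContinuousLinearMapL
    (fun i => u (a t i)) (hoelderFormL (ν.comap ((↑) : K → E)) p (paramMap K (c t) γ)), ?_, ?_⟩
  · refine ContDiffOn.sum fun t _ => ?_
    exact (ContinuousLinearMap.contDiff _).comp_contDiffOn
      ((ContinuousLinearMap.contDiff _).comp_contDiffOn (contDiffOn_paramMap hN hU hKU (hc t)))
  · intro γ hγ ξ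
    rw [← integral_subtype_comap hK.measurableSet]
    rw [sum_apply]
    simp only [ContinuousMultilinearMap.compContinuousLinearMapL_apply,
      ContinuousMultilinearMap.compContinuousLinearMap_apply, hoelderFormL_apply]
    rw [← integral_finsetSum _ fun t _ => integrable_mul_prod _ _]
    refine integral_congr_ae ?_
    have hae : ∀ᵐ z ∂(ν.comap ((↑) : K → E)), ∀ t i,
        (u (a t i) (j ξ) : K → ℝ) z = v (a t i) ξ z :=
      ae_all_iff.2 fun t => ae_all_iff.2 fun i => hu _ _ (ha t i)
    filter_upwards [hae] with z hz
    rw [hΦ ξ _ ⟨hγ, hKU z.2⟩]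
    refine Finset.sum_congr rfl fun t _ => ?_
    rw [paramMap_apply (hc t).continuousOn hKU hγ]
    simp only [hz]

end PolyOp

end PolyOp

/-! ### Components of iterated covariant derivatives in local frames -/

section JetComponents

variable
  {E : Type*} [NormedAddCommGroup E] [NormedSpace ℝ E] [FiniteDimensional ℝ E]
  {H : Type*} [TopologicalSpace H] {I : ModelWithCorners ℝ E H}
  {M : Type*} [TopologicalSpace M] [ChartedSpace H M] [IsManifold I ∞ M]
  {F : Type*} [NormedAddCommGroup F] [NormedSpace ℝ F] [FiniteDimensional ℝ F]
  {V : M → Type*} [TopologicalSpace (TotalSpace F V)]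
  [∀ x, NormedAddCommGroup (V x)] [∀ x, InnerProductSpace ℝ (V x)]
  [FiberBundle F V] [VectorBundle ℝ F V] [ContMDiffVectorBundle ∞ F V I]

instance contMDiffVectorBundle_one : ContMDiffVectorBundle 1 F V I :=
  ContMDiffVectorBundle.of_le (n := ∞) (by simp)

variable (F V) in
/-- The domain of the trivialization of `V` around `x₁`. -/
def vbase (x₁ : M) : Set M := (trivializationAt F V x₁).baseSet

lemma isOpen_vbase (x₁ : M) : IsOpen (vbase F V x₁) := (trivializationAt F V x₁).open_baseSet

lemma mem_vbase (x₁ : M) : x₁ ∈ vbase F V x₁ := FiberBundle.mem_baseSet_trivializationAt' x₁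

variable (F V) in
/-- The local frame of `V` around `x₁`. -/
def vframe (x₁ : M) (r : Fin (Module.finrank ℝ F)) (x : M) : V x :=
  (trivializationAt F V x₁).localFrame (Module.finBasis ℝ F) r x

variable (I F V) in
/-- The coordinates with respect to the local frame of `V` around `x₁`. -/
def vcoeff (x₁ : M) (r : Fin (Module.finrank ℝ F)) (x : M) : V x →ₗ[ℝ] ℝ :=
  (trivializationAt F V x₁).localFrameCoeff I (Module.finBasis ℝ F) r x

lemma contMDiffOn_vframe (x₁ : M) (r) : CMDiff[vbase F V x₁] ∞ (T% (vframe F V x₁ r)) :=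
  (trivializationAt F V x₁).contMDiffOn_localFrame_baseSet ∞ (Module.finBasis ℝ F) r

lemma mdifferentiableAt_vframe {x₁ x : M} (hx : x ∈ vbase F V x₁) (r) :
    MDiffAt (T% (vframe F V x₁ r)) x :=
  ((contMDiffOn_vframe (I := I) x₁ r).contMDiffAt
    ((isOpen_vbase x₁).mem_nhds hx)).mdifferentiableAt (by simp)

lemma eq_sum_vcoeff {x₁ x : M} (hx : x ∈ vbase F V x₁) (w : V x) :
    w = ∑ r, vcoeff I F V x₁ r x w • vframe F V x₁ r x := by
  have := (trivializationAt F V x₁).eq_sum_localFrameCoeff_smul (I := I)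
    (s := FiberBundle.extend F w) (b := Module.finBasis ℝ F) hx
  simp only [FiberBundle.extend_apply_self] at this
  exact this

lemma vcoeff_vframe {x₁ x : M} (hx : x ∈ vbase F V x₁) (r s) :
    vcoeff I F V x₁ r x (vframe F V x₁ s x) = if s = r then 1 else 0 := by
  rw [vcoeff, Bundle.Trivialization.localFrameCoeff_apply_of_mem_baseSet _ _ hx, vframe,
    Bundle.Trivialization.localFrame_apply_of_mem_baseSet _ _ hx, Module.Basis.repr_self,
    Finsupp.single_apply]

lemma contMDiffOn_vcoeff {x₁ : M} {U : Set M} (hU : IsOpen U) (hUb : U ⊆ vbase F V x₁)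
    {σ : ∀ x : M, V x} (hσ : CMDiff[U] ∞ (T% σ)) (r) :
    ContMDiffOn I 𝓘(ℝ) ∞ (fun x => vcoeff I F V x₁ r x (σ x)) U :=
  contMDiffOn_localFrameCoeff (I := I) (Module.finBasis ℝ F) hU hUb hσ r

lemma mdifferentiableAt_vcoeff {x₁ x : M} (hx : x ∈ vbase F V x₁)
    {σ : ∀ x : M, V x} (hσ : MDiffAt (T% σ) x) (r) :
    MDiffAt (fun x => vcoeff I F V x₁ r x (σ x)) x :=
  mdifferentiableAt_localFrameCoeff (I := I) (Module.finBasis ℝ F) hx hσ r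

lemma cov_sum_smul (covV : CovariantDerivative I F V) {ι : Type*} (s : Finset ι) {f : ι → M → ℝ}
    {X : ι → ∀ x : M, V x} {x : M} (hf : ∀ r, MDiffAt (f r) x) (hX : ∀ r, MDiffAt (T% (X r)) x) :
    covV (fun y => ∑ r ∈ s, f r y • X r y) x =
      ∑ r ∈ s, (f r x • covV (X r) x + (d% (f r) x).smulRight (X r x)) := by
  classical
  induction s using Finset.induction_on with
  | empty =>
    simp only [Finset.sum_empty]
    exact congrFun covV.zero x
  | insert a s ha ih =>
    rw [Finset.sum_insert ha, ← ih, ← covV.isCovariantDerivativeOnUniv.leibniz (hX a) (hf a)]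
    simp only [Finset.sum_insert ha]
    exact covV.isCovariantDerivativeOnUniv.add ((hf a).smul_section (hX a))
      (MDifferentiableAt.sum_section fun r _ => (hf r).smul_section (hX r))

/-- The connection in a frame is the derivative of the coefficients plus a zeroth-order term: write
`σ` in the frame near `x` and apply the Leibniz rule to the sum. -/
lemma vcoeff_cov [T2Space M] (covV : CovariantDerivative I F V) {x₁ x : M}
    (hx : x ∈ vbase F V x₁) {σ : ∀ x : M, V x} (hσ : MDiffAt (T% σ) x) (w : TangentSpace I x) (r) :
    vcoeff I F V x₁ r x (covV σ x w) = (d% (fun y => vcoeff I F V x₁ r y (σ y)) x) w +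
      ∑ s, vcoeff I F V x₁ r x (covV (vframe F V x₁ s) x w) * vcoeff I F V x₁ s x (σ x) := by
  have hf : ∀ s, MDiffAt (fun y => vcoeff I F V x₁ s y (σ y)) x :=
    mdifferentiableAt_vcoeff hx hσ
  have hX : ∀ s, MDiffAt (T% (vframe F V x₁ s)) x := mdifferentiableAt_vframe hx
  have h1 : covV σ x =
      covV (fun y => ∑ s, vcoeff I F V x₁ s y (σ y) • vframe F V x₁ s y) x := by
    refine covV.isCovariantDerivativeOnUniv.congr_of_eventuallyEq hσ
      (MDifferentiableAt.sum_section fun s _ => (hf s).smul_section (hX s)) Filter.univ_mem ?_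
    filter_upwards [(isOpen_vbase x₁).mem_nhds hx] with y hy
    exact eq_sum_vcoeff hy _
  rw [h1, cov_sum_smul covV _ hf hX]
  simp only [sum_apply, add_apply, smul_apply, ContinuousLinearMap.smulRight_apply, map_sum,
    map_add, map_smul, vcoeff_vframe hx, smul_eq_mul, Finset.sum_add_distrib]
  rw [add_comm]
  congr 1
  · simp
  · exact Finset.sum_congr rfl fun s _ => mul_comm _ _

variable (covT : CovariantDerivative I E (fun x : M => TangentSpace I x))
    (covV : CovariantDerivative I F V)

variable (E F) in
/-- Index of a component of an iterated covariant derivative: the order, the vectors of the frame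
of the tangent bundle that are inserted, and the component in the frame of `V`. -/
abbrev JetIndex : Type :=
  Σ i : ℕ, (Fin i → Fin (Module.finrank ℝ E)) × Fin (Module.finrank ℝ F)

/-- A component of `∇ⁱ ξ` in the local frames around `c` and `x₁`. -/
def jetComp (c x₁ : M) (a : JetIndex E F) (ξ : ∀ x : M, V x) (x : M) : ℝ :=
  vcoeff I F V x₁ a.2.2 x (iterCovDeriv covT covV ξ a.1 x fun j => tframe I c (a.2.1 j) x)

/-- The connection coefficients of `covV` in the local frames. -/
def vChristoffel (c x₁ : M) (l : Fin (Module.finrank ℝ E)) (s r : Fin (Module.finrank ℝ F))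
    (x : M) : ℝ :=
  vcoeff I F V x₁ r x (covV (vframe F V x₁ s) x (tframe I c l x))

/-- The connection coefficients of `covT` in the local frame. -/
def tChristoffel (c : M) (l a m : Fin (Module.finrank ℝ E)) (x : M) : ℝ :=
  tcoeff I c (fun y => covT (tframe I c a) y (tframe I c l y)) m x

section

variable [T2Space M] [CovariantDerivative.ContMDiffCovariantDerivative covT ∞]
    [CovariantDerivative.ContMDiffCovariantDerivative covV ∞]

lemma contMDiffOn_vChristoffel (c x₁ : M) (l s r) :
    ContMDiffOn I 𝓘(ℝ) ∞ (vChristoffel covV c x₁ l s r) (tbase I c ∩ vbase F V x₁) := by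
  have hU := (isOpen_tbase (I := I) c).inter (isOpen_vbase (F := F) (V := V) x₁)
  refine contMDiffOn_vcoeff hU Set.inter_subset_right
    (σ := fun y => covV (vframe F V x₁ s) y (tframe I c l y)) ?_ r
  exact contMDiffOn_cov covV hU ((contMDiffOn_vframe x₁ s).mono Set.inter_subset_right)
    ((contMDiffOn_tframe c l).mono Set.inter_subset_left)

lemma contMDiffOn_tChristoffel (c : M) (l a m) :
    ContMDiffOn I 𝓘(ℝ) ∞ (tChristoffel covT c l a m) (tbase I c) :=
  contMDiffOn_baseSet_localFrameCoeff (I := I) (Module.finBasis ℝ E)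
    (contMDiffOn_cov covT (isOpen_tbase c) (contMDiffOn_tframe c a) (contMDiffOn_tframe c l)) m

lemma contMDiffOn_jetComp (c x₁ : M) (a : JetIndex E F) {ξ : ∀ x : M, V x} (hξ : CMDiff ∞ (T% ξ)) :
    ContMDiffOn I 𝓘(ℝ) ∞ (jetComp covT covV c x₁ a ξ) (tbase I c ∩ vbase F V x₁) :=
  contMDiffOn_vcoeff ((isOpen_tbase c).inter (isOpen_vbase x₁)) Set.inter_subset_right
    (((isSmoothTensor_iterCovDeriv covT covV hξ a.1).smooth c a.2.1).mono Set.inter_subset_left) _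

/-- The classical formula `(∇T)_{l b} = ∂_l T_b + Γ^V T - Γ^T T`. It is used in both directions: to
compute a component of order `i + 1`, and to express a partial derivative of a component of order
`i` through components of order at most `i + 1`. -/
lemma jetComp_succ (c x₁ : M) (i : ℕ) (l) (b : Fin i → Fin (Module.finrank ℝ E)) (r)
    {ξ : ∀ x : M, V x} (hξ : CMDiff ∞ (T% ξ)) {x : M} (hx : x ∈ tbase I c ∩ vbase F V x₁) :
    jetComp covT covV c x₁ ⟨i + 1, Fin.cons l b, r⟩ ξ x =
      (d% (jetComp covT covV c x₁ ⟨i, b, r⟩ ξ) x) (tframe I c l x) +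
      ∑ s, vChristoffel covV c x₁ l s r x * jetComp covT covV c x₁ ⟨i, b, s⟩ ξ x -
      ∑ j, ∑ m, tChristoffel covT c l (b j) m x *
        jetComp covT covV c x₁ ⟨i, Function.update b j m, r⟩ ξ x := by
  have hT := isSmoothTensor_iterCovDeriv covT covV hξ i
  have hX : ∀ a, MDiffAt (T% (tframe I c a)) x := fun a =>
    ((contMDiffOn_tframe c a).contMDiffAt ((isOpen_tbase c).mem_nhds hx.1)).mdifferentiableAt
      (by simp)
  -- Tensoriality: the arbitrary extensions in the definition of `covDerivTensor` may be replaced by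
  -- the frame fields.
  have h1 := hT.covDerivTensor_eq covT covV (x := x) (X := fun j => tframe I c (b j))
    (fun j => hX _) (fun j => tframe I c ((Fin.cons l b : Fin (i + 1) → _) j) x) (fun j => by simp)
  have h2 : ∀ j, iterCovDeriv covT covV ξ i x (Function.update (fun j => tframe I c (b j) x) j
      (covT (tframe I c (b j)) x (tframe I c l x))) = ∑ m, tChristoffel covT c l (b j) m x •
        iterCovDeriv covT covV ξ i x fun j' => tframe I c (Function.update b j m j') x := by
    intro j
    have h3 := (hT.toMulti x).map_update_sum Finset.univ j
      (fun m => tChristoffel covT c l (b j) m x • tframe I c m x) (fun j => tframe I c (b j) x)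
    have h4 : covT (tframe I c (b j)) x (tframe I c l x) =
        ∑ m, tChristoffel covT c l (b j) m x • tframe I c m x :=
      eq_sum_tcoeff c (fun y => covT (tframe I c (b j)) y (tframe I c l y)) hx.1
    rw [h4]
    refine h3.trans (Finset.sum_congr rfl fun m _ => ?_)
    refine (hT.smul x _ j _ _).trans ?_
    congr 2
    funext j'
    by_cases h : j' = j
    · subst h; simp
    · simp [h]
  have h5 : MDiffAt (T% fun y => iterCovDeriv covT covV ξ i y fun j => tframe I c (b j) y) x :=
    ((hT.smooth c b).contMDiffAt ((isOpen_tbase c).mem_nhds hx.1)).mdifferentiableAt (by simp)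
  rw [jetComp]
  simp only [iterCovDeriv]
  rw [h1, covField]
  simp only [Fin.cons_zero]
  rw [Finset.sum_congr rfl fun j _ => h2 j, map_sub, map_sum]
  simp only [map_sum, map_smul, smul_eq_mul]
  rw [vcoeff_cov covV hx.2 h5]
  rfl

end

end JetComponents

/-! ### The tangent frame in chart coordinates -/

section Coordinates

variable {n : ℕ} {M : Type*} [TopologicalSpace M] [ChartedSpace (EuclideanSpace ℝ (Fin n)) M]
  [IsManifold (𝓡 n) ∞ M]

lemma tbase_eq_source (c : M) :
    tbase (𝓡 n) c = (chartAt (EuclideanSpace ℝ (Fin n)) c).source :=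
  TangentBundle.trivializationAt_baseSet c

lemma mem_source_of_mem_target {c : M} {z : EuclideanSpace ℝ (Fin n)}
    (hz : z ∈ (extChartAt (𝓡 n) c).target) :
    (extChartAt (𝓡 n) c).symm z ∈ (chartAt (EuclideanSpace ℝ (Fin n)) c).source := by
  rw [← extChartAt_source (𝓡 n)]
  exact (extChartAt (𝓡 n) c).map_target hz

/-- The trivialization of the tangent bundle comes from the chart, so `tframe` consists of
coordinate fields, taken with respect to `Module.finBasis`. Differentiating along it is therefore
taking partial derivatives, as `mvfderiv_tframe` records. -/
lemma tframe_eq_mfderiv {c x : M} (hx : x ∈ (chartAt (EuclideanSpace ℝ (Fin n)) c).source) (l) :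
    tframe (𝓡 n) c l x = mfderiv 𝓘(ℝ, EuclideanSpace ℝ (Fin n)) (𝓡 n) (extChartAt (𝓡 n) c).symm
      (extChartAt (𝓡 n) c x) (Module.finBasis ℝ (EuclideanSpace ℝ (Fin n)) l) := by
  have hx' : x ∈ (trivializationAt (EuclideanSpace ℝ (Fin n))
      (TangentSpace (𝓡 n) : M → Type _) c).baseSet := by
    rw [TangentBundle.trivializationAt_baseSet]; exact hx
  have h := TangentBundle.symmL_trivializationAt (I := 𝓡 n) hx
  simp only [modelWithCornersSelf_coe, Set.range_id, mfderivWithin_univ] at h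
  rw [← h, tframe, Bundle.Trivialization.localFrame_apply_of_mem_baseSet _ _ hx',
    Bundle.Trivialization.basisAt]
  simp only [Module.Basis.map_apply, Bundle.Trivialization.linearEquivAt_symm_apply]
  exact ((trivializationAt (EuclideanSpace ℝ (Fin n)) (TangentSpace (𝓡 n) : M → Type _) c).symmL_apply
    (R := ℝ) hx' _).symm

lemma mvfderiv_tframe {c x : M} (hx : x ∈ (chartAt (EuclideanSpace ℝ (Fin n)) c).source)
    {f : M → ℝ} (hf : MDifferentiableAt (𝓡 n) 𝓘(ℝ) f x) (l) :
    mvfderiv (𝓡 n) f x (tframe (𝓡 n) c l x) = fderiv ℝ (f ∘ (extChartAt (𝓡 n) c).symm)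
      (extChartAt (𝓡 n) c x) (Module.finBasis ℝ (EuclideanSpace ℝ (Fin n)) l) := by
  have hx' : x ∈ (extChartAt (𝓡 n) c).source := by rwa [extChartAt_source]
  have hs : (extChartAt (𝓡 n) c).symm (extChartAt (𝓡 n) c x) = x :=
    (extChartAt (𝓡 n) c).left_inv hx'
  have h1 : MDifferentiableAt 𝓘(ℝ, EuclideanSpace ℝ (Fin n)) (𝓡 n) (extChartAt (𝓡 n) c).symm
      (extChartAt (𝓡 n) c x) :=
    ((contMDiffOn_extChartAt_symm (n := ∞) c).contMDiffAt ((isOpen_extChartAt_target c).mem_nhds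
      ((extChartAt (𝓡 n) c).map_source hx'))).mdifferentiableAt (by simp)
  rw [tframe_eq_mfderiv hx, ← mfderiv_eq_fderiv,
    mfderiv_comp_of_eq (hs.symm ▸ hf) h1 rfl, hs]
  rfl

lemma mdifferentiableAt_iff_coord {c : M} {z : EuclideanSpace ℝ (Fin n)}
    (hz : z ∈ (extChartAt (𝓡 n) c).target) {f : M → ℝ}
    (hf : MDifferentiableAt (𝓡 n) 𝓘(ℝ) f ((extChartAt (𝓡 n) c).symm z)) :
    DifferentiableAt ℝ (f ∘ (extChartAt (𝓡 n) c).symm) z := by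
  have h1 : MDifferentiableAt 𝓘(ℝ, EuclideanSpace ℝ (Fin n)) (𝓡 n) (extChartAt (𝓡 n) c).symm z :=
    ((contMDiffOn_extChartAt_symm (n := ∞) c).contMDiffAt ((isOpen_extChartAt_target c).mem_nhds
      hz)).mdifferentiableAt (by simp)
  exact (hf.comp z h1).differentiableAt

end Coordinates

/-! ### Partial derivatives of jet components are again polynomial in jet components -/

section JetOperators

variable {n : ℕ} {M : Type*} [TopologicalSpace M] [ChartedSpace (EuclideanSpace ℝ (Fin n)) M]
  [IsManifold (𝓡 n) ∞ M] [T2Space M]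
  {F : Type*} [NormedAddCommGroup F] [NormedSpace ℝ F] [FiniteDimensional ℝ F]
  {V : M → Type*} [TopologicalSpace (TotalSpace F V)]
  [∀ x, NormedAddCommGroup (V x)] [∀ x, InnerProductSpace ℝ (V x)]
  [FiberBundle F V] [VectorBundle ℝ F V] [ContMDiffVectorBundle ∞ F V (𝓡 n)]
  (covT : CovariantDerivative (𝓡 n) (EuclideanSpace ℝ (Fin n))
    (fun x : M => TangentSpace (𝓡 n) x))
  [CovariantDerivative.ContMDiffCovariantDerivative covT ∞]
  (covV : CovariantDerivative (𝓡 n) F V)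
  [CovariantDerivative.ContMDiffCovariantDerivative covV ∞]
  {P : Type*} [NormedAddCommGroup P] [NormedSpace ℝ P]

/-- The order of a component of an iterated covariant derivative. -/
def jetOrder (a : JetIndex (EuclideanSpace ℝ (Fin n)) F) : ℕ := a.1

/-- A component of `∇ⁱ ξ` as a function of the coordinates. -/
def jetCoord (c x₁ : M) (a : JetIndex (EuclideanSpace ℝ (Fin n)) F) (ξ : Cₛ^∞⟮𝓡 n; F, V⟯)
    (z : EuclideanSpace ℝ (Fin n)) : ℝ :=
  jetComp covT covV c x₁ a ξ ((extChartAt (𝓡 n) c).symm z)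

variable {c x₁ : M}

lemma mdifferentiableAt_jetComp {x : M}
    (hx : x ∈ (chartAt (EuclideanSpace ℝ (Fin n)) c).source) (hx₁ : x ∈ vbase F V x₁)
    (a : JetIndex (EuclideanSpace ℝ (Fin n)) F) (ξ : Cₛ^∞⟮𝓡 n; F, V⟯) :
    MDifferentiableAt (𝓡 n) 𝓘(ℝ) (jetComp covT covV c x₁ a ξ) x :=
  ((contMDiffOn_jetComp covT covV c x₁ a ξ.contMDiff).contMDiffAt
    (((isOpen_tbase c).inter (isOpen_vbase x₁)).mem_nhds
      ⟨by rw [tbase_eq_source]; exact hx, hx₁⟩)).mdifferentiableAt (by simp)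

lemma differentiableAt_jetCoord {z : EuclideanSpace ℝ (Fin n)}
    (hz : z ∈ (extChartAt (𝓡 n) c).target)
    (hz₁ : (extChartAt (𝓡 n) c).symm z ∈ vbase F V x₁)
    (a : JetIndex (EuclideanSpace ℝ (Fin n)) F) (ξ : Cₛ^∞⟮𝓡 n; F, V⟯) :
    DifferentiableAt ℝ (jetCoord covT covV c x₁ a ξ) z :=
  mdifferentiableAt_iff_coord hz
    (mdifferentiableAt_jetComp covT covV (mem_source_of_mem_target hz) hz₁ a ξ)

lemma jetComp_succ_coord {x : M} (hx : x ∈ (chartAt (EuclideanSpace ℝ (Fin n)) c).source)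
    (hx₁ : x ∈ vbase F V x₁) (i : ℕ) (l)
    (b : Fin i → Fin (Module.finrank ℝ (EuclideanSpace ℝ (Fin n)))) (r) (ξ : Cₛ^∞⟮𝓡 n; F, V⟯) :
    jetComp covT covV c x₁ ⟨i + 1, Fin.cons l b, r⟩ ξ x =
      fderiv ℝ (jetCoord covT covV c x₁ ⟨i, b, r⟩ ξ) (extChartAt (𝓡 n) c x)
        (Module.finBasis ℝ (EuclideanSpace ℝ (Fin n)) l) +
      ∑ s, vChristoffel covV c x₁ l s r x * jetComp covT covV c x₁ ⟨i, b, s⟩ ξ x -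
      ∑ j, ∑ m, tChristoffel covT c l (b j) m x *
        jetComp covT covV c x₁ ⟨i, Function.update b j m, r⟩ ξ x := by
  rw [jetComp_succ covT covV c x₁ i l b r ξ.contMDiff ⟨by rw [tbase_eq_source]; exact hx, hx₁⟩,
    mvfderiv_tframe hx (mdifferentiableAt_jetComp covT covV hx hx₁ _ ξ)]
  rfl

variable {N : Set P} {U : Set (EuclideanSpace ℝ (Fin n))}

lemma contDiffOn_coord_snd (hUt : U ⊆ (extChartAt (𝓡 n) c).target) {W : Set M}
    (hUW : ∀ z ∈ U, (extChartAt (𝓡 n) c).symm z ∈ W) {f : M → ℝ}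
    (hf : ContMDiffOn (𝓡 n) 𝓘(ℝ) ∞ f W) :
    ContDiffOn ℝ ∞ (fun q : P × EuclideanSpace ℝ (Fin n) => f ((extChartAt (𝓡 n) c).symm q.2))
      (N ×ˢ U) := by
  have h1 : ContMDiffOn 𝓘(ℝ, EuclideanSpace ℝ (Fin n)) 𝓘(ℝ) ∞
      (f ∘ (extChartAt (𝓡 n) c).symm) U :=
    hf.comp ((contMDiffOn_extChartAt_symm c).mono hUt) hUW
  exact h1.contDiffOn.comp contDiffOn_snd fun q hq => hq.2

/-- Solve `jetComp_succ_coord` for the partial derivative; the connection coefficients are smooth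
and do not involve the parameter. This supplies the hypothesis `hder` of
`PolyOp.fderiv_apply_field`. -/
lemma polyOp_fderiv_jetCoord (hUt : U ⊆ (extChartAt (𝓡 n) c).target)
    (hUV : ∀ z ∈ U, (extChartAt (𝓡 n) c).symm z ∈ vbase F V x₁) (e : EuclideanSpace ℝ (Fin n))
    (a : JetIndex (EuclideanSpace ℝ (Fin n)) F) :
    PolyOp (N ×ˢ U) jetOrder (jetCoord covT covV c x₁) 1 (jetOrder a + 1)
      (fun ξ q => fderiv ℝ (jetCoord covT covV c x₁ a ξ) q.2 e) := by
  obtain ⟨i, b, r⟩ := a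
  have hsrc : ∀ z ∈ U, (extChartAt (𝓡 n) c).symm z ∈ tbase (𝓡 n) c ∩ vbase F V x₁ := fun z hz =>
    ⟨by rw [tbase_eq_source]; exact mem_source_of_mem_target (hUt hz), hUV z hz⟩
  set B := Module.finBasis ℝ (EuclideanSpace ℝ (Fin n)) with hB
  have hl : ∀ l, PolyOp (N ×ˢ U) jetOrder (jetCoord covT covV c x₁) 1 (i + 1)
      (fun ξ q => fderiv ℝ (jetCoord covT covV c x₁ ⟨i, b, r⟩ ξ) q.2 (B l)) := by
    intro l
    have h1 : PolyOp (N ×ˢ U) jetOrder (jetCoord covT covV c x₁) 1 (i + 1)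
        (fun ξ q => jetCoord covT covV c x₁ ⟨i + 1, Fin.cons l b, r⟩ ξ q.2) :=
      PolyOp.base le_rfl
    have h2 : PolyOp (N ×ˢ U) jetOrder (jetCoord covT covV c x₁) 1 (i + 1)
        (fun ξ q => ∑ s, vChristoffel covV c x₁ l s r ((extChartAt (𝓡 n) c).symm q.2) *
          jetCoord covT covV c x₁ ⟨i, b, s⟩ ξ q.2) :=
      PolyOp.sum fun s _ => PolyOp.smul (contDiffOn_coord_snd hUt hsrc
        (contMDiffOn_vChristoffel covV c x₁ l s r)) (PolyOp.base i.le_succ)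
    have h3 : PolyOp (N ×ˢ U) jetOrder (jetCoord covT covV c x₁) 1 (i + 1)
        (fun ξ q => ∑ j, ∑ m, tChristoffel covT c l (b j) m ((extChartAt (𝓡 n) c).symm q.2) *
          jetCoord covT covV c x₁ ⟨i, Function.update b j m, r⟩ ξ q.2) :=
      PolyOp.sum fun j _ => PolyOp.sum fun m _ => PolyOp.smul (contDiffOn_coord_snd hUt
        (fun z hz => (hsrc z hz).1) (contMDiffOn_tChristoffel covT c l (b j) m))
        (PolyOp.base i.le_succ)
    refine ((h1.sub h2).add h3).congr fun ξ q hq => ?_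
    have h4 := jetComp_succ_coord covT covV (mem_source_of_mem_target (hUt hq.2)) (hUV _ hq.2)
      i l b r ξ
    rw [(extChartAt (𝓡 n) c).right_inv (hUt hq.2)] at h4
    simp only [jetCoord] at h4 ⊢
    rw [h4]
    ring
  refine (PolyOp.sum (s := Finset.univ) fun l _ => (hl l).smul
    (contDiffOn_const (c := B.repr e l))).congr fun ξ q _ => ?_
  conv_lhs => rw [← B.sum_repr e]
  simp only [map_sum, map_smul, smul_eq_mul]

end JetOperators

/-! ### The action in coordinates: the point `g(γ)⁻¹ • x` and its inverse change of coordinates -/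

section Moving

variable {n : ℕ} {EG : Type*} [NormedAddCommGroup EG] [NormedSpace ℝ EG]
  {G : Type*} [TopologicalSpace G] [ChartedSpace EG G] [Group G] [LieGroup 𝓘(ℝ, EG) ∞ G]
  {M : Type*} [TopologicalSpace M] [ChartedSpace (EuclideanSpace ℝ (Fin n)) M]
  [IsManifold (𝓡 n) ∞ M]
  [MulAction G M] [ContMDiffSMul 𝓘(ℝ, EG) (𝓡 n) ∞ G M]

/-- The point `g(γ)⁻¹ • x`, where `x` has coordinates `z` in the chart at `c`. -/
def movePt (g : EG → G) (c : M) (q : EG × EuclideanSpace ℝ (Fin n)) : M :=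
  (g q.1)⁻¹ • (extChartAt (𝓡 n) c).symm q.2

/-- The coordinates in the chart at `c` of `g(γ) • x`, where `x` has coordinates `y` in the chart
at `c'`. -/
def moveCoord (g : EG → G) (c c' : M) (q : EG × EuclideanSpace ℝ (Fin n)) :
    EuclideanSpace ℝ (Fin n) :=
  extChartAt (𝓡 n) c (g q.1 • (extChartAt (𝓡 n) c').symm q.2)

variable {g : EG → G} {N : Set EG} {U : Set (EuclideanSpace ℝ (Fin n))} {c c' : M}

lemma contMDiffOn_smul_coord {h : EG → G} (hh : ContMDiffOn 𝓘(ℝ, EG) 𝓘(ℝ, EG) ∞ h N)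
    (hU : U ⊆ (extChartAt (𝓡 n) c).target) :
    ContMDiffOn 𝓘(ℝ, EG × EuclideanSpace ℝ (Fin n)) (𝓡 n) ∞
      (fun q : EG × EuclideanSpace ℝ (Fin n) => h q.1 • (extChartAt (𝓡 n) c).symm q.2)
      (N ×ˢ U) := by
  have h1 : ContMDiffOn 𝓘(ℝ, EG × EuclideanSpace ℝ (Fin n)) 𝓘(ℝ, EG) ∞
      (fun q : EG × EuclideanSpace ℝ (Fin n) => h q.1) (N ×ˢ U) :=
    hh.comp contDiff_fst.contMDiff.contMDiffOn fun q hq => hq.1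
  have h2 : ContMDiffOn 𝓘(ℝ, EG × EuclideanSpace ℝ (Fin n)) (𝓡 n) ∞
      (fun q : EG × EuclideanSpace ℝ (Fin n) => (extChartAt (𝓡 n) c).symm q.2) (N ×ˢ U) :=
    (contMDiffOn_extChartAt_symm c).comp contDiff_snd.contMDiff.contMDiffOn fun q hq => hU hq.2
  exact (ContMDiffSMul.contMDiff_smul (I := 𝓘(ℝ, EG)) (G := G) (M := M)).comp_contMDiffOn
    (h1.prodMk h2)

lemma contMDiffOn_movePt (hg : ContMDiffOn 𝓘(ℝ, EG) 𝓘(ℝ, EG) ∞ g N)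
    (hU : U ⊆ (extChartAt (𝓡 n) c).target) :
    ContMDiffOn 𝓘(ℝ, EG × EuclideanSpace ℝ (Fin n)) (𝓡 n) ∞ (movePt g c) (N ×ˢ U) :=
  contMDiffOn_smul_coord hg.inv hU

lemma contDiffOn_comp_movePt (hg : ContMDiffOn 𝓘(ℝ, EG) 𝓘(ℝ, EG) ∞ g N)
    (hU : U ⊆ (extChartAt (𝓡 n) c).target) {W : Set M} (hW : ∀ q ∈ N ×ˢ U, movePt g c q ∈ W)
    {H : Type*} [NormedAddCommGroup H] [NormedSpace ℝ H]
    {f : M → H} (hf : ContMDiffOn (𝓡 n) 𝓘(ℝ, H) ∞ f W) :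
    ContDiffOn ℝ ∞ (fun q => f (movePt g c q)) (N ×ˢ U) :=
  (hf.comp (contMDiffOn_movePt hg hU) hW).contDiffOn

/-- The domain of `moveCoord`. -/
def moveDomain (g : EG → G) (N : Set EG) (c c' : M) : Set (EG × EuclideanSpace ℝ (Fin n)) :=
  (N ×ˢ (extChartAt (𝓡 n) c').target) ∩
    (fun q : EG × EuclideanSpace ℝ (Fin n) => g q.1 • (extChartAt (𝓡 n) c').symm q.2) ⁻¹'
      (chartAt (EuclideanSpace ℝ (Fin n)) c).source

lemma isOpen_moveDomain (hN : IsOpen N) (hg : ContMDiffOn 𝓘(ℝ, EG) 𝓘(ℝ, EG) ∞ g N) :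
    IsOpen (moveDomain (n := n) g N c c') :=
  (contMDiffOn_smul_coord hg subset_rfl).continuousOn.isOpen_inter_preimage
    (hN.prod (isOpen_extChartAt_target c')) (chartAt (EuclideanSpace ℝ (Fin n)) c).open_source

lemma contDiffOn_moveCoord (hg : ContMDiffOn 𝓘(ℝ, EG) 𝓘(ℝ, EG) ∞ g N) :
    ContDiffOn ℝ ∞ (moveCoord (n := n) g c c') (moveDomain (n := n) g N c c') :=
  ((contMDiffOn_extChartAt (n := ∞)).comp ((contMDiffOn_smul_coord hg subset_rfl).mono
    Set.inter_subset_left) fun _ hq => hq.2).contDiffOn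

lemma smul_movePt (q : EG × EuclideanSpace ℝ (Fin n)) :
    g q.1 • movePt g c q = (extChartAt (𝓡 n) c).symm q.2 := by
  simp [movePt]

lemma moveDomain_coord (hU : U ⊆ (extChartAt (𝓡 n) c).target)
    {q : EG × EuclideanSpace ℝ (Fin n)} (hq : q ∈ N ×ˢ U)
    (hs : movePt g c q ∈ (chartAt (EuclideanSpace ℝ (Fin n)) c').source) :
    (q.1, extChartAt (𝓡 n) c' (movePt g c q)) ∈ moveDomain g N c c' := by
  have hs' : movePt g c q ∈ (extChartAt (𝓡 n) c').source := by rwa [extChartAt_source]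
  refine ⟨⟨hq.1, (extChartAt (𝓡 n) c').map_source hs'⟩, ?_⟩
  simp only [Set.mem_preimage, (extChartAt (𝓡 n) c').left_inv hs', smul_movePt]
  exact mem_source_of_mem_target (hU hq.2)

/-- Together with `movePt_moveCoord`: for fixed `γ`, the coordinates of `movePt` and `moveCoord` are
mutually inverse. This drives both the chain rule for jets and the change of variables in the
integrals. -/
lemma moveCoord_coord (hU : U ⊆ (extChartAt (𝓡 n) c).target)
    {q : EG × EuclideanSpace ℝ (Fin n)} (hq : q ∈ N ×ˢ U)
    (hs : movePt g c q ∈ (chartAt (EuclideanSpace ℝ (Fin n)) c').source) :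
    moveCoord g c c' (q.1, extChartAt (𝓡 n) c' (movePt g c q)) = q.2 := by
  have hs' : movePt g c q ∈ (extChartAt (𝓡 n) c').source := by rwa [extChartAt_source]
  simp only [moveCoord, (extChartAt (𝓡 n) c').left_inv hs', smul_movePt]
  exact (extChartAt (𝓡 n) c).right_inv (hU hq.2)

lemma movePt_moveCoord {q : EG × EuclideanSpace ℝ (Fin n)} (hq : q ∈ moveDomain g N c c') :
    movePt g c (q.1, moveCoord g c c' q) = (extChartAt (𝓡 n) c').symm q.2 := by
  have h : g q.1 • (extChartAt (𝓡 n) c').symm q.2 ∈ (extChartAt (𝓡 n) c).source := by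
    rw [extChartAt_source]; exact hq.2
  simp only [movePt, moveCoord, (extChartAt (𝓡 n) c).left_inv h, inv_smul_smul]

end Moving

/-! ### The jets of `g(γ) · ξ` at the moved point, in terms of the jets of `ξ` -/

section MovingJets

variable {n : ℕ} {EG : Type*} [NormedAddCommGroup EG] [NormedSpace ℝ EG]
  {G : Type*} [TopologicalSpace G] [ChartedSpace EG G] [Group G] [LieGroup 𝓘(ℝ, EG) ∞ G]
  {M : Type*} [TopologicalSpace M] [ChartedSpace (EuclideanSpace ℝ (Fin n)) M]
  [IsManifold (𝓡 n) ∞ M] [T2Space M]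
  [MulAction G M] [ContMDiffSMul 𝓘(ℝ, EG) (𝓡 n) ∞ G M]
  {F : Type*} [NormedAddCommGroup F] [NormedSpace ℝ F] [FiniteDimensional ℝ F]
  {V : M → Type*} [TopologicalSpace (TotalSpace F V)]
  [∀ x, NormedAddCommGroup (V x)] [∀ x, InnerProductSpace ℝ (V x)]
  [FiberBundle F V] [VectorBundle ℝ F V] [ContMDiffVectorBundle ∞ F V (𝓡 n)]
  (covT : CovariantDerivative (𝓡 n) (EuclideanSpace ℝ (Fin n))
    (fun x : M => TangentSpace (𝓡 n) x))
  [CovariantDerivative.ContMDiffCovariantDerivative covT ∞]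
  (covV : CovariantDerivative (𝓡 n) F V)
  [CovariantDerivative.ContMDiffCovariantDerivative covV ∞]
  (A : BundleAction n EG G F V)
  {g : EG → G} {N : Set EG} {U : Set (EuclideanSpace ℝ (Fin n))} {c c' x₁ x₁' : M}

/-- The inverse of the fiber map of `a` is the fiber map of `a⁻¹`, which turns smoothness of the
action into smoothness of `g · ξ`. The equation lives in the total space because the base points `x`
and `a⁻¹ • a • x` are only propositionally equal. -/
lemma BundleAction.act_symm_eq (a : G) (x : M) (w : V (a • x)) :
    (⟨x, (A.act a x).symm w⟩ : TotalSpace F V) = ⟨a⁻¹ • a • x, A.act a⁻¹ (a • x) w⟩ := by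
  have h1 : ∀ (h : G), h = 1 → ∀ (x : M) (v : V x),
      (⟨h • x, A.act h x v⟩ : TotalSpace F V) = ⟨x, v⟩ := by
    rintro _ rfl x v
    exact A.act_one x v
  have := A.act_mul a⁻¹ a x ((A.act a x).symm w)
  rw [h1 _ (inv_mul_cancel a)] at this
  simpa using this

lemma vcoeff_eq_repr {x₁ x : M} (hx : x ∈ vbase F V x₁) (r) (w : V x) :
    vcoeff (𝓡 n) F V x₁ r x w =
      (Module.finBasis ℝ F).repr (trivializationAt F V x₁ ⟨x, w⟩).2 r := by
  have := (trivializationAt F V x₁).localFrameCoeff_eq_coeff (I := 𝓡 n)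
    (b := Module.finBasis ℝ F) (s := FiberBundle.extend F w) hx (i := r)
  simp only [FiberBundle.extend_apply_self] at this
  exact this

/-- The components of the action of `g(γ)⁻¹` on the fibers, in the local frames. -/
def actCoeff (g : EG → G) (c x₁ x₁' : M) (s r : Fin (Module.finrank ℝ F))
    (q : EG × EuclideanSpace ℝ (Fin n)) : ℝ :=
  (Module.finBasis ℝ F).repr (trivializationAt F V x₁' ⟨movePt g c q,
    A.act (g q.1)⁻¹ ((extChartAt (𝓡 n) c).symm q.2)
      (vframe F V x₁ s ((extChartAt (𝓡 n) c).symm q.2))⟩).2 r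

lemma contDiffOn_actCoeff (hg : ContMDiffOn 𝓘(ℝ, EG) 𝓘(ℝ, EG) ∞ g N)
    (hU : U ⊆ (extChartAt (𝓡 n) c).target)
    (hUV : ∀ z ∈ U, (extChartAt (𝓡 n) c).symm z ∈ vbase F V x₁)
    (hV' : ∀ q ∈ N ×ˢ U, movePt g c q ∈ vbase F V x₁') (s r) :
    ContDiffOn ℝ ∞ (actCoeff A g c x₁ x₁' s r) (N ×ˢ U) := by
  have h1 : ContMDiffOn 𝓘(ℝ, EG × EuclideanSpace ℝ (Fin n)) 𝓘(ℝ, EG) ∞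
      (fun q : EG × EuclideanSpace ℝ (Fin n) => (g q.1)⁻¹) (N ×ˢ U) :=
    hg.inv.comp contDiff_fst.contMDiff.contMDiffOn fun q hq => hq.1
  have h2 : ContMDiffOn 𝓘(ℝ, EG × EuclideanSpace ℝ (Fin n)) (𝓡 n) ∞
      (fun q : EG × EuclideanSpace ℝ (Fin n) => (extChartAt (𝓡 n) c).symm q.2) (N ×ˢ U) :=
    (contMDiffOn_extChartAt_symm c).comp contDiff_snd.contMDiff.contMDiffOn fun q hq => hU hq.2
  have h3 := (contMDiffOn_vframe (I := 𝓡 n) (F := F) (V := V) x₁ s).comp h2 fun q hq => hUV _ hq.2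
  have h4 := A.contMDiff_act.comp_contMDiffOn (h1.prodMk h3)
  have h5 := ((trivializationAt F V x₁').contMDiffOn (n := ∞) (IB := 𝓡 n)).comp h4 fun q hq => by
    rw [Set.mem_preimage, Bundle.Trivialization.mem_source]
    exact hV' q hq
  have h6 := (contMDiff_snd.comp_contMDiffOn h5).contDiffOn
  exact (LinearMap.toContinuousLinearMap ((Module.finBasis ℝ F).coord r)).contDiff.comp_contDiffOn h6

/-- The components of `∇ⁱ (g(γ) · ξ)` at the point moved by `g(γ)⁻¹`. -/
def movedJet (g : EG → G) (c c' x₁' : M) (a : JetIndex (EuclideanSpace ℝ (Fin n)) F)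
    (ξ : Cₛ^∞⟮𝓡 n; F, V⟯) (q : EG × EuclideanSpace ℝ (Fin n)) : ℝ :=
  jetComp covT covV c' x₁' a (A.pullback (g q.1) ξ) (movePt g c q)

/-- At the moved point `x = g(γ)⁻¹ • y`, with `y` the point of coordinates `z`, the section `g(γ) ·
ξ` sees `ξ` only at `g(γ) • x = y`. Expanding `ξ y` in the frame of `V` leaves the matrix of the
fiber action as coefficients. -/
lemma polyOp_movedJet_zero (hg : ContMDiffOn 𝓘(ℝ, EG) 𝓘(ℝ, EG) ∞ g N)
    (hU : U ⊆ (extChartAt (𝓡 n) c).target)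
    (hUV : ∀ z ∈ U, (extChartAt (𝓡 n) c).symm z ∈ vbase F V x₁)
    (hV' : ∀ q ∈ N ×ˢ U, movePt g c q ∈ vbase F V x₁')
    (b : Fin 0 → Fin (Module.finrank ℝ (EuclideanSpace ℝ (Fin n)))) (r) :
    PolyOp (N ×ˢ U) jetOrder (jetCoord covT covV c x₁) 1 0
      (movedJet covT covV A g c c' x₁' ⟨0, b, r⟩) := by
  refine (PolyOp.sum (s := Finset.univ) fun s _ => PolyOp.smul
    (contDiffOn_actCoeff A hg hU hUV hV' s r)
    (PolyOp.base (a := (⟨0, b, s⟩ : JetIndex (EuclideanSpace ℝ (Fin n)) F)) le_rfl)).congr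
    fun ξ q hq => ?_
  simp only [movedJet, jetComp, jetCoord, iterCovDeriv]
  set x := movePt g c q with hx
  have hgx : g q.1 • x = (extChartAt (𝓡 n) c).symm q.2 := smul_movePt q
  have hgx₁ : g q.1 • x ∈ vbase F V x₁ := hgx ▸ hUV _ hq.2
  have h1 : (A.pullback (g q.1) ξ) x = (A.act (g q.1) x).symm (ξ (g q.1 • x)) := rfl
  rw [h1, eq_sum_vcoeff (I := 𝓡 n) hgx₁ (ξ (g q.1 • x))]
  simp only [map_sum, map_smul, smul_eq_mul]
  refine Finset.sum_congr rfl fun s _ => ?_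
  rw [mul_comm, vcoeff_eq_repr (hV' q hq), A.act_symm_eq]
  -- The base points `g q.1 • x` and the one with coordinates `q.2` are equal but not definitionally
  -- so; the dependent terms are transported by generalizing both.
  have h2 : ∀ y z : M, y = z → (⟨(g q.1)⁻¹ • y, A.act (g q.1)⁻¹ y (vframe F V x₁ s y)⟩ :
      TotalSpace F V) = ⟨(g q.1)⁻¹ • z, A.act (g q.1)⁻¹ z (vframe F V x₁ s z)⟩ := by
    rintro y _ rfl; rfl
  have h3 : ∀ y z : M, y = z → vcoeff (𝓡 n) F V x₁ s y (ξ y) = vcoeff (𝓡 n) F V x₁ s z (ξ z) := by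
    rintro y _ rfl; rfl
  rw [h2 _ _ hgx, h3 _ _ hgx]
  rfl

/-- Induction on the order by the formula for `∇` in frames, evaluated at the moved point. The
zeroth-order terms are covered by the induction hypothesis, with coefficients smooth in `(γ, z)`. By
the chain rule, the partial derivative at the moved point becomes a derivative in `z` along a smooth
field, which raises the level by one and never differentiates in `γ`. -/
lemma polyOp_movedJet (hN : IsOpen N) (hg : ContMDiffOn 𝓘(ℝ, EG) 𝓘(ℝ, EG) ∞ g N) (hUo : IsOpen U)
    (hU : U ⊆ (extChartAt (𝓡 n) c).target)
    (hUV : ∀ z ∈ U, (extChartAt (𝓡 n) c).symm z ∈ vbase F V x₁)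
    (hs' : ∀ q ∈ N ×ˢ U, movePt g c q ∈ (chartAt (EuclideanSpace ℝ (Fin n)) c').source)
    (hV' : ∀ q ∈ N ×ˢ U, movePt g c q ∈ vbase F V x₁') (i : ℕ) :
    ∀ (b : Fin i → Fin (Module.finrank ℝ (EuclideanSpace ℝ (Fin n)))) (r),
    PolyOp (N ×ˢ U) jetOrder (jetCoord covT covV c x₁) 1 i
      (movedJet covT covV A g c c' x₁' ⟨i, b, r⟩) := by
  have hD : IsOpen (N ×ˢ U) := hN.prod hUo
  have hv : ∀ a ξ, ∀ q ∈ N ×ˢ U, DifferentiableAt ℝ (jetCoord covT covV c x₁ a ξ) q.2 :=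
    fun a ξ q hq => differentiableAt_jetCoord covT covV (hU hq.2) (hUV _ hq.2) a ξ
  have hder := polyOp_fderiv_jetCoord (N := N) covT covV hU hUV
  have hsrc : ∀ q ∈ N ×ˢ U, movePt g c q ∈ tbase (𝓡 n) c' ∩ vbase F V x₁' := fun q hq =>
    ⟨by rw [tbase_eq_source]; exact hs' q hq, hV' q hq⟩
  set B := Module.finBasis ℝ (EuclideanSpace ℝ (Fin n)) with hB
  induction i with
  | zero => exact fun b r => polyOp_movedJet_zero covT covV A hg hU hUV hV' b r
  | succ i ih =>
    intro b r
    obtain ⟨l, b, rfl⟩ : ∃ l b', b = Fin.cons l b' := ⟨b 0, Fin.tail b, (Fin.cons_self_tail b).symm⟩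
    -- The field is the push-forward under `g(γ)` of the `l`-th coordinate field of the chart at
    -- `c'`, written in the coordinates `z` of the chart at `c`.
    have hY : ContDiffOn ℝ ∞ (fun q : EG × EuclideanSpace ℝ (Fin n) =>
        fderiv ℝ (moveCoord g c c') (q.1, extChartAt (𝓡 n) c' (movePt g c q)) (0, B l))
        (N ×ˢ U) := by
      have h1 := (contDiffOn_moveCoord (n := n) (c := c) (c' := c') hg).fderiv_of_isOpen
        (isOpen_moveDomain (n := n) hN hg) (m := ∞) (by simp)
      have h2 : ContDiffOn ℝ ∞ (fun q : EG × EuclideanSpace ℝ (Fin n) =>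
          (q.1, extChartAt (𝓡 n) c' (movePt g c q))) (N ×ˢ U) :=
        contDiffOn_fst.prodMk (contDiffOn_comp_movePt hg hU hs' contMDiffOn_extChartAt)
      exact (h1.comp h2 fun q hq => moveDomain_coord hU hq (hs' q hq)).clm_apply contDiffOn_const
    have h1 := (ih b r).fderiv_apply_field hD hv hder hY
    have h2 : PolyOp (N ×ˢ U) jetOrder (jetCoord covT covV c x₁) 1 (i + 1)
        (fun ξ q => ∑ s, vChristoffel covV c' x₁' l s r (movePt g c q) *
          movedJet covT covV A g c c' x₁' ⟨i, b, s⟩ ξ q) :=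
      PolyOp.sum fun s _ => PolyOp.smul (contDiffOn_comp_movePt hg hU hsrc
        (contMDiffOn_vChristoffel covV c' x₁' l s r)) ((ih b s).mono i.le_succ)
    have h3 : PolyOp (N ×ˢ U) jetOrder (jetCoord covT covV c x₁) 1 (i + 1)
        (fun ξ q => ∑ j, ∑ m, tChristoffel covT c' l (b j) m (movePt g c q) *
          movedJet covT covV A g c c' x₁' ⟨i, Function.update b j m, r⟩ ξ q) :=
      PolyOp.sum fun j _ => PolyOp.sum fun m _ => PolyOp.smul (contDiffOn_comp_movePt hg hU
        (fun q hq => (hsrc q hq).1) (contMDiffOn_tChristoffel covT c' l (b j) m))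
        ((ih _ r).mono i.le_succ)
    refine ((h1.add h2).sub h3).congr fun ξ q hq => ?_
    rw [movedJet, jetComp_succ_coord covT covV (hs' q hq) (hV' q hq)]
    congr 2
    obtain ⟨γ, z⟩ := q
    set y₀ := extChartAt (𝓡 n) c' (movePt g c (γ, z)) with hy₀
    have hdom : (γ, y₀) ∈ moveDomain g N c c' := moveDomain_coord hU hq (hs' _ hq)
    have hdo := isOpen_moveDomain (n := n) (c := c) (c' := c') hN hg
    have hz : moveCoord g c c' (γ, y₀) = z := moveCoord_coord hU hq (hs' _ hq)
    -- For frozen `γ`, the component as a function of the coordinates `y` at `c'` is `movedJet`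
    -- after the change of coordinates `y ↦ z`. Differentiating this composite in the direction `B
    -- l` produces the derivative along `(0, Y)`.
    have h4 : jetCoord covT covV c' x₁' ⟨i, b, r⟩ (A.pullback (g γ) ξ) =ᶠ[𝓝 y₀]
        fun y => movedJet covT covV A g c c' x₁' ⟨i, b, r⟩ ξ (γ, moveCoord g c c' (γ, y)) := by
      have : ∀ᶠ y in 𝓝 y₀, (γ, y) ∈ moveDomain g N c c' :=
        (Continuous.prodMk_right γ).continuousAt.eventually (hdo.mem_nhds hdom)
      filter_upwards [this] with y hy
      simp only [movedJet, jetCoord, movePt_moveCoord hy]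
    have h5 : HasFDerivAt (fun y => moveCoord g c c' (γ, y))
        ((fderiv ℝ (moveCoord g c c') (γ, y₀)).comp
          (ContinuousLinearMap.inr ℝ EG (EuclideanSpace ℝ (Fin n)))) y₀ :=
      HasFDerivAt.comp (g := moveCoord g c c') y₀ (((contDiffOn_moveCoord hg).contDiffAt
        (hdo.mem_nhds hdom)).differentiableAt (by simp)).hasFDerivAt (hasFDerivAt_prodMk_right γ y₀)
    have h6 : HasFDerivAt (movedJet covT covV A g c c' x₁' ⟨i, b, r⟩ ξ)
        (fderiv ℝ (movedJet covT covV A g c c' x₁' ⟨i, b, r⟩ ξ) (γ, z))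
        (γ, moveCoord g c c' (γ, y₀)) := by
      rw [hz]
      exact ((ih b r).differentiableAt hD hv ξ _ hq).hasFDerivAt
    have h7 := HasFDerivAt.comp y₀ h6 ((hasFDerivAt_const γ y₀).prodMk h5)
    rw [h4.fderiv_eq]
    refine (congrArg (fun L : EuclideanSpace ℝ (Fin n) →L[ℝ] ℝ => L (B l)) h7.fderiv).trans ?_
    simp

end MovingJets

/-! ### Smoothness of the determinant and of the inverse matrix -/

section MatrixSmooth

variable {ι : Type*} [Fintype ι] [DecidableEq ι]

lemma contDiff_det : ContDiff ℝ ∞ fun A : ι → ι → ℝ => (Matrix.of A).det := by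
  simp only [Matrix.det_apply, Matrix.of_apply]
  refine ContDiff.sum fun σ _ => ContDiff.const_smul _ (contDiff_prod fun i _ => ?_)
  exact contDiff_apply_apply ℝ ℝ (σ i) i

/-- Cramer's rule: an entry of the inverse is a quotient of determinants. -/
lemma contDiffAt_inv_apply {A : ι → ι → ℝ} (hA : (Matrix.of A).det ≠ 0) (i j : ι) :
    ContDiffAt ℝ ∞ (fun A : ι → ι → ℝ => (Matrix.of A)⁻¹ i j) A := by
  have h : (fun A : ι → ι → ℝ => (Matrix.of A)⁻¹ i j) = fun A : ι → ι → ℝ =>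
      ((Matrix.of A).det)⁻¹ * (Matrix.of (Function.update A j (Pi.single i 1))).det := by
    funext A
    rw [Matrix.inv_def, Matrix.smul_apply, Matrix.adjugate_apply, Ring.inverse_eq_inv', smul_eq_mul]
    rfl
  rw [h]
  refine (contDiff_det.contDiffAt.inv hA).mul (contDiff_det.comp ?_).contDiffAt
  refine contDiff_pi.2 fun l => ?_
  by_cases hl : l = j
  · subst hl
    simpa using contDiff_const
  · simpa [hl] using contDiff_apply ℝ (ι → ℝ) l

end MatrixSmooth

/-! ### The Hilbert–Schmidt norm as a quadratic form in frame components -/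

section TensorNorm

variable
  {E : Type*} [NormedAddCommGroup E] [NormedSpace ℝ E] [FiniteDimensional ℝ E]
  {H : Type*} [TopologicalSpace H] {I : ModelWithCorners ℝ E H}
  {M : Type*} [TopologicalSpace M] [ChartedSpace H M] [IsManifold I ∞ M]
  {F : Type*} [NormedAddCommGroup F] [NormedSpace ℝ F] [FiniteDimensional ℝ F]
  {V : M → Type*} [TopologicalSpace (TotalSpace F V)]
  [∀ x, NormedAddCommGroup (V x)] [∀ x, InnerProductSpace ℝ (V x)]
  [FiberBundle F V] [VectorBundle ℝ F V] [ContMDiffVectorBundle ∞ F V I]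
  [RiemannianBundle (fun x : M => TangentSpace I x)]

/-- Expand every argument in an orthonormal basis: the coefficients are bounded by Cauchy–Schwarz,
each value on basis vectors is at most the Hilbert–Schmidt norm, and there are `dim ^ i` terms. -/
lemma norm_le_tensorNorm {i : ℕ} {T : ∀ x : M, (Fin i → TangentSpace I x) → V x}
    (hT : IsSmoothTensor (F := F) T) {x : M} (w : Fin i → TangentSpace I x) :
    ‖T x w‖ ≤ (Module.finrank ℝ E : ℝ) ^ i * (∏ j, ‖w j‖) * tensorNorm T x := by
  set e := stdOrthonormalBasis ℝ (TangentSpace I x) with he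
  have h1 : T x w = ∑ a : Fin i → Fin (Module.finrank ℝ (TangentSpace I x)),
      (∏ j, inner ℝ (e (a j)) (w j)) • T x fun j => e (a j) := by
    rw [← hT.expand x (fun j b => inner ℝ (e b) (w j)) e]
    congr 1
    funext j
    exact (e.sum_repr' (w j)).symm
  have h2 : ∀ a : Fin i → Fin (Module.finrank ℝ (TangentSpace I x)),
      ‖(∏ j, inner ℝ (e (a j)) (w j)) • T x fun j => e (a j)‖ ≤ (∏ j, ‖w j‖) * tensorNorm T x := by
    intro a
    rw [norm_smul, norm_prod]
    refine mul_le_mul (Finset.prod_le_prod (fun _ _ => norm_nonneg _) fun j _ => ?_) ?_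
      (norm_nonneg _) (Finset.prod_nonneg fun _ _ => norm_nonneg _)
    · simpa using norm_inner_le_norm (𝕜 := ℝ) (e (a j)) (w j)
    · refine Real.le_sqrt_of_sq_le ?_
      exact Finset.single_le_sum (f := fun a : Fin i → Fin (Module.finrank ℝ (TangentSpace I x)) =>
        ‖T x fun j => e (a j)‖ ^ 2) (fun _ _ => sq_nonneg _) (Finset.mem_univ a)
  rw [h1]
  refine (norm_sum_le _ _).trans ((Finset.sum_le_sum fun a _ => h2 a).trans (le_of_eq ?_))
  rw [Finset.sum_const, Finset.card_univ, Fintype.card_fun, Fintype.card_fin, Fintype.card_fin,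
    nsmul_eq_mul, mul_assoc]
  push_cast
  rfl

lemma tensorNorm_sq_eq_frame {i : ℕ} {T : ∀ x : M, (Fin i → TangentSpace I x) → V x}
    (hT : IsSmoothTensor (F := F) T) (c : M) {x : M} (hx : x ∈ tbase I c) :
    tensorNorm T x ^ 2 = ∑ b : Fin i → Fin (Module.finrank ℝ E),
      ∑ b' : Fin i → Fin (Module.finrank ℝ E), (∏ j, (gram (I := I) c x)⁻¹ (b j) (b' j)) *
        inner ℝ (T x fun j => tframe I c (b j) x) (T x fun j => tframe I c (b' j) x) := by
  have h := (tensorNorm_eq_frame hT c hx).2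
  rw [h, Real.sq_sqrt]
  -- The frame formula for the norm is a square root, so the sum must be shown to be nonnegative. If
  -- it were negative, the root would take the value zero, hence `T` would vanish at `x` by
  -- `norm_le_tensorNorm`, and so would the sum.
  by_contra hneg
  rw [Real.sqrt_eq_zero_of_nonpos (not_le.1 hneg).le] at h
  have h0 : ∀ w, T x w = 0 := fun w => by
    have := norm_le_tensorNorm hT w
    rw [h, mul_zero] at this
    exact norm_le_zero_iff.1 this
  simp [h0] at hneg

lemma contMDiffOn_gram
    [IsContMDiffRiemannianBundle I ∞ E (fun x : M => TangentSpace I x)] (c : M) (a b) :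
    ContMDiffOn I 𝓘(ℝ) ∞ (fun x => gram (I := I) c x a b) (tbase I c) :=
  ContMDiffOn.inner_bundle (IB := I) (n := ∞) (E := fun x : M => TangentSpace I x)
    (contMDiffOn_tframe c a) (contMDiffOn_tframe c b)

lemma det_gram_ne_zero (c : M) {x : M} (hx : x ∈ tbase I c) : (gram (I := I) c x).det ≠ 0 := by
  -- Invertibility of the Gram matrix is part of `tensorNorm_eq_frame`, which asks for some tensor;
  -- the zero function serves.
  have hT : IsSmoothTensor (F := ℝ) (V := Bundle.Trivial M ℝ)
      (fun (x : M) (_ : Fin 0 → TangentSpace I x) => (0 : ℝ)) :=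
    ⟨fun _ _ j => j.elim0, fun _ _ j => j.elim0,
      fun _ _ => (contMDiff_zeroSection (IB := I) (F := ℝ) ℝ (Bundle.Trivial M ℝ)).contMDiffOn⟩
  exact (tensorNorm_eq_frame hT c hx).1.ne_zero

lemma contMDiffOn_gram_inv
    [IsContMDiffRiemannianBundle I ∞ E (fun x : M => TangentSpace I x)] (c : M) (a b) :
    ContMDiffOn I 𝓘(ℝ) ∞ (fun x => (gram (I := I) c x)⁻¹ a b) (tbase I c) := by
  have h : ContMDiffOn I 𝓘(ℝ, Fin (Module.finrank ℝ E) → Fin (Module.finrank ℝ E) → ℝ) ∞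
      (fun x a b => gram (I := I) c x a b) (tbase I c) :=
    contMDiffOn_pi_space.2 fun a => contMDiffOn_pi_space.2 fun b => contMDiffOn_gram c a b
  intro x hx
  exact (contDiffAt_inv_apply (A := fun a b => gram (I := I) c x a b)
    (det_gram_ne_zero c hx) a b).contMDiffAt.comp_contMDiffWithinAt x (h x hx)

end TensorNorm

/-! ### Even powers of the norm of the moved jet -/

section MovingNorm

variable {n : ℕ} {EG : Type*} [NormedAddCommGroup EG] [NormedSpace ℝ EG]
  {G : Type*} [TopologicalSpace G] [ChartedSpace EG G] [Group G] [LieGroup 𝓘(ℝ, EG) ∞ G]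
  {M : Type*} [TopologicalSpace M] [ChartedSpace (EuclideanSpace ℝ (Fin n)) M]
  [IsManifold (𝓡 n) ∞ M] [T2Space M]
  [RiemannianBundle (fun x : M => TangentSpace (𝓡 n) x)]
  [IsContMDiffRiemannianBundle (𝓡 n) ∞ (EuclideanSpace ℝ (Fin n))
    (fun x : M => TangentSpace (𝓡 n) x)]
  [MulAction G M] [ContMDiffSMul 𝓘(ℝ, EG) (𝓡 n) ∞ G M]
  {F : Type*} [NormedAddCommGroup F] [NormedSpace ℝ F] [FiniteDimensional ℝ F]
  {V : M → Type*} [TopologicalSpace (TotalSpace F V)]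
  [∀ x, NormedAddCommGroup (V x)] [∀ x, InnerProductSpace ℝ (V x)]
  [FiberBundle F V] [VectorBundle ℝ F V] [ContMDiffVectorBundle ∞ F V (𝓡 n)]
  [IsContMDiffRiemannianBundle (𝓡 n) ∞ F V]
  (covT : CovariantDerivative (𝓡 n) (EuclideanSpace ℝ (Fin n))
    (fun x : M => TangentSpace (𝓡 n) x))
  [CovariantDerivative.ContMDiffCovariantDerivative covT ∞]
  (covV : CovariantDerivative (𝓡 n) F V)
  [CovariantDerivative.ContMDiffCovariantDerivative covV ∞]
  (A : BundleAction n EG G F V)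
  {g : EG → G} {N : Set EG} {U : Set (EuclideanSpace ℝ (Fin n))} {c c' x₁ x₁' : M}

/-- The squared norm is quadratic in the components, with coefficients from the inverse Gram matrix
and the fiber metric, hence of degree 2. Evenness of `p` makes the `p`-th power a natural power of
the square; an odd power would leave a square root, which is not polynomial. -/
lemma polyOp_tensorNorm_pow (hN : IsOpen N) (hg : ContMDiffOn 𝓘(ℝ, EG) 𝓘(ℝ, EG) ∞ g N)
    (hUo : IsOpen U) (hU : U ⊆ (extChartAt (𝓡 n) c).target)
    (hUV : ∀ z ∈ U, (extChartAt (𝓡 n) c).symm z ∈ vbase F V x₁)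
    (hs' : ∀ q ∈ N ×ˢ U, movePt g c q ∈ (chartAt (EuclideanSpace ℝ (Fin n)) c').source)
    (hV' : ∀ q ∈ N ×ˢ U, movePt g c q ∈ vbase F V x₁') {i k : ℕ} (hik : i ≤ k) {p : ℕ}
    (hp : Even p) :
    PolyOp (N ×ˢ U) jetOrder (jetCoord covT covV c x₁) p k
      (fun ξ q => tensorNorm (iterCovDeriv covT covV (A.pullback (g q.1) ξ) i)
        (movePt g c q) ^ p) := by
  have hJ := polyOp_movedJet covT covV A hN hg hUo hU hUV hs' hV' i
  have hsrc : ∀ q ∈ N ×ˢ U, movePt g c q ∈ tbase (𝓡 n) c' := fun q hq => by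
    rw [tbase_eq_source]; exact hs' q hq
  have hG : ∀ b b' : Fin i → Fin (Module.finrank ℝ (EuclideanSpace ℝ (Fin n))),
      ContDiffOn ℝ ∞ (fun q => ∏ j, (gram (I := 𝓡 n) c' (movePt g c q))⁻¹ (b j) (b' j))
        (N ×ˢ U) := fun b b' =>
    contDiffOn_prod fun j _ => contDiffOn_comp_movePt hg hU hsrc
      (contMDiffOn_gram_inv (I := 𝓡 n) c' (b j) (b' j))
  have hI : ∀ r s : Fin (Module.finrank ℝ F), ContDiffOn ℝ ∞ (fun q =>
      inner ℝ (vframe F V x₁' r (movePt g c q)) (vframe F V x₁' s (movePt g c q))) (N ×ˢ U) :=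
    fun r s => contDiffOn_comp_movePt (f := fun x => inner ℝ (vframe F V x₁' r x)
      (vframe F V x₁' s x)) hg hU hV' (ContMDiffOn.inner_bundle (IB := 𝓡 n) (n := ∞)
        (contMDiffOn_vframe x₁' r) (contMDiffOn_vframe x₁' s))
  have h2 : PolyOp (N ×ˢ U) jetOrder (jetCoord covT covV c x₁) 2 i
      (fun ξ q => tensorNorm (iterCovDeriv covT covV (A.pullback (g q.1) ξ) i)
        (movePt g c q) ^ 2) := by
    refine (PolyOp.sum (s := Finset.univ) fun b _ => PolyOp.sum (s := Finset.univ) fun b' _ =>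
      (PolyOp.sum (s := Finset.univ) fun r _ => PolyOp.sum (s := Finset.univ) fun s _ =>
        ((hJ b r).mul (hJ b' s)).smul (hI r s)).smul (hG b b')).congr fun ξ q hq => ?_
    rw [tensorNorm_sq_eq_frame (isSmoothTensor_iterCovDeriv covT covV
      (A.pullback (g q.1) ξ).contMDiff i) c' (hsrc q hq)]
    refine Finset.sum_congr rfl fun b _ => Finset.sum_congr rfl fun b' _ => ?_
    congr 1
    have hx := hV' q hq
    conv_lhs => rw [eq_sum_vcoeff (I := 𝓡 n) hx (iterCovDeriv covT covV (A.pullback (g q.1) ξ) i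
      (movePt g c q) fun j => tframe (𝓡 n) c' (b j) (movePt g c q)),
      eq_sum_vcoeff (I := 𝓡 n) hx (iterCovDeriv covT covV (A.pullback (g q.1) ξ) i
      (movePt g c q) fun j => tframe (𝓡 n) c' (b' j) (movePt g c q))]
    rw [sum_inner]
    refine Finset.sum_congr rfl fun r _ => ?_
    rw [inner_sum]
    refine Finset.sum_congr rfl fun s _ => ?_
    rw [real_inner_smul_left, real_inner_smul_right, movedJet, movedJet, jetComp, jetComp]
    ring
  obtain ⟨m, rfl⟩ := hp
  rw [← two_mul]
  simp only [pow_mul]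
  exact (h2.mono hik).pow m

end MovingNorm

/-! ### The Riemannian volume in coordinates -/

section Volume

variable {n : ℕ} {M : Type*} [TopologicalSpace M] [ChartedSpace (EuclideanSpace ℝ (Fin n)) M]
  [IsManifold (𝓡 n) ∞ M]
  [RiemannianBundle (fun x : M => TangentSpace (𝓡 n) x)]

/-- The density of the Riemannian volume in the chart at `c`. -/
def volDensity (c : M) (y : EuclideanSpace ℝ (Fin n)) : ℝ := √(metricMatrix c y).det

lemma volDensity_nonneg (c : M) (y : EuclideanSpace ℝ (Fin n)) : 0 ≤ volDensity c y :=
  Real.sqrt_nonneg _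

lemma mfderiv_symm_eq_symmL {c : M} {y : EuclideanSpace ℝ (Fin n)}
    (hy : y ∈ (extChartAt (𝓡 n) c).target) :
    mfderiv 𝓘(ℝ, EuclideanSpace ℝ (Fin n)) (𝓡 n) (extChartAt (𝓡 n) c).symm y =
      (trivializationAt (EuclideanSpace ℝ (Fin n)) (TangentSpace (𝓡 n) : M → Type _) c).symmL ℝ
        ((extChartAt (𝓡 n) c).symm y) := by
  have h := TangentBundle.symmL_trivializationAt (I := 𝓡 n) (mem_source_of_mem_target hy)
  simp only [modelWithCornersSelf_coe, Set.range_id, mfderivWithin_univ] at h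
  rw [h, (extChartAt (𝓡 n) c).right_inv hy]

/-- The derivative of the inverse chart at `c`, at the point with coordinates `y`. -/
def coordMap (c : M) (y : EuclideanSpace ℝ (Fin n)) :
    EuclideanSpace ℝ (Fin n) →L[ℝ] TangentSpace (𝓡 n) ((extChartAt (𝓡 n) c).symm y) :=
  (trivializationAt (EuclideanSpace ℝ (Fin n)) (TangentSpace (𝓡 n) : M → Type _) c).symmL ℝ
    ((extChartAt (𝓡 n) c).symm y)

lemma coordVec_eq {c : M} {y : EuclideanSpace ℝ (Fin n)}
    (hy : y ∈ (extChartAt (𝓡 n) c).target) (i : Fin n) :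
    coordVec c y i = coordMap c y (EuclideanSpace.single i (1 : ℝ)) :=
  congrArg (fun L : EuclideanSpace ℝ (Fin n) →L[ℝ]
    TangentSpace (𝓡 n) ((extChartAt (𝓡 n) c).symm y) => L (EuclideanSpace.single i (1 : ℝ)))
    (mfderiv_symm_eq_symmL hy)

lemma injective_coordMap {c : M} {y : EuclideanSpace ℝ (Fin n)}
    (hy : y ∈ (extChartAt (𝓡 n) c).target) : Function.Injective (coordMap c y) := by
  have hb : (extChartAt (𝓡 n) c).symm y ∈ (trivializationAt (EuclideanSpace ℝ (Fin n))
      (TangentSpace (𝓡 n) : M → Type _) c).baseSet := by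
    rw [TangentBundle.trivializationAt_baseSet]; exact mem_source_of_mem_target hy
  exact Function.LeftInverse.injective
      ((trivializationAt (EuclideanSpace ℝ (Fin n)) (TangentSpace (𝓡 n) : M → Type _)
        c).continuousLinearMapAt_symmL (R := ℝ) hb)

lemma det_inner_pos_of_injective {X : Type*} [NormedAddCommGroup X] [InnerProductSpace ℝ X]
    (L : EuclideanSpace ℝ (Fin n) →ₗ[ℝ] X) (hL : Function.Injective L) :
    0 < (Matrix.of fun i j : Fin n => (inner ℝ (L (EuclideanSpace.single i (1 : ℝ)))
      (L (EuclideanSpace.single j (1 : ℝ))) : ℝ)).det := by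
  have h := (EuclideanSpace.basisFun (Fin n) ℝ).toBasis.linearIndependent.map' L
    (LinearMap.ker_eq_bot.2 hL)
  have h2 := (Matrix.posDef_gram_of_linearIndependent h).det_pos
  have h3 : (Matrix.of fun i j : Fin n => (inner ℝ (L (EuclideanSpace.single i (1 : ℝ)))
      (L (EuclideanSpace.single j (1 : ℝ))) : ℝ)) =
      Matrix.gram ℝ (L ∘ (EuclideanSpace.basisFun (Fin n) ℝ).toBasis) := by
    ext i j
    simp [Matrix.gram]
  rw [h3]
  exact h2

lemma det_metricMatrix_pos {c : M} {y : EuclideanSpace ℝ (Fin n)}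
    (hy : y ∈ (extChartAt (𝓡 n) c).target) : 0 < (metricMatrix c y).det := by
  have h := det_inner_pos_of_injective (coordMap c y).toLinearMap (injective_coordMap hy)
  have h2 : metricMatrix c y = Matrix.of fun i j : Fin n =>
      (inner ℝ (coordMap c y (EuclideanSpace.single i (1 : ℝ)))
        (coordMap c y (EuclideanSpace.single j (1 : ℝ))) : ℝ) := by
    ext i j
    rw [metricMatrix, coordVec_eq hy, coordVec_eq hy]
    rfl
  rw [h2]
  exact h

lemma volDensity_pos {c : M} {y : EuclideanSpace ℝ (Fin n)}
    (hy : y ∈ (extChartAt (𝓡 n) c).target) : 0 < volDensity c y :=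
  Real.sqrt_pos.2 (det_metricMatrix_pos hy)

variable [IsContMDiffRiemannianBundle (𝓡 n) ∞ (EuclideanSpace ℝ (Fin n))
    (fun x : M => TangentSpace (𝓡 n) x)]

/-- The metric matrix uses the standard basis of `EuclideanSpace` while `tframe` uses
`Module.finBasis`; a constant change of basis reduces the claim to the Gram matrix. -/
lemma contDiffOn_metricMatrix (c : M) (i j : Fin n) :
    ContDiffOn ℝ ∞ (fun y => metricMatrix c y i j) (extChartAt (𝓡 n) c).target := by
  set B := Module.finBasis ℝ (EuclideanSpace ℝ (Fin n)) with hB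
  have h1 : ∀ l m, ContDiffOn ℝ ∞ (fun y => gram (I := 𝓡 n) c ((extChartAt (𝓡 n) c).symm y) l m)
      (extChartAt (𝓡 n) c).target := fun l m =>
    ((contMDiffOn_gram (I := 𝓡 n) c l m).comp (contMDiffOn_extChartAt_symm c) fun y hy => by
      rw [Set.mem_preimage, tbase_eq_source]; exact mem_source_of_mem_target hy).contDiffOn
  have h2 : ContDiffOn ℝ ∞ (fun y => ∑ l, ∑ m,
      B.repr (EuclideanSpace.single i (1 : ℝ)) l * (B.repr (EuclideanSpace.single j (1 : ℝ)) m *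
        gram (I := 𝓡 n) c ((extChartAt (𝓡 n) c).symm y) l m)) (extChartAt (𝓡 n) c).target :=
    ContDiffOn.sum fun l _ => ContDiffOn.sum fun m _ =>
      contDiffOn_const.mul (contDiffOn_const.mul (h1 l m))
  refine h2.congr fun y hy => ?_
  have h3 : ∀ i, coordVec c y i = ∑ l, B.repr (EuclideanSpace.single i (1 : ℝ)) l •
      tframe (𝓡 n) c l ((extChartAt (𝓡 n) c).symm y) := by
    intro i
    have h4 : ∀ l, tframe (𝓡 n) c l ((extChartAt (𝓡 n) c).symm y) = coordMap c y (B l) := by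
      intro l
      rw [tframe_eq_mfderiv (mem_source_of_mem_target hy), (extChartAt (𝓡 n) c).right_inv hy]
      exact congrArg (fun L : EuclideanSpace ℝ (Fin n) →L[ℝ]
        TangentSpace (𝓡 n) ((extChartAt (𝓡 n) c).symm y) => L (B l)) (mfderiv_symm_eq_symmL hy)
    rw [coordVec_eq hy]
    conv_lhs => rw [← B.sum_repr (EuclideanSpace.single i (1 : ℝ)), map_sum]
    refine Finset.sum_congr rfl fun l _ => ?_
    rw [h4, map_smul]
  change inner ℝ (coordVec c y i) (coordVec c y j) = _
  rw [h3, h3, sum_inner]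
  refine Finset.sum_congr rfl fun l _ => ?_
  rw [inner_sum]
  refine Finset.sum_congr rfl fun m _ => ?_
  rw [real_inner_smul_left, real_inner_smul_right]
  rfl

/-- The square root is smooth here because the determinant is positive: the coordinate vectors are
linearly independent. -/
lemma contDiffOn_volDensity (c : M) :
    ContDiffOn ℝ ∞ (volDensity c) (extChartAt (𝓡 n) c).target := by
  have h : ContDiffOn ℝ ∞ (fun y i j => metricMatrix c y i j) (extChartAt (𝓡 n) c).target :=
    contDiffOn_pi.2 fun i => contDiffOn_pi.2 fun j => contDiffOn_metricMatrix c i j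
  exact (contDiff_det.comp_contDiffOn h).sqrt fun y hy => (det_metricMatrix_pos hy).ne'

variable [MeasurableSpace M] [BorelSpace M]

lemma integral_chartVolume (c : M) {f : M → ℝ} (hf : Continuous f) :
    ∫ x, f x ∂(chartVolume n c) = ∫ y in (extChartAt (𝓡 n) c).target,
      volDensity c y * f ((extChartAt (𝓡 n) c).symm y) := by
  have hto : MeasurableSet (extChartAt (𝓡 n) c).target := (isOpen_extChartAt_target c).measurableSet
  have h1 : AEMeasurable (extChartAt (𝓡 n) c).symm
      (volume.restrict (extChartAt (𝓡 n) c).target) :=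
    (continuousOn_extChartAt_symm c).aemeasurable hto
  have h2 : AEMeasurable (fun y => ENNReal.ofReal (√(metricMatrix c y).det))
      (volume.restrict (extChartAt (𝓡 n) c).target) :=
    ((contDiffOn_volDensity c).continuousOn.aemeasurable hto).ennreal_ofReal
  rw [chartVolume, integral_map (h1.mono_ac (withDensity_absolutelyContinuous _ _))
    hf.aestronglyMeasurable, integral_withDensity_eq_integral_toReal_smul₀ h2 (by simp)]
  refine integral_congr_ae (Filter.Eventually.of_forall fun y => ?_)
  simp only [ENNReal.toReal_ofReal (Real.sqrt_nonneg _), smul_eq_mul]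
  rfl

variable [T2Space M] [CompactSpace M]

variable (n) in
/-- The contribution of the chart at `c` to the Riemannian integral of `f`. -/
def chartIntegral (c : M) (f : M → ℝ) : ℝ :=
  ∫ y in (extChartAt (𝓡 n) c).target, volDensity c y *
    (chartPartition n M c ((extChartAt (𝓡 n) c).symm y) * f ((extChartAt (𝓡 n) c).symm y))

variable (n M) in
/-- The finitely many charts that contribute to the Riemannian volume. -/
def activeCharts : Finset M :=
  ((chartPartition n M).locallyFinite.finite_nonempty_of_compact).toFinset

lemma chartPartition_eq_zero {c : M} (hc : c ∉ activeCharts n M) (x : M) :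
    chartPartition n M c x = 0 := by
  by_contra hx
  exact hc (((chartPartition n M).locallyFinite.finite_nonempty_of_compact).mem_toFinset.2 ⟨x, hx⟩)

/-- The measure is a sum over all points of `M`, but by local finiteness and compactness only
finitely many members of the partition of unity are not identically zero. -/
lemma integral_riemannianVolume {f : M → ℝ} (hf : Continuous f) :
    ∫ x, f x ∂(riemannianVolume n M) = ∑ c ∈ activeCharts n M, chartIntegral n c f := by
  have hint : Integrable f (riemannianVolume n M) :=
    hf.integrable_of_hasCompactSupport (HasCompactSupport.of_compactSpace _)
  have h1 := hasSum_integral_measure hint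
  have hterm : ∀ c : M, ∫ x, f x ∂((chartVolume n c).withDensity
      fun x => ENNReal.ofReal (chartPartition n M c x)) = chartIntegral n c f := by
    intro c
    have hc : Continuous (chartPartition n M c) := (chartPartition n M c).contMDiff.continuous
    rw [integral_withDensity_eq_integral_toReal_smul₀
      hc.measurable.ennreal_ofReal.aemeasurable (by simp), chartIntegral,
      ← integral_chartVolume c (f := fun x => chartPartition n M c x * f x) (hc.mul hf)]
    refine integral_congr_ae (Filter.Eventually.of_forall fun y => ?_)
    simp only [ENNReal.toReal_ofReal ((chartPartition n M).nonneg c y), smul_eq_mul]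
  refine h1.unique ?_
  simp only [hterm]
  refine hasSum_sum_of_ne_finset_zero fun c hc => ?_
  simp [chartIntegral, chartPartition_eq_zero hc]

lemma chartIntegral_nonneg (c : M) {f : M → ℝ} (hf : ∀ x, 0 ≤ f x) : 0 ≤ chartIntegral n c f :=
  integral_nonneg fun y => mul_nonneg (volDensity_nonneg c y)
    (mul_nonneg ((chartPartition n M).nonneg c _) (hf _))

lemma continuousOn_chartIntegrand (c : M) {f : M → ℝ} (hf : Continuous f) :
    ContinuousOn (fun y => volDensity c y * (chartPartition n M c ((extChartAt (𝓡 n) c).symm y) *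
      f ((extChartAt (𝓡 n) c).symm y))) (extChartAt (𝓡 n) c).target :=
  (contDiffOn_volDensity c).continuousOn.mul
    (((chartPartition n M c).contMDiff.continuous.mul hf).comp_continuousOn
      (continuousOn_extChartAt_symm c))

lemma isCompact_chartSupport (c : M) :
    IsCompact (extChartAt (𝓡 n) c '' tsupport (chartPartition n M c)) ∧
      extChartAt (𝓡 n) c '' tsupport (chartPartition n M c) ⊆ (extChartAt (𝓡 n) c).target := by
  have hsub : tsupport (chartPartition n M c) ⊆ (extChartAt (𝓡 n) c).source := by
    rw [extChartAt_source]
    exact chartPartition_isSubordinate c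
  refine ⟨(isClosed_tsupport _).isCompact.image_of_continuousOn
    ((continuousOn_extChartAt c).mono hsub), ?_⟩
  rintro _ ⟨x, hx, rfl⟩
  exact (extChartAt (𝓡 n) c).map_source (hsub hx)

lemma integrableOn_chartIntegrand (c : M) {f : M → ℝ} (hf : Continuous f) :
    IntegrableOn (fun y => volDensity c y * (chartPartition n M c ((extChartAt (𝓡 n) c).symm y) *
      f ((extChartAt (𝓡 n) c).symm y))) (extChartAt (𝓡 n) c).target := by
  obtain ⟨hK, hKt⟩ := isCompact_chartSupport (n := n) c
  refine (((continuousOn_chartIntegrand c hf).mono hKt).integrableOn_compact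
    hK).of_forall_sdiff_eq_zero (isOpen_extChartAt_target c).measurableSet fun y hy => ?_
  have : (extChartAt (𝓡 n) c).symm y ∉ tsupport (chartPartition n M c) := fun h =>
    hy.2 ⟨_, h, (extChartAt (𝓡 n) c).right_inv hy.1⟩
  rw [image_eq_zero_of_notMem_tsupport this, zero_mul, mul_zero]

/-- For `f ≥ 0` the contributions of the other charts can be dropped, and `δ` bounds from below the
weight of the chart at `c` against Lebesgue measure. In this way `L_k^p`-norms control Lebesgue
norms on compact pieces of a chart. -/
lemma setIntegral_le_integral_riemannianVolume {c : M} {f : M → ℝ} (hf : Continuous f)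
    (hf0 : ∀ x, 0 ≤ f x) {K : Set (EuclideanSpace ℝ (Fin n))} (hK : IsCompact K)
    (hKt : K ⊆ (extChartAt (𝓡 n) c).target) {δ : ℝ}
    (hδ : ∀ y ∈ K, δ ≤ volDensity c y * chartPartition n M c ((extChartAt (𝓡 n) c).symm y)) :
    δ * ∫ y in K, f ((extChartAt (𝓡 n) c).symm y) ≤ ∫ x, f x ∂(riemannianVolume n M) := by
  have h1 : chartIntegral n c f ≤ ∫ x, f x ∂(riemannianVolume n M) := by
    rw [integral_riemannianVolume hf]
    by_cases hc : c ∈ activeCharts n M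
    · exact Finset.single_le_sum (fun c _ => chartIntegral_nonneg c hf0) hc
    · have : chartIntegral n c f = 0 := by simp [chartIntegral, chartPartition_eq_zero hc]
      rw [this]
      exact Finset.sum_nonneg fun c _ => chartIntegral_nonneg c hf0
  refine le_trans ?_ h1
  have h2 : ContinuousOn (fun y => f ((extChartAt (𝓡 n) c).symm y)) K :=
    hf.comp_continuousOn ((continuousOn_extChartAt_symm c).mono hKt)
  calc δ * ∫ y in K, f ((extChartAt (𝓡 n) c).symm y)
      = ∫ y in K, δ * f ((extChartAt (𝓡 n) c).symm y) := (integral_const_mul _ _).symm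
    _ ≤ ∫ y in K, volDensity c y * (chartPartition n M c ((extChartAt (𝓡 n) c).symm y) *
          f ((extChartAt (𝓡 n) c).symm y)) := by
        refine setIntegral_mono_on ((h2.integrableOn_compact hK).const_mul δ)
          ((integrableOn_chartIntegrand c hf).mono_set hKt) hK.measurableSet fun y hy => ?_
        rw [← mul_assoc]
        exact mul_le_mul_of_nonneg_right (hδ y hy) (hf0 _)
    _ ≤ chartIntegral n c f :=
        setIntegral_mono_set (integrableOn_chartIntegrand c hf)
          (Filter.Eventually.of_forall fun y => mul_nonneg (volDensity_nonneg c y)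
            (mul_nonneg ((chartPartition n M).nonneg c _) (hf0 _))) hKt.eventuallyLE

end Volume

/-! ### Extension of `L^p`-bounded families to the completion -/

section Restriction

variable {E : Type*} [NormedAddCommGroup E] [MeasurableSpace E] [BorelSpace E]

lemma isFiniteMeasure_comap_compact {K : Set E} (hK : IsCompact K) (ν : Measure E)
    [IsFiniteMeasureOnCompacts ν] : IsFiniteMeasure (ν.comap ((↑) : K → E)) := by
  constructor
  rw [comap_subtype_coe_apply hK.measurableSet]
  simpa using hK.measure_lt_top

/-- A linear family of functions that are continuous on a compact set `K`, with `L^p`-norm on `K`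
controlled by the norm of the parameter, extends to the completion of the space of parameters. -/
lemma exists_completion_clm_Lp {S : Type*} [SeminormedAddCommGroup S] [NormedSpace ℝ S]
    {K : Set E} (hK : IsCompact K) (ν : Measure E) [IsFiniteMeasureOnCompacts ν] {p : ℕ}
    [hp : Fact (1 ≤ p)] (v : S → E → ℝ) (hcont : ∀ ξ, ContinuousOn (v ξ) K)
    (hadd : ∀ ξ η, ∀ z ∈ K, v (ξ + η) z = v ξ z + v η z)
    (hsmul : ∀ (r : ℝ) ξ, ∀ z ∈ K, v (r • ξ) z = r * v ξ z) {C : ℝ} (hC : 0 ≤ C)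
    (hbound : ∀ ξ, ∫ z in K, |v ξ z| ^ p ∂ν ≤ (C * ‖ξ‖) ^ p) :
    ∃ u : UniformSpace.Completion S →L[ℝ] Lp ℝ p (ν.comap ((↑) : K → E)),
      ∀ ξ : S, u ξ =ᵐ[ν.comap ((↑) : K → E)] fun z => v ξ z := by
  have : CompactSpace K := isCompact_iff_compactSpace.1 hK
  have := isFiniteMeasure_comap_compact hK ν
  have hp0 : p ≠ 0 := by have := hp.out; omega
  let f : S → C(K, ℝ) := fun ξ => ⟨K.domRestrict (v ξ), (hcont ξ).domRestrict⟩
  let fL : S →ₗ[ℝ] C(K, ℝ) :=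
    { toFun := f
      map_add' := fun ξ η => ContinuousMap.ext fun z => hadd ξ η z z.2
      map_smul' := fun r ξ => ContinuousMap.ext fun z => hsmul r ξ z z.2 }
  let T : S →ₗ[ℝ] Lp ℝ p (ν.comap ((↑) : K → E)) :=
    (ContinuousMap.toLp p (ν.comap ((↑) : K → E)) ℝ).toLinearMap ∘ₗ fL
  have hT : ∀ ξ, T ξ =ᵐ[ν.comap ((↑) : K → E)] fun z => v ξ z := fun ξ =>
    ContinuousMap.coeFn_toLp (𝕜 := ℝ) (p := p) (ν.comap ((↑) : K → E)) (f ξ)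
  have hTb : ∀ ξ, ‖T ξ‖ ≤ C * ‖ξ‖ := by
    intro ξ
    have hm : MemLp (T ξ) p (ν.comap ((↑) : K → E)) := Lp.memLp _
    have h1 : ‖T ξ‖ = (∫ z in K, |v ξ z| ^ p ∂ν) ^ ((p : ℝ)⁻¹) := by
      rw [Lp.norm_def, hm.eLpNorm_eq_integral_rpow_norm (by exact_mod_cast hp0) (by simp),
        ENNReal.toReal_ofReal (by positivity), ← integral_subtype_comap hK.measurableSet]
      simp only [ENNReal.toReal_natCast, Real.rpow_natCast]
      congr 1
      refine integral_congr_ae ?_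
      filter_upwards [hT ξ] with z hz
      rw [hz, Real.norm_eq_abs]
    rw [h1]
    calc (∫ z in K, |v ξ z| ^ p ∂ν) ^ ((p : ℝ)⁻¹) ≤ ((C * ‖ξ‖) ^ p) ^ ((p : ℝ)⁻¹) :=
          Real.rpow_le_rpow (integral_nonneg fun z => by positivity) (hbound ξ) (by positivity)
      _ = C * ‖ξ‖ := Real.pow_rpow_inv_natCast (by positivity) hp0
  let TL := T.mkContinuous C hTb
  refine ⟨TL.extend UniformSpace.Completion.toComplL, fun ξ => ?_⟩
  have h := TL.extend_eq (e := UniformSpace.Completion.toComplL (𝕜 := ℝ) (E := S))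
    UniformSpace.Completion.denseRange_coe (UniformSpace.Completion.isUniformInducing_coe S) ξ
  have h2 : TL.extend UniformSpace.Completion.toComplL (ξ : UniformSpace.Completion S) = T ξ := h
  rw [h2]
  exact hT ξ

end Restriction

/-! ### Jet components as bounded operators from `L_k^p` to `L^p(K)` -/

section GoodNeighborhoods

variable {n : ℕ} {M : Type*} [TopologicalSpace M] [ChartedSpace (EuclideanSpace ℝ (Fin n)) M]
  [IsManifold (𝓡 n) ∞ M] [T2Space M] [CompactSpace M] [MeasurableSpace M] [BorelSpace M]
  [RiemannianBundle (fun x : M => TangentSpace (𝓡 n) x)]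
  [IsContMDiffRiemannianBundle (𝓡 n) ∞ (EuclideanSpace ℝ (Fin n))
    (fun x : M => TangentSpace (𝓡 n) x)]
  {F : Type*} [NormedAddCommGroup F] [NormedSpace ℝ F] [FiniteDimensional ℝ F]
  {V : M → Type*} [TopologicalSpace (TotalSpace F V)]
  [∀ x, NormedAddCommGroup (V x)] [∀ x, InnerProductSpace ℝ (V x)]
  [FiberBundle F V] [VectorBundle ℝ F V] [ContMDiffVectorBundle ∞ F V (𝓡 n)]
  [IsContMDiffRiemannianBundle (𝓡 n) ∞ F V]

variable (n F V) in
/-- A neighborhood `W` of `x₁` in the chart at `c` on which the local frames are controlled and the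
part of the volume that is carried by the chart at `c` is bounded below. -/
structure IsControlled (c x₁ : M) (W : Set M) (δ C : ℝ) : Prop where
  isOpen : IsOpen W
  mem : x₁ ∈ W
  subset_source : W ⊆ (chartAt (EuclideanSpace ℝ (Fin n)) c).source
  subset_vbase : W ⊆ vbase F V x₁
  pos : 0 < δ
  nonneg : 0 ≤ C
  le_density : ∀ x ∈ W, δ ≤ volDensity c (extChartAt (𝓡 n) c x) * chartPartition n M c x
  vcoeff_le : ∀ x ∈ W, ∀ r w, |vcoeff (𝓡 n) F V x₁ r x w| ≤ C * ‖w‖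
  tframe_le : ∀ x ∈ W, ∀ l, ‖tframe (𝓡 n) c l x‖ ≤ C

/-- The fiber metric is continuous, so the trivialization around `x₁` has locally bounded operator
norm; coordinate functionals on the model fiber add a constant factor. -/
lemma eventually_abs_vcoeff_le (x₁ : M) :
    ∃ C, 0 ≤ C ∧ ∀ᶠ x in 𝓝 x₁, ∀ r w, |vcoeff (𝓡 n) F V x₁ r x w| ≤ C * ‖w‖ := by
  have : IsContinuousRiemannianBundle F V := by
    obtain ⟨h, hh, hhi⟩ :=
      IsContMDiffRiemannianBundle.exists_contMDiff (IB := 𝓡 n) (n := ∞) (F := F) (E := V)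
    exact ⟨h, hh.continuous, hhi⟩
  obtain ⟨C₁, hC₁, h₁⟩ := eventually_norm_trivializationAt_lt F V x₁
  let L : Fin (Module.finrank ℝ F) → F →L[ℝ] ℝ := fun r =>
    LinearMap.toContinuousLinearMap ((Module.finBasis ℝ F).coord r)
  refine ⟨(∑ r, ‖L r‖) * C₁, by positivity, ?_⟩
  filter_upwards [h₁, (isOpen_vbase (F := F) (V := V) x₁).mem_nhds (mem_vbase x₁)] with x hx hxb r w
  have h2 : vcoeff (𝓡 n) F V x₁ r x w =
      L r ((trivializationAt F V x₁).continuousLinearMapAt ℝ x w) := by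
    rw [vcoeff_eq_repr hxb, Trivialization.continuousLinearMapAt_apply,
      Trivialization.linearMapAt_apply, if_pos (show x ∈ (trivializationAt F V x₁).baseSet from hxb)]
    rfl
  rw [h2, ← Real.norm_eq_abs, mul_assoc]
  refine ((L r).le_opNorm _).trans (mul_le_mul ?_ ?_ (norm_nonneg _) (by positivity))
  · exact Finset.single_le_sum (f := fun r => ‖L r‖) (fun _ _ => norm_nonneg _) (Finset.mem_univ r)
  · exact (ContinuousLinearMap.le_opNorm _ w).trans
      (mul_le_mul_of_nonneg_right hx.le (norm_nonneg _))

lemma eventually_norm_tframe_le {c x₁ : M} (hx : x₁ ∈ tbase (𝓡 n) c) :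
    ∃ C, 0 ≤ C ∧ ∀ᶠ x in 𝓝 x₁, ∀ l, ‖tframe (𝓡 n) c l x‖ ≤ C := by
  have hg : ∀ l, 0 ≤ gram (I := 𝓡 n) c x₁ l l := fun l => real_inner_self_nonneg
  refine ⟨∑ l, (gram (I := 𝓡 n) c x₁ l l + 2), Finset.sum_nonneg fun l _ => by linarith [hg l], ?_⟩
  refine Filter.eventually_all.2 fun l => ?_
  have h1 : ContinuousAt (fun x => gram (I := 𝓡 n) c x l l) x₁ :=
    (contMDiffOn_gram (I := 𝓡 n) c l l).continuousOn.continuousAt ((isOpen_tbase c).mem_nhds hx)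
  filter_upwards [h1.eventually (Iio_mem_nhds (lt_add_one _))] with x hx
  have h2 : gram (I := 𝓡 n) c x l l = ‖tframe (𝓡 n) c l x‖ ^ 2 := real_inner_self_eq_norm_sq _
  have h3 : ‖tframe (𝓡 n) c l x‖ ^ 2 < gram (I := 𝓡 n) c x₁ l l + 1 := h2 ▸ hx
  -- From `t ^ 2 < a + 1` with `a ≥ 0` follows `t ≤ a + 2`. Summing these bounds over `l` gives one
  -- constant for the whole frame.
  refine le_trans (b := gram (I := 𝓡 n) c x₁ l l + 2) (by nlinarith [norm_nonneg (tframe (𝓡 n) c l x)])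
    (Finset.single_le_sum (f := fun l => gram (I := 𝓡 n) c x₁ l l + 2)
      (fun l _ => by linarith [hg l]) (Finset.mem_univ l))

variable (n F V) in
lemma exists_isControlled (x₁ : M) :
    ∃ c W δ C, IsControlled n F V c x₁ W δ C := by
  -- The chart is chosen so that its member of the partition of unity is positive at `x₁`; the
  -- preferred chart at `x₁` itself might carry no volume there. Then `w`, density times partition
  -- function, is positive at `x₁` and stays above half its value nearby.
  obtain ⟨c, hc⟩ := (chartPartition n M).exists_pos_of_mem (Set.mem_univ x₁)
  have hsrc : x₁ ∈ (chartAt (EuclideanSpace ℝ (Fin n)) c).source :=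
    chartPartition_isSubordinate c (subset_tsupport _ hc.ne')
  have hsrc' : x₁ ∈ (extChartAt (𝓡 n) c).source := by rwa [extChartAt_source]
  have hev := (chartAt (EuclideanSpace ℝ (Fin n)) c).open_source.mem_nhds hsrc
  obtain ⟨C₁, hC₁, h₁⟩ := eventually_abs_vcoeff_le (n := n) (F := F) (V := V) x₁
  obtain ⟨C₂, hC₂, h₂⟩ := eventually_norm_tframe_le (n := n) (c := c) (x₁ := x₁)
    (by rwa [tbase_eq_source])
  set w : M → ℝ := fun x => volDensity c (extChartAt (𝓡 n) c x) * chartPartition n M c x with hw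
  have hwc : ContinuousAt w x₁ := by
    refine ContinuousAt.mul ?_ (chartPartition n M c).contMDiff.continuous.continuousAt
    refine ContinuousAt.comp (g := volDensity c) ?_ (continuousAt_extChartAt' hsrc')
    exact (contDiffOn_volDensity c).continuousOn.continuousAt
      ((isOpen_extChartAt_target c).mem_nhds ((extChartAt (𝓡 n) c).map_source hsrc'))
  have hwp : 0 < w x₁ := mul_pos (volDensity_pos ((extChartAt (𝓡 n) c).map_source hsrc')) hc
  have h₃ := hwc.eventually (Ioi_mem_nhds (half_lt_self hwp))
  have h₄ : ∀ᶠ x in 𝓝 x₁, x ∈ vbase F V x₁ := (isOpen_vbase x₁).mem_nhds (mem_vbase x₁)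
  have h₅ : ∀ᶠ x in 𝓝 x₁, x ∈ (chartAt (EuclideanSpace ℝ (Fin n)) c).source := hev
  obtain ⟨W, hW, hWo, hxW⟩ := eventually_nhds_iff.1 (h₁.and (h₂.and (h₃.and (h₄.and h₅))))
  refine ⟨c, W, w x₁ / 2, max C₁ C₂, hWo, hxW, fun x hx => (hW x hx).2.2.2.2,
    fun x hx => (hW x hx).2.2.2.1, half_pos hwp, hC₁.trans (le_max_left _ _),
    fun x hx => (hW x hx).2.2.1.le, fun x hx r v => ?_, fun x hx l => ?_⟩
  · exact ((hW x hx).1 r v).trans (mul_le_mul_of_nonneg_right (le_max_left _ _) (norm_nonneg _))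
  · exact ((hW x hx).2.1 l).trans (le_max_right _ _)

variable (covT : CovariantDerivative (𝓡 n) (EuclideanSpace ℝ (Fin n))
    (fun x : M => TangentSpace (𝓡 n) x))
  [CovariantDerivative.ContMDiffCovariantDerivative covT ∞]
  (covV : CovariantDerivative (𝓡 n) F V)
  [CovariantDerivative.ContMDiffCovariantDerivative covV ∞]
  {c x₁ : M} {W : Set M} {δ C : ℝ}

lemma IsControlled.abs_jetComp_le (h : IsControlled n F V c x₁ W δ C)
    (a : JetIndex (EuclideanSpace ℝ (Fin n)) F) (ξ : Cₛ^∞⟮𝓡 n; F, V⟯) {x : M} (hx : x ∈ W) :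
    |jetComp covT covV c x₁ a ξ x| ≤
      C * ((Module.finrank ℝ (EuclideanSpace ℝ (Fin n)) : ℝ) ^ a.1 * C ^ a.1) *
        tensorNorm (iterCovDeriv covT covV ξ a.1) x := by
  refine (h.vcoeff_le x hx _ _).trans ?_
  rw [mul_assoc]
  refine mul_le_mul_of_nonneg_left ?_ h.nonneg
  refine (norm_le_tensorNorm (isSmoothTensor_iterCovDeriv covT covV ξ.contMDiff a.1) _).trans ?_
  refine mul_le_mul_of_nonneg_right (mul_le_mul_of_nonneg_left ?_ (by positivity))
    (tensorNorm_nonneg _ _)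
  refine (Finset.prod_le_prod (fun _ _ => norm_nonneg _) fun j _ =>
    h.tframe_le x hx (a.2.1 j)).trans (le_of_eq ?_)
  simp

lemma norm_smoothSections_pow {k p : ℕ} [hp : Fact (1 ≤ p)] (ξ : SmoothSections covT covV k p) :
    ‖ξ‖ ^ p = ∑ i ∈ Finset.range (k + 1),
      ∫ x, tensorNorm (iterCovDeriv covT covV (show Cₛ^∞⟮𝓡 n; F, V⟯ from ξ) i) x ^ p
        ∂(riemannianVolume n M) := by
  have hp0 : p ≠ 0 := by have := hp.out; omega
  rw [norm_smoothSections, sobolevNorm, one_div, Real.rpow_inv_natCast_pow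
    (Finset.sum_nonneg fun i _ => integral_nonneg fun x => pow_nonneg (tensorNorm_nonneg _ _) _) hp0]

lemma integral_tensorNorm_pow_le_norm_pow {k p i : ℕ} (hik : i ≤ k) [Fact (1 ≤ p)]
    (ξ : SmoothSections covT covV k p) :
    ∫ x, tensorNorm (iterCovDeriv covT covV (show Cₛ^∞⟮𝓡 n; F, V⟯ from ξ) i) x ^ p
      ∂(riemannianVolume n M) ≤ ‖ξ‖ ^ p := by
  rw [norm_smoothSections_pow]
  exact Finset.single_le_sum (f := fun i => ∫ x, tensorNorm (iterCovDeriv covT covV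
      (show Cₛ^∞⟮𝓡 n; F, V⟯ from ξ) i) x ^ p ∂(riemannianVolume n M))
    (fun i _ => integral_nonneg fun x => pow_nonneg (tensorNorm_nonneg _ _) _)
    (Finset.mem_range.2 (by omega))

/-- Pointwise, the component is at most `D` times the Hilbert–Schmidt norm of the covariant
derivative of the same order. Integrating over `K` against Lebesgue measure instead of the volume
costs a factor `δ⁻¹`, that is `δ^(-1/p)` in the norm. The resulting bounded operator on smooth
sections extends to the completion. -/
lemma IsControlled.exists_clm_jetCoord (h : IsControlled n F V c x₁ W δ C)
    {K : Set (EuclideanSpace ℝ (Fin n))} (hK : IsCompact K) (hKt : K ⊆ (extChartAt (𝓡 n) c).target)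
    (hKW : ∀ y ∈ K, (extChartAt (𝓡 n) c).symm y ∈ W) (k p : ℕ) [hp : Fact (1 ≤ p)]
    (a : JetIndex (EuclideanSpace ℝ (Fin n)) F) :
    ∃ u : SobolevSpace covT covV k p →L[ℝ] Lp ℝ p
        (volume.comap ((↑) : K → EuclideanSpace ℝ (Fin n))),
      ∀ ξ : Cₛ^∞⟮𝓡 n; F, V⟯, jetOrder a ≤ k →
        u (show SmoothSections covT covV k p from ξ)
          =ᵐ[volume.comap ((↑) : K → EuclideanSpace ℝ (Fin n))]
            fun z => jetCoord covT covV c x₁ a ξ z := by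
  -- For orders above `k` nothing is claimed, and zero serves; this way `u` is defined for every
  -- index.
  by_cases hak : jetOrder a ≤ k
  swap
  · exact ⟨0, fun _ h => (hak h).elim⟩
  set D := C * ((Module.finrank ℝ (EuclideanSpace ℝ (Fin n)) : ℝ) ^ a.1 * C ^ a.1) with hD
  have hC := h.nonneg
  have hδ := h.pos
  have hD0 : 0 ≤ D := by positivity
  have hp0 : p ≠ 0 := by have := hp.out; omega
  have hcont : ∀ ξ : Cₛ^∞⟮𝓡 n; F, V⟯, ContinuousOn (jetCoord covT covV c x₁ a ξ) K :=
    fun ξ z hz => (differentiableAt_jetCoord covT covV (hKt hz) (h.subset_vbase (hKW z hz)) a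
      ξ).continuousAt.continuousWithinAt
  have hb : ∀ ξ : SmoothSections covT covV k p,
      ∫ z in K, |jetCoord covT covV c x₁ a ξ z| ^ p ≤ (D * (δ⁻¹) ^ ((p : ℝ)⁻¹) * ‖ξ‖) ^ p := by
    intro ξ
    set f : M → ℝ := fun x => tensorNorm (iterCovDeriv covT covV
      (show Cₛ^∞⟮𝓡 n; F, V⟯ from ξ) a.1) x ^ p with hf
    have hfc : Continuous f :=
      (continuous_tensorNorm_iterCovDeriv covT covV (ContMDiffSection.contMDiff ξ) a.1).pow p
    have h1 := setIntegral_le_integral_riemannianVolume hfc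
      (fun x => pow_nonneg (tensorNorm_nonneg _ _) _) hK hKt (δ := δ) fun y hy => by
        have := h.le_density _ (hKW y hy)
        rwa [(extChartAt (𝓡 n) c).right_inv (hKt hy)] at this
    have h2 := h1.trans (integral_tensorNorm_pow_le_norm_pow covT covV hak ξ)
    have h3 : ∫ z in K, |jetCoord covT covV c x₁ a ξ z| ^ p ≤
        ∫ z in K, D ^ p * f ((extChartAt (𝓡 n) c).symm z) := by
      refine setIntegral_mono_on (((hcont ξ).abs.pow p).integrableOn_compact hK)
        (((hfc.comp_continuousOn ((continuousOn_extChartAt_symm c).mono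
          hKt)).integrableOn_compact hK).const_mul _) hK.measurableSet fun z hz => ?_
      rw [hf, ← mul_pow]
      exact pow_le_pow_left₀ (abs_nonneg _) (h.abs_jetComp_le covT covV a ξ (hKW z hz)) p
    rw [integral_const_mul] at h3
    refine h3.trans ?_
    rw [mul_pow (D * _), mul_pow D, Real.rpow_inv_natCast_pow (by positivity) hp0, mul_assoc]
    refine mul_le_mul_of_nonneg_left ?_ (by positivity)
    rw [le_inv_mul_iff₀ hδ]
    exact h2
  obtain ⟨u, hu⟩ := exists_completion_clm_Lp (S := SmoothSections covT covV k p) hK volume (p := p)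
    (fun ξ => jetCoord covT covV c x₁ a ξ) hcont
    (fun ξ η z hz => by
      have := congrFun (congrFun (iterCovDeriv_add covT covV
        (ContMDiffSection.contMDiff ξ) (ContMDiffSection.contMDiff η) a.1)
          ((extChartAt (𝓡 n) c).symm z))
        fun j => tframe (𝓡 n) c (a.2.1 j) ((extChartAt (𝓡 n) c).symm z)
      exact (congrArg (vcoeff (𝓡 n) F V x₁ a.2.2 _) this).trans (map_add _ _ _))
    (fun r ξ z hz => by
      have := congrFun (congrFun (iterCovDeriv_smul covT covV
        (ContMDiffSection.contMDiff ξ) r a.1)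
          ((extChartAt (𝓡 n) c).symm z))
        fun j => tframe (𝓡 n) c (a.2.1 j) ((extChartAt (𝓡 n) c).symm z)
      exact (congrArg (vcoeff (𝓡 n) F V x₁ a.2.2 _) this).trans (map_smul _ _ _))
    (C := D * (δ⁻¹) ^ ((p : ℝ)⁻¹)) (by positivity) hb
  exact ⟨u, fun ξ _ => hu ξ⟩

end GoodNeighborhoods

/-! ### Smoothness of the determinant of an endomorphism, and a tube lemma for group actions -/

lemma contDiff_clm_det {E : Type*} [NormedAddCommGroup E] [NormedSpace ℝ E]
    [FiniteDimensional ℝ E] : ContDiff ℝ ∞ fun L : E →L[ℝ] E => L.det := by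
  set B := Module.finBasis ℝ E with hB
  have h : ∀ L : E →L[ℝ] E, L.det =
      (Matrix.of fun i j => LinearMap.toContinuousLinearMap (B.coord i) (L (B j))).det := by
    intro L
    rw [ContinuousLinearMap.det, ← LinearMap.det_toMatrix B]
    congr 1
    ext i j
    rw [LinearMap.toMatrix_apply]
    rfl
  simp only [h]
  refine contDiff_det.comp (contDiff_pi.2 fun i => contDiff_pi.2 fun j => ?_)
  exact (ContinuousLinearMap.contDiff _).comp (contDiff_id.clm_apply contDiff_const)

/-- If `a₀` moves the compact set `K` into `W`, then there is a compact subset of `W` into which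
all `a` near `a₀` move `K`, and their inverses move a neighborhood of it into a given
neighborhood of `K`. -/
lemma exists_compact_smul_tube {G M : Type*} [Group G] [TopologicalSpace G] [ContinuousInv G]
    [TopologicalSpace M] [LocallyCompactSpace M] [MulAction G M] [ContinuousSMul G M] {a₀ : G}
    {K S W : Set M} (hK : IsCompact K) (hS : IsOpen S) (hW : IsOpen W) (hKS : K ⊆ S)
    (hKW : ∀ x ∈ K, a₀ • x ∈ W) :
    ∃ (N : Set G) (L O : Set M), IsOpen N ∧ a₀ ∈ N ∧ IsCompact L ∧ IsOpen O ∧ L ⊆ O ∧ O ⊆ W ∧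
      (∀ a ∈ N, ∀ x ∈ O, a⁻¹ • x ∈ S) ∧ ∀ a ∈ N, ∀ x ∈ K, a • x ∈ L := by
  have hinv : Continuous fun q : G × M => q.1⁻¹ • q.2 := continuous_fst.inv.smul continuous_snd
  have hsm : Continuous fun q : G × M => q.1 • q.2 := continuous_smul
  have hΩ : IsOpen {x | x ∈ W ∧ a₀⁻¹ • x ∈ S} :=
    hW.inter (hS.preimage (continuous_const.smul continuous_id : Continuous fun x : M => a₀⁻¹ • x))
  -- `L` is squeezed between `a₀ • K` and the open set of points of `W` that `a₀⁻¹` sends into `S`.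
  -- The tube lemma then spreads both inclusions to all `a` near `a₀`.
  obtain ⟨L, hL, hKL, hLΩ⟩ := exists_compact_between
    (hK.image (continuous_const.smul continuous_id : Continuous fun x : M => a₀ • x)) hΩ (by
      rintro _ ⟨x, hx, rfl⟩
      exact ⟨hKW x hx, by simpa using hKS hx⟩)
  obtain ⟨N₁, O, hN₁, hO, haN₁, hLO, h₁⟩ := generalized_tube_lemma (isCompact_singleton (x := a₀)) hL
    ((hW.preimage continuous_snd).inter (hS.preimage hinv)) (by
      rintro ⟨a, x⟩ ⟨rfl, hx⟩
      exact hLΩ hx)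
  obtain ⟨N₂, O', hN₂, -, haN₂, hKO', h₂⟩ := generalized_tube_lemma
    (isCompact_singleton (x := a₀)) hK (isOpen_interior.preimage hsm) (n := _ ⁻¹' interior L) (by
      rintro ⟨a, x⟩ ⟨rfl, hx⟩
      exact hKL ⟨x, hx, rfl⟩)
  have ha₁ : a₀ ∈ N₁ := haN₁ rfl
  exact ⟨N₁ ∩ N₂, L, O, hN₁.inter hN₂, ⟨ha₁, haN₂ rfl⟩, hL, hO, hLO,
    fun x hx => (h₁ ⟨ha₁, hx⟩ : (a₀, x) ∈ _).1,
    fun a ha x hx => (h₁ ⟨ha.1, hx⟩ : (a, x) ∈ _).2,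
    fun a ha x hx => interior_subset (h₂ ⟨ha.2, hKO' hx⟩ : (a, x) ∈ _)⟩

/-! ### Change of variables in one localized piece of the norm -/

section Piece

variable {n : ℕ} {EG : Type*} [NormedAddCommGroup EG] [NormedSpace ℝ EG]
  {G : Type*} [TopologicalSpace G] [ChartedSpace EG G] [Group G] [LieGroup 𝓘(ℝ, EG) ∞ G]
  {M : Type*} [TopologicalSpace M] [ChartedSpace (EuclideanSpace ℝ (Fin n)) M]
  [IsManifold (𝓡 n) ∞ M]
  [MulAction G M] [ContMDiffSMul 𝓘(ℝ, EG) (𝓡 n) ∞ G M]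
  {g : EG → G} {N : Set EG} {U : Set (EuclideanSpace ℝ (Fin n))} {c c' : M}

/-- The derivative in the second variable of the coordinates of `g(γ)⁻¹ • x`. -/
def moveDeriv (g : EG → G) (c c' : M) (q : EG × EuclideanSpace ℝ (Fin n)) :
    EuclideanSpace ℝ (Fin n) →L[ℝ] EuclideanSpace ℝ (Fin n) :=
  (fderiv ℝ (fun q => extChartAt (𝓡 n) c' (movePt g c q)) q).comp
    (ContinuousLinearMap.inr ℝ EG (EuclideanSpace ℝ (Fin n)))

lemma contDiffOn_extChartAt_movePt (hg : ContMDiffOn 𝓘(ℝ, EG) 𝓘(ℝ, EG) ∞ g N)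
    (hU : U ⊆ (extChartAt (𝓡 n) c).target)
    (hs' : ∀ q ∈ N ×ˢ U, movePt g c q ∈ (chartAt (EuclideanSpace ℝ (Fin n)) c').source) :
    ContDiffOn ℝ ∞ (fun q => extChartAt (𝓡 n) c' (movePt g c q)) (N ×ˢ U) :=
  contDiffOn_comp_movePt hg hU hs' contMDiffOn_extChartAt

section

variable (hN : IsOpen N) (hg : ContMDiffOn 𝓘(ℝ, EG) 𝓘(ℝ, EG) ∞ g N)
  (hUo : IsOpen U) (hU : U ⊆ (extChartAt (𝓡 n) c).target)
  (hs' : ∀ q ∈ N ×ˢ U, movePt g c q ∈ (chartAt (EuclideanSpace ℝ (Fin n)) c').source)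

include hN hg hUo hU hs'

lemma contDiffOn_moveDeriv : ContDiffOn ℝ ∞ (moveDeriv g c c') (N ×ˢ U) :=
  ((contDiffOn_extChartAt_movePt hg hU hs').fderiv_of_isOpen (hN.prod hUo)
    (by simp)).clm_comp contDiffOn_const

lemma hasFDerivAt_moveDeriv {γ : EG} {z : EuclideanSpace ℝ (Fin n)} (hγ : γ ∈ N) (hz : z ∈ U) :
    HasFDerivAt (fun z => extChartAt (𝓡 n) c' (movePt g c (γ, z))) (moveDeriv g c c' (γ, z)) z := by
  have h1 : HasFDerivAt (fun q => extChartAt (𝓡 n) c' (movePt g c q)) _ (γ, z) :=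
    (((contDiffOn_extChartAt_movePt hg hU hs').contDiffAt
      ((hN.prod hUo).mem_nhds ⟨hγ, hz⟩)).differentiableAt (by simp)).hasFDerivAt
  exact HasFDerivAt.comp z h1 (hasFDerivAt_prodMk_right γ z)

/-- For fixed `γ` the coordinate change has `moveCoord` as a left inverse near `z`, so by the chain
rule its derivative has a left inverse. -/
lemma det_moveDeriv_ne_zero {q : EG × EuclideanSpace ℝ (Fin n)} (hq : q ∈ N ×ˢ U) :
    (moveDeriv g c c' q).det ≠ 0 := by
  obtain ⟨γ, z⟩ := q
  have h1 := hasFDerivAt_moveDeriv hN hg hUo hU hs' hq.1 hq.2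
  set y := extChartAt (𝓡 n) c' (movePt g c (γ, z)) with hy
  have h2 : HasFDerivAt (moveCoord (n := n) g c c') _ (γ, y) :=
    (((contDiffOn_moveCoord (n := n) hg).contDiffAt ((isOpen_moveDomain (n := n) hN hg).mem_nhds
      (moveDomain_coord hU hq (hs' _ hq)))).differentiableAt (by simp)).hasFDerivAt
  have h3 := HasFDerivAt.comp z (HasFDerivAt.comp y h2 (hasFDerivAt_prodMk_right γ y)) h1
  have h4 := h3.congr_of_eventuallyEq (f₁ := id) (by
    filter_upwards [hUo.mem_nhds hq.2] with w hw
    exact (moveCoord_coord hU (q := (γ, w)) ⟨hq.1, hw⟩ (hs' _ ⟨hq.1, hw⟩)).symm)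
  have h5 := congrArg ContinuousLinearMap.det (h4.unique (hasFDerivAt_id z))
  intro h0
  rw [ContinuousLinearMap.det, ContinuousLinearMap.toLinearMap_comp, LinearMap.det_comp] at h5
  rw [ContinuousLinearMap.det] at h0
  rw [h0, mul_zero] at h5
  simp [ContinuousLinearMap.det] at h5

lemma contDiffOn_abs_det_moveDeriv :
    ContDiffOn ℝ ∞ (fun q => |(moveDeriv g c c' q).det|) (N ×ˢ U) :=
  (contDiff_clm_det.comp_contDiffOn (contDiffOn_moveDeriv hN hg hUo hU hs')).abs
    fun _ hq => det_moveDeriv_ne_zero hN hg hUo hU hs' hq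

/-- The substitution `y = ` coordinates of `g(γ)⁻¹ • x`, with `x` running over the points with
coordinates in `K`. Since `f` vanishes unless `g(γ)` moves the point into that set, the integral
over the image of `K` is the integral over the whole chart. The domain `K` on the right no longer
depends on `γ`. -/
lemma setIntegral_target_eq {f : EuclideanSpace ℝ (Fin n) → ℝ}
    {K : Set (EuclideanSpace ℝ (Fin n))} (hK : IsCompact K) (hKU : K ⊆ U) {γ : EG} (hγ : γ ∈ N)
    (hf : ∀ y ∈ (extChartAt (𝓡 n) c').target,
      extChartAt (𝓡 n) c (g γ • (extChartAt (𝓡 n) c').symm y) ∉ K ∨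
        g γ • (extChartAt (𝓡 n) c').symm y ∉ (chartAt (EuclideanSpace ℝ (Fin n)) c).source →
      f y = 0) :
    ∫ y in (extChartAt (𝓡 n) c').target, f y =
      ∫ z in K, |(moveDeriv g c c' (γ, z)).det| *
        f (extChartAt (𝓡 n) c' (movePt g c (γ, z))) := by
  have hinj : Set.InjOn (fun z => extChartAt (𝓡 n) c' (movePt g c (γ, z))) K := by
    intro z hz w hw h
    have h1 := moveCoord_coord hU (q := (γ, z)) ⟨hγ, hKU hz⟩ (hs' _ ⟨hγ, hKU hz⟩)
    have h2 := moveCoord_coord hU (q := (γ, w)) ⟨hγ, hKU hw⟩ (hs' _ ⟨hγ, hKU hw⟩)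
    have h' : extChartAt (𝓡 n) c' (movePt g c (γ, z)) = extChartAt (𝓡 n) c' (movePt g c (γ, w)) := h
    simp only [h'] at h1
    exact h1.symm.trans h2
  have h1 := integral_image_eq_integral_abs_det_fderiv_smul volume hK.measurableSet
    (fun z hz => (hasFDerivAt_moveDeriv hN hg hUo hU hs' hγ (hKU hz)).hasFDerivWithinAt) hinj f
  refine (setIntegral_eq_of_subset_of_forall_sdiff_eq_zero
    (isOpen_extChartAt_target c').measurableSet ?_ fun y hy => hf y hy.1 ?_).trans h1
  · rintro _ ⟨z, hz, rfl⟩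
    refine (extChartAt (𝓡 n) c').map_source ?_
    rw [extChartAt_source]
    exact hs' _ ⟨hγ, hKU hz⟩
  · by_contra! hcon
    refine hy.2 ⟨_, hcon.1, ?_⟩
    have h2 : g γ • (extChartAt (𝓡 n) c').symm y ∈ (extChartAt (𝓡 n) c).source := by
      rw [extChartAt_source]; exact hcon.2
    simp only [movePt, (extChartAt (𝓡 n) c).left_inv h2, inv_smul_smul]
    exact (extChartAt (𝓡 n) c').right_inv hy.1

end

variable [FiniteDimensional ℝ EG] [T2Space M] [CompactSpace M] [MeasurableSpace M] [BorelSpace M]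
  [RiemannianBundle (fun x : M => TangentSpace (𝓡 n) x)]
  [IsContMDiffRiemannianBundle (𝓡 n) ∞ (EuclideanSpace ℝ (Fin n))
    (fun x : M => TangentSpace (𝓡 n) x)]
  {F : Type*} [NormedAddCommGroup F] [NormedSpace ℝ F] [FiniteDimensional ℝ F]
  {V : M → Type*} [TopologicalSpace (TotalSpace F V)]
  [∀ x, NormedAddCommGroup (V x)] [∀ x, InnerProductSpace ℝ (V x)]
  [FiberBundle F V] [VectorBundle ℝ F V] [ContMDiffVectorBundle ∞ F V (𝓡 n)]
  [IsContMDiffRiemannianBundle (𝓡 n) ∞ F V]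
  (covT : CovariantDerivative (𝓡 n) (EuclideanSpace ℝ (Fin n))
    (fun x : M => TangentSpace (𝓡 n) x))
  [CovariantDerivative.ContMDiffCovariantDerivative covT ∞]
  (covV : CovariantDerivative (𝓡 n) F V)
  [CovariantDerivative.ContMDiffCovariantDerivative covV ∞]
  (A : BundleAction n EG G F V)

/-- The contributions to the Sobolev norm that are localized near a point depend smoothly on the
group element. -/
lemma exists_chartIntegral_eq {x₀ x₁ : M} {W : Set M} {δ C : ℝ}
    (hW : IsControlled n F V c x₁ W δ C) {N : Set EG} (hN : IsOpen N)
    (hg : ContMDiffOn 𝓘(ℝ, EG) 𝓘(ℝ, EG) ∞ g N) {γ₀ : EG} (hγ₀ : γ₀ ∈ N) {ρ : M → ℝ}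
    (hρ : ContMDiff (𝓡 n) 𝓘(ℝ) ∞ ρ)
    (hρs : tsupport ρ ⊆ vbase F V x₀ ∩ {x | g γ₀ • x ∈ W}) {i k p : ℕ} (hik : i ≤ k)
    [Fact (1 ≤ p)] (hp : Even p) (c' : M) :
    ∃ (N' : Set EG) (Λ : EG → ContinuousMultilinearMap ℝ
        (fun _ : Fin p => SobolevSpace covT covV k p) ℝ),
      IsOpen N' ∧ γ₀ ∈ N' ∧ ContDiffOn ℝ ∞ Λ N' ∧ ∀ γ ∈ N', ∀ ξ : Cₛ^∞⟮𝓡 n; F, V⟯,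
        chartIntegral n c' (fun x => ρ x *
          tensorNorm (iterCovDeriv covT covV (A.pullback (g γ) ξ) i) x ^ p) =
        Λ γ fun _ => ((show SmoothSections covT covV k p from ξ : SmoothSections covT covV k p) :
          SobolevSpace covT covV k p) := by
  have : IsTopologicalGroup G := topologicalGroup_of_lieGroup 𝓘(ℝ, EG) ∞
  have : ContinuousSMul G M :=
    ⟨(ContMDiffSMul.contMDiff_smul (I := 𝓘(ℝ, EG)) (I' := 𝓡 n) (n := ∞) (G := G)
      (M := M)).continuous⟩
  set χ := chartPartition n M c' with hχ
  have hχs : tsupport χ ⊆ (chartAt (EuclideanSpace ℝ (Fin n)) c').source :=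
    chartPartition_isSubordinate c'
  -- The integrand is supported in `tsupport ρ ∩ tsupport χ`. For all group elements near `g γ₀`,
  -- this set is moved into the fixed compact set `L`, while points of the open set `O` are moved
  -- back to where the frame of `V` around `x₀` and the chart at `c'` are defined.
  obtain ⟨NG, L, O, hNG, haN, hL, hO, hLO, hOW, hinv, hmove⟩ :=
    exists_compact_smul_tube (a₀ := g γ₀) (K := tsupport ρ ∩ tsupport χ)
      (S := vbase F V x₀ ∩ (chartAt (EuclideanSpace ℝ (Fin n)) c').source)
      ((isClosed_tsupport ρ).inter (isClosed_tsupport χ)).isCompact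
      ((isOpen_vbase x₀).inter (chartAt (EuclideanSpace ℝ (Fin n)) c').open_source) hW.isOpen
      (fun x hx => ⟨(hρs hx.1).1, hχs hx.2⟩) fun x hx => (hρs hx.1).2
  set N' := N ∩ g ⁻¹' NG with hN'
  have hN'o : IsOpen N' := hg.continuousOn.isOpen_inter_preimage hN hNG
  have hg' := hg.mono (Set.inter_subset_left : N' ⊆ N)
  set τ := (extChartAt (𝓡 n) c).symm with hτ
  set U := (extChartAt (𝓡 n) c).target ∩ τ ⁻¹' O with hUdef
  have hUo : IsOpen U :=
    (continuousOn_extChartAt_symm c).isOpen_inter_preimage (isOpen_extChartAt_target c) hO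
  have hU : U ⊆ (extChartAt (𝓡 n) c).target := Set.inter_subset_left
  have hUW : ∀ z ∈ U, τ z ∈ W := fun z hz => hOW hz.2
  have hs' : ∀ q ∈ N' ×ˢ U, movePt g c q ∈ (chartAt (EuclideanSpace ℝ (Fin n)) c').source :=
    fun q hq => (hinv _ hq.1.2 _ hq.2.2).2
  have hV' : ∀ q ∈ N' ×ˢ U, movePt g c q ∈ vbase F V x₀ := fun q hq => (hinv _ hq.1.2 _ hq.2.2).1
  have hLs : L ⊆ (extChartAt (𝓡 n) c).source := by
    rw [extChartAt_source]; exact (hLO.trans hOW).trans hW.subset_source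
  set K := extChartAt (𝓡 n) c '' L with hKdef
  have hK : IsCompact K := hL.image_of_continuousOn ((continuousOn_extChartAt c).mono hLs)
  have hKU : K ⊆ U := by
    rintro _ ⟨x, hx, rfl⟩
    refine ⟨(extChartAt (𝓡 n) c).map_source (hLs hx), ?_⟩
    rw [Set.mem_preimage, hτ, (extChartAt (𝓡 n) c).left_inv (hLs hx)]
    exact hLO hx
  choose u hu using fun a => hW.exists_clm_jetCoord covT covV hK (hKU.trans hU)
    (fun z hz => hUW z (hKU hz)) k p a
  -- All factors that do not involve `ξ`: Jacobian, volume density, member of the volume partition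
  -- and cut-off.
  have hκ : ContDiffOn ℝ ∞ (fun q => |(moveDeriv g c c' q).det| *
      (volDensity c' (extChartAt (𝓡 n) c' (movePt g c q)) *
        (χ (movePt g c q) * ρ (movePt g c q)))) (N' ×ˢ U) := by
    refine (contDiffOn_abs_det_moveDeriv hN'o hg' hUo hU hs').mul (ContDiffOn.mul ?_
      (ContDiffOn.mul ?_ ?_))
    · refine (contDiffOn_volDensity c').comp (contDiffOn_extChartAt_movePt hg' hU hs')
        fun q hq => (extChartAt (𝓡 n) c').map_source ?_
      rw [extChartAt_source]
      exact hs' q hq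
    · exact contDiffOn_comp_movePt hg' hU hs' χ.contMDiff.contMDiffOn
    · exact contDiffOn_comp_movePt hg' hU hs' hρ.contMDiffOn
  have hΦ := (polyOp_tensorNorm_pow covT covV A hN'o hg' hUo hU
    (fun z hz => hW.subset_vbase (hUW z hz)) hs' hV' hik hp).smul hκ
  obtain ⟨Λ, hΛ, hΛe⟩ := PolyOp.exists_integral_eq hN'o hUo hK hKU (ν := volume)
    (fun ξ : Cₛ^∞⟮𝓡 n; F, V⟯ => ((show SmoothSections covT covV k p from ξ :
      SmoothSections covT covV k p) : SobolevSpace covT covV k p)) u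
    (fun a ξ ha => hu a ξ ha) hΦ
  refine ⟨N', Λ, hN'o, ⟨hγ₀, haN⟩, hΛ, fun γ hγ ξ => ?_⟩
  rw [← hΛe γ hγ ξ, chartIntegral,
    setIntegral_target_eq hN'o hg' hUo hU hs' hK hKU hγ fun y hy hcon => ?_]
  · refine setIntegral_congr_fun hK.measurableSet fun z hz => ?_
    have h1 : movePt g c (γ, z) ∈ (extChartAt (𝓡 n) c').source := by
      rw [extChartAt_source]; exact hs' _ ⟨hγ, hKU hz⟩
    simp only [(extChartAt (𝓡 n) c').left_inv h1]
    ring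
  · have h1 : (extChartAt (𝓡 n) c').symm y ∉ tsupport ρ ∩ tsupport χ := by
      intro hx
      have h2 := hmove _ hγ.2 _ hx
      rcases hcon with h | h
      · exact h ⟨_, h2, rfl⟩
      · rw [← extChartAt_source (𝓡 n)] at h
        exact h (hLs h2)
    by_cases h3 : (extChartAt (𝓡 n) c').symm y ∈ tsupport ρ
    · have h4 : χ ((extChartAt (𝓡 n) c').symm y) = 0 :=
        image_eq_zero_of_notMem_tsupport fun h => h1 ⟨h3, h⟩
      rw [h4, zero_mul, mul_zero]
    · rw [image_eq_zero_of_notMem_tsupport h3, zero_mul, mul_zero, mul_zero]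

end Piece

/-- Exchanging arguments makes `f` a continuous multilinear map of the `B`-variables with values in
the linear forms on `Y`. Such a map is smooth, also after restriction to the diagonal, and
evaluation of a linear form is smooth. -/
lemma contDiff_multilinear_apply_diag {Y B : Type*} [NormedAddCommGroup Y] [NormedSpace ℝ Y]
    [NormedAddCommGroup B] [NormedSpace ℝ B] {p : ℕ}
    (f : Y →L[ℝ] ContinuousMultilinearMap ℝ (fun _ : Fin p => B) ℝ) :
    ContDiff ℝ ∞ fun q : Y × B => f q.1 fun _ => q.2 := by
  have h1 : ContDiff ℝ ∞ fun q : Y × B => fun _ : Fin p => q.2 :=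
    contDiff_pi.2 fun _ => contDiff_snd
  exact (f.flipMultilinear.contDiff.comp h1).clm_apply contDiff_fst

/-! ### Summing the pieces and passing to the completion -/

section Assembly

variable {n : ℕ} {EG : Type*} [NormedAddCommGroup EG] [NormedSpace ℝ EG] [FiniteDimensional ℝ EG]
  {G : Type*} [TopologicalSpace G] [ChartedSpace EG G] [Group G] [LieGroup 𝓘(ℝ, EG) ∞ G]
  {M : Type*} [TopologicalSpace M] [ChartedSpace (EuclideanSpace ℝ (Fin n)) M]
  [IsManifold (𝓡 n) ∞ M] [T2Space M] [CompactSpace M] [MeasurableSpace M] [BorelSpace M]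
  [RiemannianBundle (fun x : M => TangentSpace (𝓡 n) x)]
  [IsContMDiffRiemannianBundle (𝓡 n) ∞ (EuclideanSpace ℝ (Fin n))
    (fun x : M => TangentSpace (𝓡 n) x)]
  [MulAction G M] [ContMDiffSMul 𝓘(ℝ, EG) (𝓡 n) ∞ G M]

lemma chartIntegral_sum_mul (c : M) {ι : Type*} (s : Finset ι) {ρ : ι → M → ℝ}
    (hρ : ∀ j, Continuous (ρ j)) (hsum : ∀ x, ∑ j ∈ s, ρ j x = 1) {f : M → ℝ} (hf : Continuous f) :
    chartIntegral n c f = ∑ j ∈ s, chartIntegral n c fun x => ρ j x * f x := by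
  simp only [chartIntegral]
  rw [← integral_finsetSum s fun j _ =>
    integrableOn_chartIntegrand c (f := fun x => ρ j x * f x) ((hρ j).mul hf)]
  refine integral_congr_ae (Filter.Eventually.of_forall fun y => ?_)
  simp only [← Finset.mul_sum, ← Finset.sum_mul, hsum, one_mul]

variable {F : Type*} [NormedAddCommGroup F] [NormedSpace ℝ F] [FiniteDimensional ℝ F]
  {V : M → Type*} [TopologicalSpace (TotalSpace F V)]
  [∀ x, NormedAddCommGroup (V x)] [∀ x, InnerProductSpace ℝ (V x)]
  [FiberBundle F V] [VectorBundle ℝ F V] [ContMDiffVectorBundle ∞ F V (𝓡 n)]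
  [IsContMDiffRiemannianBundle (𝓡 n) ∞ F V]
  (covT : CovariantDerivative (𝓡 n) (EuclideanSpace ℝ (Fin n))
    (fun x : M => TangentSpace (𝓡 n) x))
  [CovariantDerivative.ContMDiffCovariantDerivative covT ∞]
  (covV : CovariantDerivative (𝓡 n) F V)
  [CovariantDerivative.ContMDiffCovariantDerivative covV ∞]
  (A : BundleAction n EG G F V)

/-- On smooth sections, the `p`-th power of the Sobolev norm of `g(γ) · ξ` is the value on the
diagonal of a continuous multilinear map on the Sobolev space that depends smoothly on `γ`. -/
lemma exists_norm_smoothAction_pow_eq (k : ℕ) {p : ℕ} [Fact (1 ≤ p)] (hp : Even p) {g : EG → G}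
    {N : Set EG} (hN : IsOpen N) (hg : ContMDiffOn 𝓘(ℝ, EG) 𝓘(ℝ, EG) ∞ g N) {γ₀ : EG}
    (hγ₀ : γ₀ ∈ N) :
    ∃ (N' : Set EG) (Λ : EG → ContinuousMultilinearMap ℝ
        (fun _ : Fin p => SobolevSpace covT covV k p) ℝ),
      IsOpen N' ∧ γ₀ ∈ N' ∧ ContDiffOn ℝ ∞ Λ N' ∧
        ∀ γ ∈ N', ∀ ξ : SmoothSections covT covV k p,
          ‖smoothAction covT covV k p A (g γ) ξ‖ ^ p =
            Λ γ fun _ => (ξ : SobolevSpace covT covV k p) := by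
  have : ContinuousSMul G M :=
    ⟨(ContMDiffSMul.contMDiff_smul (I := 𝓘(ℝ, EG)) (I' := 𝓡 n) (n := ∞) (G := G)
      (M := M)).continuous⟩
  -- The controlled neighborhoods are centred at the moved points `g γ₀ • x₀`, since after the
  -- substitution the jets of `ξ` are evaluated there. The partition `ρ` then confines `x` to where
  -- `V` is trivialized around `x₀` and `g γ₀ • x` is controlled.
  choose c W δ C hW using fun x₀ : M => exists_isControlled n F V (g γ₀ • x₀)
  have hOo : ∀ x₀ : M, IsOpen (vbase F V x₀ ∩ {x | g γ₀ • x ∈ W x₀}) := fun x₀ =>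
    (isOpen_vbase x₀).inter ((hW x₀).isOpen.preimage (continuous_const_smul (g γ₀)))
  obtain ⟨ρ, hρ⟩ := SmoothPartitionOfUnity.exists_isSubordinate (𝓡 n) (s := (Set.univ : Set M))
    isClosed_univ _ hOo fun x _ => Set.mem_iUnion.2 ⟨x, mem_vbase x, (hW x).mem⟩
  set s := (ρ.locallyFinite.finite_nonempty_of_compact).toFinset with hs
  have hsum : ∀ x, ∑ j ∈ s, ρ j x = 1 := by
    intro x
    rw [← ρ.sum_eq_one (Set.mem_univ x)]
    refine (finsum_eq_sum_of_support_subset _ fun j hj => ?_).symm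
    rw [hs, Set.Finite.coe_toFinset]
    exact ⟨x, hj⟩
  -- One piece for each order of differentiation, chart of the volume measure and member of `ρ`.
  -- Only the finitely many in `t` contribute, so the intersection of their neighborhoods is open.
  choose N' Λ hN'o hN' hΛ hΛe using fun q : Fin (k + 1) × M × M =>
    exists_chartIntegral_eq covT covV A (hW q.2.2) hN hg hγ₀ (ρ q.2.2).contMDiff (hρ q.2.2)
      (i := q.1) (k := k) (by omega) hp q.2.1
  set t : Finset (Fin (k + 1) × M × M) := Finset.univ ×ˢ activeCharts n M ×ˢ s with ht
  refine ⟨⋂ q ∈ t, N' q, fun γ => ∑ q ∈ t, Λ q γ, isOpen_biInter_finset fun q _ => hN'o q,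
    Set.mem_iInter₂.2 fun q _ => hN' q, ContDiffOn.sum fun q hq =>
      (hΛ q).mono (Set.biInter_subset_of_mem hq), fun γ hγ ξ => ?_⟩
  rw [norm_smoothSections_pow, sum_apply, ht, Finset.sum_product,
    Finset.sum_range]
  refine Finset.sum_congr rfl fun i _ => ?_
  have hc : Continuous fun x => tensorNorm (iterCovDeriv covT covV (A.pullback (g γ) ξ) i) x ^ p :=
    (continuous_tensorNorm_iterCovDeriv covT covV (A.pullback (g γ) ξ).contMDiff i).pow p
  refine (integral_riemannianVolume hc).trans ?_
  rw [Finset.sum_product]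
  refine Finset.sum_congr rfl fun c' hc' => ?_
  rw [chartIntegral_sum_mul c' s (fun j => (ρ j).contMDiff.continuous) hsum hc]
  refine Finset.sum_congr rfl fun x₀ hx₀ => ?_
  exact hΛe (i, c', x₀) γ (Set.mem_iInter₂.1 hγ _ (Finset.mem_product.2
    ⟨Finset.mem_univ _, Finset.mem_product.2 ⟨hc', hx₀⟩⟩)) ξ

/-- The pullback of smooth sections as a linear map. -/
def smoothActionL (k p : ℕ) [Fact (1 ≤ p)] (a : G) :
    SmoothSections covT covV k p →ₗ[ℝ] SmoothSections covT covV k p where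
  toFun := smoothAction covT covV k p A a
  map_add' _ _ := ContMDiffSection.ext fun x => map_add (A.act a x).symm _ _
  map_smul' _ _ := ContMDiffSection.ext fun x => map_smul (A.act a x).symm _ _

/-- The preceding result with `g` the inverse of the chart of `G` at `a₀`, transported back to the
group. -/
lemma exists_contMDiffOn_norm_smoothAction_pow_eq (k : ℕ) {p : ℕ} [Fact (1 ≤ p)] (hp : Even p)
    (a₀ : G) :
    ∃ (O : Set G) (Λ : G → ContinuousMultilinearMap ℝ
        (fun _ : Fin p => SobolevSpace covT covV k p) ℝ),
      IsOpen O ∧ a₀ ∈ O ∧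
      ContMDiffOn 𝓘(ℝ, EG) 𝓘(ℝ, ContinuousMultilinearMap ℝ
        (fun _ : Fin p => SobolevSpace covT covV k p) ℝ) ∞ Λ O ∧
        ∀ a ∈ O, ∀ ξ : SmoothSections covT covV k p, ‖smoothAction covT covV k p A a ξ‖ ^ p =
          Λ a fun _ => (ξ : SobolevSpace covT covV k p) := by
  set φ := extChartAt 𝓘(ℝ, EG) a₀ with hφ
  obtain ⟨N, Λ, hNo, hN, hΛ, hΛe⟩ := exists_norm_smoothAction_pow_eq covT covV A k hp
    (isOpen_extChartAt_target a₀) (contMDiffOn_extChartAt_symm a₀ (I := 𝓘(ℝ, EG)) (n := ∞))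
    (mem_extChartAt_target a₀)
  refine ⟨φ.source ∩ φ ⁻¹' N, Λ ∘ φ,
    (continuousOn_extChartAt a₀).isOpen_inter_preimage (isOpen_extChartAt_source a₀) hNo,
    ⟨mem_extChartAt_source a₀, hN⟩, ?_, fun a ha ξ => ?_⟩
  · refine hΛ.contMDiffOn.comp ((contMDiffOn_extChartAt (n := ∞)).mono fun a ha => ?_)
      fun a ha => ha.2
    rw [← extChartAt_source 𝓘(ℝ, EG)]
    exact ha.1
  · rw [Function.comp_apply, ← hΛe _ ha.2 ξ, φ.left_inv ha.1]

/-- For fixed `a` the multilinear formula gives `‖a · ξ‖ ^ p ≤ ‖Λ a‖ * ‖ξ‖ ^ p`, so the linear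
action of `a` is bounded with constant `‖Λ a‖ ^ (1/p)`. No separate estimate of the pullback is
needed. -/
lemma uniformContinuous_smoothAction (k : ℕ) {p : ℕ} [hp1 : Fact (1 ≤ p)] (hp : Even p) (a : G) :
    UniformContinuous (smoothAction covT covV k p A a) := by
  have hp0 : p ≠ 0 := by have := hp1.out; omega
  obtain ⟨O, Λ, -, ha, -, hΛ⟩ := exists_contMDiffOn_norm_smoothAction_pow_eq covT covV A k hp a
  refine ((smoothActionL covT covV A k p a).mkContinuous (‖Λ a‖ ^ ((p : ℝ)⁻¹))
    fun ξ => ?_).uniformContinuous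
  change ‖smoothAction covT covV k p A a ξ‖ ≤ _
  rw [← pow_le_pow_iff_left₀ (norm_nonneg _) (by positivity) hp0, hΛ a ha ξ, mul_pow,
    Real.rpow_inv_natCast_pow (norm_nonneg _) hp0]
  refine (le_abs_self _).trans (((Λ a).le_opNorm _).trans (le_of_eq ?_))
  simp

/-- Both sides are continuous in `ξ` and agree on the dense image of the smooth sections. -/
lemma norm_inducedAction_pow_eq (k : ℕ) {p : ℕ} [Fact (1 ≤ p)] (hp : Even p) {a : G}
    {L : ContinuousMultilinearMap ℝ (fun _ : Fin p => SobolevSpace covT covV k p) ℝ}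
    (hL : ∀ ξ : SmoothSections covT covV k p, ‖smoothAction covT covV k p A a ξ‖ ^ p =
      L fun _ => (ξ : SobolevSpace covT covV k p)) (ξ : SobolevSpace covT covV k p) :
    ‖inducedAction covT covV k p A a ξ‖ ^ p = L fun _ => ξ := by
  induction ξ using UniformSpace.Completion.induction_on with
  | hp =>
    exact isClosed_eq (UniformSpace.Completion.continuous_map.norm.pow p)
      (L.cont.comp (continuous_pi fun _ => continuous_id))
  | ih ξ =>
    rw [← hL, inducedAction,
      UniformSpace.Completion.map_coe (uniformContinuous_smoothAction covT covV A k hp a),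
      UniformSpace.Completion.norm_coe]

end Assembly

end SobolevAction

end

/-! ### The main theorem -/

theorem mainTheorem10 {n : ℕ}
    {M : Type*} [TopologicalSpace M] [ChartedSpace (EuclideanSpace ℝ (Fin n)) M]
    [IsManifold (𝓡 n) ∞ M] [T2Space M] [CompactSpace M] [MeasurableSpace M] [BorelSpace M]
    [RiemannianBundle (fun x : M => TangentSpace (𝓡 n) x)]
    [IsContMDiffRiemannianBundle (𝓡 n) ∞ (EuclideanSpace ℝ (Fin n))
      (fun x : M => TangentSpace (𝓡 n) x)]
    {F : Type*} [NormedAddCommGroup F] [NormedSpace ℝ F] [FiniteDimensional ℝ F]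
    {V : M → Type*} [TopologicalSpace (TotalSpace F V)]
    [∀ x, NormedAddCommGroup (V x)] [∀ x, InnerProductSpace ℝ (V x)]
    [FiberBundle F V] [VectorBundle ℝ F V] [ContMDiffVectorBundle ∞ F V (𝓡 n)]
    [IsContMDiffRiemannianBundle (𝓡 n) ∞ F V]
    (covT : CovariantDerivative (𝓡 n) (EuclideanSpace ℝ (Fin n))
      (fun x : M => TangentSpace (𝓡 n) x))
    [CovariantDerivative.ContMDiffCovariantDerivative covT ∞]
    (covV : CovariantDerivative (𝓡 n) F V)
    [CovariantDerivative.ContMDiffCovariantDerivative covV ∞]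
    {EG : Type*} [NormedAddCommGroup EG] [NormedSpace ℝ EG] [FiniteDimensional ℝ EG]
    {G : Type*} [TopologicalSpace G] [ChartedSpace EG G] [Group G] [LieGroup 𝓘(ℝ, EG) ∞ G]
    [MulAction G M] [ContMDiffSMul 𝓘(ℝ, EG) (𝓡 n) ∞ G M]
    (A : SobolevAction.BundleAction n EG G F V)
    (k p : ℕ) [Fact (1 ≤ p)] (hp : Even p) :
    (∀ g : G, Continuous (SobolevAction.inducedAction covT covV k p A g)) ∧
    (∀ (g : G) (ξ : SobolevAction.SmoothSections covT covV k p),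
      SobolevAction.inducedAction covT covV k p A g ξ =
        (SobolevAction.smoothAction covT covV k p A g ξ : SobolevAction.SobolevSpace covT covV k p)) ∧
    ContMDiff (𝓘(ℝ, EG).prod 𝓘(ℝ, SobolevAction.SobolevSpace covT covV k p)) 𝓘(ℝ, ℝ) ∞
      (fun q : G × SobolevAction.SobolevSpace covT covV k p =>
        ‖SobolevAction.inducedAction covT covV k p A q.1 q.2‖ ^ p) := by
  -- `UniformSpace.Completion.map` is continuous whatever the underlying map. That it extends
  -- `smoothAction` is the substantial claim, and uniform continuity is what yields it.
  refine ⟨fun _ => UniformSpace.Completion.continuous_map, fun g ξ =>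
    UniformSpace.Completion.map_coe
      (SobolevAction.uniformContinuous_smoothAction covT covV A k hp g) ξ, ?_⟩
  rintro ⟨a₀, ξ₀⟩
  obtain ⟨O, Λ, hO, ha₀, hΛ, hΛe⟩ :=
    SobolevAction.exists_contMDiffOn_norm_smoothAction_pow_eq covT covV A k hp a₀
  have h1 : ContMDiffAt (𝓘(ℝ, EG).prod 𝓘(ℝ, SobolevAction.SobolevSpace covT covV k p))
      𝓘(ℝ, ContinuousMultilinearMap ℝ
        (fun _ : Fin p => SobolevAction.SobolevSpace covT covV k p) ℝ) ∞
      (fun q : G × SobolevAction.SobolevSpace covT covV k p => Λ q.1) (a₀, ξ₀) :=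
    (hΛ.contMDiffAt (hO.mem_nhds ha₀)).comp (a₀, ξ₀) contMDiffAt_fst
  -- Near `(a₀, ξ₀)` the function is the evaluation `(Λ, ξ) ↦ Λ(ξ, …, ξ)`, smooth on a product of
  -- normed spaces, composed with `(a, ξ) ↦ (Λ a, ξ)`.
  have h2 := (SobolevAction.contDiff_multilinear_apply_diag (p := p)
    (ContinuousLinearMap.id ℝ _)).contMDiff.contMDiffAt.comp (a₀, ξ₀) (h1.prodMk_space contMDiffAt_snd)
  refine h2.congr_of_eventuallyEq ?_
  filter_upwards [(hO.preimage continuous_fst).mem_nhds ha₀] with q hq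
  exact SobolevAction.norm_inducedAction_pow_eq covT covV A k hp (hΛe q.1 hq) q.2
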